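/- **Setting.** Let $B$ be a unital complex Banach algebra. A *Banach $B$-$B$-non-commutative probability space* is a triple $(\mathcal A,E,\varepsilon)$ where $\mathcal A$ is a unital complex Banach algebra, $\varepsilon:B\otimes B^{\mathrm{op}}\to\mathcal A$ is a unital homomorphism, and $E:\mathcal A\to B$ is a bounded linear map with $E(1)=1$ such that, writing $L_b=\varepsilon(b\otimes 1)$ and $R_b=\varepsilon(1\otimes b)$, the maps $b\mapsto L_b$ and $b\mapsto R_b$ are injective and bounded, and $E(L_{b_1}R_{b_2}Z)=b_1E(Z)b_2$, $E(ZL_b)=E(ZR_b)$ for all $b,b_1,b_2\in B$, $Z\in\mathcal A$. Put $\mathcal A_\ell=\{Z: ZR_b=R_bZ\ \forall b\in B\}$ and $\mathcal A_r=\{Z: ZL_b=L_bZ\ \forall b\in B\}$. **Cumulants.** For $\chi:\{1,\dots,n\}\to\{\ell,r\}$ let $\prec_\chi$ be the total order on $\{1,\dots,n\}$ that lists $\chi^{-1}(\ell)$ increasingly and then $\chi^{-1}(r)$ decreasingly, and let $BNC(\chi)$ be the set of partitions of $\{1,\dots,n\}$ that are non-crossing with respect to $\prec_\chi$, ordered by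 refinement, with largest element $1_\chi$ and Möbius function $\mu_{BNC}$. For $\pi\in BNC(\chi)$ and $Z_k\in\mathcal A_{\chi(k)}$ let $E^B_\pi(Z_1,\dots,Z_n)\in B$ be the bi-free moment function, i.e. the bi-multiplicative function with $E^B_{1_\chi}(Z_1,\dots,Z_n)=E(Z_1\cdots Z_n)$. Explicitly, with value $1$ for the empty partition, it is given by the following recursion: if $V$ is the block containing the $\prec_\chi$-smallest index, replace, for each $k\in V$ that is not the $\prec_\chi$-largest element of $V$, the operator $Z_k$ by $Z_kL_a$ if $\chi(k)=\ell$ and by $R_aZ_k$ if $\chi(k)=r$, where $a$ is the value of $E^B$ on the restriction of $\pi$ to the indices strictly between $k$ and the $\prec_\chi$-next element of $V$; then $E^B_\pi(Z_1,\dots,Z_n)$ is $E$ of the product, in the usual order of the indices, of the so modified $Z_k$, $k\in V$, multiplied on the right by the value of $E^B$ on the restriction of $\pi$ to the indices $\prec_\chi$-after all of $V$. Put $$\kappa^B_\chi(Z_1,\dots,Z_n)=\sum_{\sigma\in BNC(\chi)}\mu_{BNC}(\sigma,1_\chi)\,E^B_\sigma(Z_1,\dots,Z_n).$$ Let $\chi_{n,m}:\{1,\dots,n+m\}\to\{\ell,r\}$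 be $\ell$ on the first $n$ indices and $r$ on the last $m$. **Series.** For $X\in\mathcal A_\ell$, $Y\in\mathcal A_r$ and $b,c,d\in B$ let $$M^\ell_X(b)=1+\sum_{n\ge1}E((L_bX)^n),\qquad M^r_Y(d)=1+\sum_{n\ge1}E((R_dY)^n),\qquad M_{X,Y}(b,c,d)=\sum_{n,m\ge0}E((L_bX)^n(R_dY)^mR_c),$$ $$C_{X,Y}(b,c,d)=c+\sum_{n\ge1}\kappa^B_{\chi_{n,0}}(\underbrace{L_bX,\dots,L_bX}_{n-1},L_bXL_c)+\sum_{m\ge1,\,n\ge0}\kappa^B_{\chi_{n,m}}(\underbrace{L_bX,\dots,L_bX}_{n},\underbrace{R_dY,\dots,R_dY}_{m-1},R_dYR_c).$$ **Theorem.** Let $(\mathcal A,E,\varepsilon)$ be a Banach $B$-$B$-non-commutative probability space, $X\in\mathcal A_\ell$ and $Y\in\mathcal A_r$. There is $\delta>0$ such that for all $b,c,d\in B$ with $\|b\|<\delta$ and $\|d\|<\delta$ the series $M^\ell_X(b)$, $M^r_Y(d)$, $M_{X,Y}(b,c,d)$, $C_{X,Y}(b,c,d)$ and $C_{X,Y}\big(M^\ell_X(b)b,\,M_{X,Y}(b,c,d),\,dM^r_Y(d)\big)$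 converge absolutely, and $$M^\ell_X(b)M_{X,Y}(b,c,d)+M_{X,Y}(b,c,d)M^r_Y(d)=M^\ell_X(b)\,c\,M^r_Y(d)+C_{X,Y}\big(M^\ell_X(b)b,\;M_{X,Y}(b,c,d),\;dM^r_Y(d)\big).$$ -/

import Mathlib

open scoped TensorProduct

noncomputable section

namespace BiFree

/-! ### Bi-non-crossing partitions -/

/-- The labels `ℓ` and `r`. -/
inductive Side where
  | left
  | right

/-- A key realising the order `≺_χ`: the left indices in increasing order come first, followed by
the right indices in decreasing order. -/
def chiKey {n : ℕ} (χ : Fin n → Side) (k : Fin n) : ℕ :=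
  match χ k with
  | Side.left => (k : ℕ)
  | Side.right => 2 * n - (k : ℕ)

/-- The strict order `i ≺_χ j`. -/
def Prec {n : ℕ} (χ : Fin n → Side) (i j : Fin n) : Prop :=
  chiKey χ i < chiKey χ j

/-- `π` (a partition of the indices, given as an equivalence relation) is bi-non-crossing with
respect to `χ`. -/
def IsBiNonCrossing {n : ℕ} (χ : Fin n → Side) (π : Setoid (Fin n)) : Prop :=
  ∀ u₁ v₁ u₂ v₂ : Fin n, Prec χ u₁ v₁ → Prec χ v₁ u₂ → Prec χ u₂ v₂ →
    π u₁ u₂ → π v₁ v₂ → π u₁ v₁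

/-- `BNC(χ)`, ordered by refinement (`π ≤ σ` when every block of `π` lies in a block of `σ`). -/
abbrev BNC {n : ℕ} (χ : Fin n → Side) : Type :=
  {π : Setoid (Fin n) // IsBiNonCrossing χ π}

/-- The maximal element `1_χ`, with a single block. -/
def BNC.one {n : ℕ} (χ : Fin n → Side) : BNC χ :=
  ⟨⊤, fun _ _ _ _ _ _ _ _ _ => trivial⟩

instance BNC.instFinite {n : ℕ} (χ : Fin n → Side) : Finite (BNC χ) :=
  Finite.of_injective (fun (π : BNC χ) (i j : Fin n) => π.1 i j) (fun _ _ h =>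
    Subtype.ext (Setoid.ext (fun i j => iff_of_eq (congrFun (congrFun h i) j))))

instance BNC.instFintype {n : ℕ} (χ : Fin n → Side) : Fintype (BNC χ) :=
  Fintype.ofFinite _

open Classical in
instance BNC.instLocallyFiniteOrder {n : ℕ} (χ : Fin n → Side) : LocallyFiniteOrder (BNC χ) :=
  Fintype.toLocallyFiniteOrder

open Classical in
/-- The bi-non-crossing Möbius function: the Möbius function of the poset `BNC(χ)`. -/
def muBNC {n : ℕ} {χ : Fin n → Side} (σ π : BNC χ) : ℂ :=
  IncidenceAlgebra.mu ℂ σ π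

/-- The map `χ_{n,m}`: `n` left indices followed by `m` right indices. -/
def chi (n m : ℕ) : Fin (n + m) → Side :=
  fun k => if (k : ℕ) < n then Side.left else Side.right

/-! ### `B`-`B`-non-commutative probability spaces -/

/-- A `B`-`B`-non-commutative probability space `(A, E, ε)`. -/
structure BBSpace (B A : Type*) [Ring B] [Algebra ℂ B] [Ring A] [Algebra ℂ A] where
  ε : B ⊗[ℂ] Bᵐᵒᵖ →ₐ[ℂ] A
  E : A →ₗ[ℂ] B
  injective_left : Function.Injective (fun b : B => ε (b ⊗ₜ[ℂ] (1 : Bᵐᵒᵖ)))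
  injective_right : Function.Injective (fun b : B => ε ((1 : B) ⊗ₜ[ℂ] MulOpposite.op b))
  E_one : E 1 = 1
  E_bimodule : ∀ (b₁ b₂ : B) (Z : A),
    E (ε (b₁ ⊗ₜ[ℂ] MulOpposite.op b₂) * Z) = b₁ * E Z * b₂
  E_left_eq_right : ∀ (b : B) (Z : A),
    E (Z * ε (b ⊗ₜ[ℂ] (1 : Bᵐᵒᵖ))) = E (Z * ε ((1 : B) ⊗ₜ[ℂ] MulOpposite.op b))

namespace BBSpace

section Algebraic

variable {B A : Type*} [Ring B] [Algebra ℂ B] [Ring A] [Algebra ℂ A]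

/-- `L_b = ε(b ⊗ 1)`. -/
def L (S : BBSpace B A) (b : B) : A := S.ε (b ⊗ₜ[ℂ] (1 : Bᵐᵒᵖ))

/-- `R_b = ε(1 ⊗ b)`. -/
def R (S : BBSpace B A) (b : B) : A := S.ε ((1 : B) ⊗ₜ[ℂ] MulOpposite.op b)

/-- The left algebra `A_ℓ`. -/
def leftAlgebra (S : BBSpace B A) : Subalgebra ℂ A :=
  Subalgebra.centralizer ℂ (Set.range S.R)

/-- The right algebra `A_r`. -/
def rightAlgebra (S : BBSpace B A) : Subalgebra ℂ A :=
  Subalgebra.centralizer ℂ (Set.range S.L)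

end Algebraic

end BBSpace

/-! ### The moment and cumulant functions -/

section Blocks

open Classical in
/-- The part in `T` of the block of `π` that contains the `≺_χ`-smallest element of `T`. -/
def firstBlock {n : ℕ} (χ : Fin n → Side) (π : Setoid (Fin n)) (T : Finset (Fin n)) :
    Finset (Fin n) :=
  T.filter (fun k => ∃ p ∈ T, (∀ j ∈ T, ¬ Prec χ j p) ∧ π p k)

open Classical in
/-- The elements of `T` strictly between `k` and the `≺_χ`-next element of the first block `V` of
`T` (empty if `k` is the `≺_χ`-largest element of `V`). -/
def gap {n : ℕ} (χ : Fin n → Side) (π : Setoid (Fin n)) (T : Finset (Fin n)) (k : Fin n) :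
    Finset (Fin n) :=
  (T \ firstBlock χ π T).filter (fun j => Prec χ k j ∧ (∃ v ∈ firstBlock χ π T, Prec χ j v) ∧
    ∀ v ∈ firstBlock χ π T, Prec χ k v → Prec χ j v)

open Classical in
/-- The elements of `T` that come `≺_χ`-after all of the first block of `T`. -/
def rest {n : ℕ} (χ : Fin n → Side) (π : Setoid (Fin n)) (T : Finset (Fin n)) :
    Finset (Fin n) :=
  (T \ firstBlock χ π T).filter (fun j => ∀ v ∈ firstBlock χ π T, Prec χ v j)

theorem firstBlock_nonempty {n : ℕ} (χ : Fin n → Side) (π : Setoid (Fin n))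
    {T : Finset (Fin n)} (hT : T ≠ ∅) : (firstBlock χ π T).Nonempty := by
  obtain ⟨p, hp, hmin⟩ := T.exists_min_image (chiKey χ) (Finset.nonempty_iff_ne_empty.mpr hT)
  refine ⟨p, ?_⟩
  simp only [firstBlock, Finset.mem_filter]
  exact ⟨hp, p, hp, fun j hj => not_lt.mpr (hmin j hj), π.refl p⟩

theorem card_sdiff_firstBlock_lt {n : ℕ} (χ : Fin n → Side) (π : Setoid (Fin n))
    {T : Finset (Fin n)} (hT : T ≠ ∅) : (T \ firstBlock χ π T).card < T.card := by
  obtain ⟨p, hp⟩ := firstBlock_nonempty χ π hT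
  refine Finset.card_lt_card ⟨Finset.sdiff_subset, fun h => ?_⟩
  have hpT : p ∈ T := by
    simp only [firstBlock, Finset.mem_filter] at hp
    exact hp.1
  exact (Finset.mem_sdiff.mp (h hpT)).2 hp

open Classical in
theorem card_gap_lt {n : ℕ} (χ : Fin n → Side) (π : Setoid (Fin n))
    {T : Finset (Fin n)} (hT : T ≠ ∅) (k : Fin n) : (gap χ π T k).card < T.card :=
  lt_of_le_of_lt (Finset.card_filter_le _ _) (card_sdiff_firstBlock_lt χ π hT)

open Classical in
theorem card_rest_lt {n : ℕ} (χ : Fin n → Side) (π : Setoid (Fin n))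
    {T : Finset (Fin n)} (hT : T ≠ ∅) : (rest χ π T).card < T.card :=
  lt_of_le_of_lt (Finset.card_filter_le _ _) (card_sdiff_firstBlock_lt χ π hT)

end Blocks

namespace BBSpace

section Functions

variable {B A : Type*} [Ring B] [Algebra ℂ B] [Ring A] [Algebra ℂ A]

/-- Multiply `Z` by the element `b` of `B` that sits `≺_χ`-directly after it:
`Z L_b` for a left operator, `R_b Z` for a right operator. -/
def insertAfter (S : BBSpace B A) (s : Side) (Z : A) (b : B) : A :=
  match s with
  | Side.left => Z * S.L b
  | Side.right => S.R b * Z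

/-- The operator-valued bi-free moment function of the restriction of `π` to `T`, computed by the
reduction rules of a bi-multiplicative function whose value on a single block is `E` of the product
in the given order.  The first block `V` of `T` and whatever is nested in it form an initial
`≺_χ`-interval, which splits off as a left factor; each gap of `V` is replaced by its value in `B`,
which is attached to the element of `V` directly before the gap. -/
def momentOn (S : BBSpace B A) {n : ℕ} (χ : Fin n → Side) (π : Setoid (Fin n)) (Z : Fin n → A)
    (T : Finset (Fin n)) : B :=
  open Classical in
  if hT : T = ∅ then 1
  else
    S.E (((firstBlock χ π T).sort (· ≤ ·)).map
        (fun k => S.insertAfter (χ k) (Z k) (S.momentOn χ π Z (gap χ π T k)))).prod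
      * S.momentOn χ π Z (rest χ π T)
termination_by T.card
decreasing_by
  · exact card_gap_lt χ π hT k
  · exact card_rest_lt χ π hT

/-- The operator-valued bi-free moment function `E^B_π(Z₁, …, Zₙ)`. -/
def moment (S : BBSpace B A) {n : ℕ} {χ : Fin n → Side} (π : BNC χ) (Z : Fin n → A) : B :=
  S.momentOn χ π.1 Z Finset.univ

open Classical in
/-- The operator-valued bi-free cumulant function `κ^B_π(Z₁, …, Zₙ)`. -/
def cumulant (S : BBSpace B A) {n : ℕ} {χ : Fin n → Side} (π : BNC χ) (Z : Fin n → A) : B :=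
  ∑ σ : BNC χ with σ ≤ π, muBNC σ π • S.moment σ Z

/-- `κ^B_χ = κ^B_{1_χ}`. -/
def kappa (S : BBSpace B A) {n : ℕ} (χ : Fin n → Side) (Z : Fin n → A) : B :=
  S.cumulant (BNC.one χ) Z

/-! ### The terms of the series -/

/-- `κ_{χ_{n,0}}(L_b X, …, L_b X, L_b X L_c)`, with `n` entries. -/
def leftTerm (S : BBSpace B A) (X : A) (b c : B) (n : ℕ) : B :=
  S.kappa (chi n 0) (fun k => if (k : ℕ) + 1 = n then S.L b * X * S.L c else S.L b * X)

/-- `κ_{χ_{n,m}}(L_b X, …, L_b X, R_d Y, …, R_d Y, R_d Y R_c)`, with `n` left entries and `m` right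
entries (used for `m ≥ 1`). -/
def mixedTerm (S : BBSpace B A) (X Y : A) (b c d : B) (n m : ℕ) : B :=
  S.kappa (chi n m) (fun k =>
    if (k : ℕ) < n then S.L b * X
    else if (k : ℕ) + 1 = n + m then S.R d * Y * S.R c else S.R d * Y)

end Functions

section Banach

variable {B A : Type*} [NormedRing B] [NormedAlgebra ℂ B] [NormedRing A] [NormedAlgebra ℂ A]

/-- The boundedness requirements in a Banach `B`-`B`-non-commutative probability space. -/
structure IsBanach (S : BBSpace B A) : Prop where
  E_bounded : ∃ K : ℝ, ∀ Z : A, ‖S.E Z‖ ≤ K * ‖Z‖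
  L_bounded : ∃ K : ℝ, ∀ b : B, ‖S.L b‖ ≤ K * ‖b‖
  R_bounded : ∃ K : ℝ, ∀ b : B, ‖S.R b‖ ≤ K * ‖b‖

/-- `M^ℓ_X(b) = 1 + ∑_{n ≥ 1} E((L_b X)^n)`. -/
def Ml (S : BBSpace B A) (X : A) (b : B) : B :=
  1 + ∑' n : ℕ, S.E ((S.L b * X) ^ (n + 1))

/-- `M^r_Y(d) = 1 + ∑_{n ≥ 1} E((R_d Y)^n)`. -/
def Mr (S : BBSpace B A) (Y : A) (d : B) : B :=
  1 + ∑' n : ℕ, S.E ((S.R d * Y) ^ (n + 1))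

/-- `M_{X,Y}(b,c,d) = ∑_{n,m ≥ 0} E((L_b X)^n (R_d Y)^m R_c)`. -/
def M (S : BBSpace B A) (X Y : A) (b c d : B) : B :=
  ∑' p : ℕ × ℕ, S.E ((S.L b * X) ^ p.1 * (S.R d * Y) ^ p.2 * S.R c)

/-- The cumulant series `C_{X,Y}(b,c,d)`. -/
def C (S : BBSpace B A) (X Y : A) (b c d : B) : B :=
  c + ∑' n : ℕ, S.leftTerm X b c (n + 1)
    + ∑' p : ℕ × ℕ, S.mixedTerm X Y b c d p.1 (p.2 + 1)

/-- Absolute convergence of the series `M^ℓ_X(b)`. -/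
def MlConverges (S : BBSpace B A) (X : A) (b : B) : Prop :=
  Summable fun n : ℕ => ‖S.E ((S.L b * X) ^ (n + 1))‖

/-- Absolute convergence of the series `M^r_Y(d)`. -/
def MrConverges (S : BBSpace B A) (Y : A) (d : B) : Prop :=
  Summable fun n : ℕ => ‖S.E ((S.R d * Y) ^ (n + 1))‖

/-- Absolute convergence of the series `M_{X,Y}(b,c,d)`. -/
def MConverges (S : BBSpace B A) (X Y : A) (b c d : B) : Prop :=
  Summable fun p : ℕ × ℕ => ‖S.E ((S.L b * X) ^ p.1 * (S.R d * Y) ^ p.2 * S.R c)‖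

/-- Absolute convergence of the two series in `C_{X,Y}(b,c,d)`. -/
def CConverges (S : BBSpace B A) (X Y : A) (b c d : B) : Prop :=
  (Summable fun n : ℕ => ‖S.leftTerm X b c (n + 1)‖) ∧
    Summable fun p : ℕ × ℕ => ‖S.mixedTerm X Y b c d p.1 (p.2 + 1)‖

end Banach

end BBSpace

end BiFree

end

/-!
Let `K (w, j)` be the sum of the cumulants of a word `w` over all partitions in which the first `j`
letters with respect to `≺_χ` lie in one block; it interpolates between the moment of `w` (`j ≤ 1`)
and its cumulant (`j` the length of `w`). Sorting the partitions by the gap between the `j`-th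
letter and the next letter of its block, and summing over all partitions of the gap, replaces the
gap by its moment, so that `K (w, j)` is a sum of terms `K (w', j + 1)` in which an initial piece
`g` of what follows the `j`-th letter has been replaced by the coefficient `E(g)`.

Put `x = L_b X`, `y = R_d Y`, `l = M^ℓ_X(b)`, `r = M^r_Y(d)`, `m = M_{X,Y}(b,c,d)`. Summing over all
words `x ⋯ x c y ⋯ y`, the gaps between two letters `x` add up to `l`, those between two letters `y`
to `r`, and the gap between the last `x` and the first `y`, which contains `c`, to `m`. Iterating
the recursion thus gives, with `z[a]` for the letter `z` followed by the coefficient `a`,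
`∑_{n, k ≥ 0} κ(x[l], …, x[l], x[m], y[r], …, y[r]) = m - c r` (with `n` letters `x[l]` and `k`
letters `y[r]`), and similarly `∑_{k ≥ 1} κ(y[r], …, y[r]) = r - 1`. Moving the coefficients from
behind a letter to the front of the next one turns these series into those of `C`, so that
`C(l b, m, d r) = m + l (m - c r) + m (r - 1)`. The same recursion bounds the cumulants of `w`
exponentially in its length, whence the convergence for small `b` and `d`.
-/

noncomputable section

namespace BiFree

/-! ### Möbius inversion and summation -/

section Moebius

variable {α 𝕜 E : Type*} [Fintype α] [PartialOrder α] [DecidableLE α] [AddCommGroup E]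

theorem sum_le_sum_mu_smul [LocallyFiniteOrder α] [DecidableEq α] [Ring 𝕜] [Module 𝕜 E]
    (g : α → E) (x : α) :
    ∑ y with y ≤ x, ∑ z with z ≤ y, IncidenceAlgebra.mu 𝕜 z y • g z = g x := by
  have sum_mu (z : α) : ∑ y with y ≤ x, IncidenceAlgebra.mu 𝕜 z y = if z = x then 1 else 0 := by
    rw [← IncidenceAlgebra.sum_Icc_mu_right]
    refine (Finset.sum_subset (fun y hy => ?_) fun y hy hzy => ?_).symm
    · simpa using (Finset.mem_Icc.1 hy).2
    · exact IncidenceAlgebra.apply_eq_zero_of_not_le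
        (fun h => hzy (Finset.mem_Icc.2 ⟨h, by simpa using hy⟩)) _
  calc ∑ y with y ≤ x, ∑ z with z ≤ y, IncidenceAlgebra.mu 𝕜 z y • g z
      = ∑ y with y ≤ x, ∑ z, IncidenceAlgebra.mu 𝕜 z y • g z :=
        Finset.sum_congr rfl fun y _ => Finset.sum_subset (Finset.filter_subset _ _)
          fun z _ hz => by
            rw [IncidenceAlgebra.apply_eq_zero_of_not_le (by simpa using hz), zero_smul]
    _ = ∑ z, (∑ y with y ≤ x, IncidenceAlgebra.mu 𝕜 z y) • g z := by
        rw [Finset.sum_comm]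
        exact Finset.sum_congr rfl fun z _ => Finset.sum_smul.symm
    _ = g x := by simp [sum_mu]

theorem eq_of_forall_sum_le_eq {f g : α → E}
    (h : ∀ x, ∑ y with y ≤ x, f y = ∑ y with y ≤ x, g y) : f = g := by
  classical
  funext x
  induction x using WellFoundedLT.induction with
  | _ x ih =>
    have split (φ : α → E) : ∑ y with y ≤ x, φ y = φ x + ∑ y with y < x, φ y := by
      rw [← Finset.sum_insert (by simp)]
      congr 1
      ext y
      simp [le_iff_eq_or_lt]
    have hx := h x
    rw [split, split, Finset.sum_congr rfl fun y hy => ih y (Finset.mem_filter.1 hy).2] at hx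
    exact add_right_cancel hx

end Moebius

section Sums

open Finset.HasAntidiagonal (antidiagonal mem_antidiagonal)

variable {E F ι κ : Type*} [NormedAddCommGroup E] [NormedAddCommGroup F]

theorem hasSum_sum_antidiagonal_prod {f : (ℕ × ℕ) × κ → E} {a : E} (h : HasSum f a) :
    HasSum (fun q : ℕ × κ => ∑ p ∈ antidiagonal q.1, f (p, q.2)) a := by
  let e : (Σ q : ℕ × κ, antidiagonal q.1) ≃ (ℕ × ℕ) × κ :=
    { toFun x := (x.2, x.1.2)
      invFun x := ⟨(x.1.1 + x.1.2, x.2), x.1, mem_antidiagonal.2 rfl⟩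
      left_inv := by
        rintro ⟨⟨n, k⟩, p, hp⟩
        obtain rfl := mem_antidiagonal.1 hp
        rfl
      right_inv _ := rfl }
  refine (e.hasSum_iff.2 h).sigma fun q => ?_
  have := hasSum_fintype fun p : antidiagonal q.1 => f (p, q.2)
  rwa [Finset.sum_coe_sort (antidiagonal q.1) fun p => f (p, q.2)] at this

theorem hasSum_sum_antidiagonal {f : ℕ × ℕ → E} {a : E} (h : HasSum f a) :
    HasSum (fun n => ∑ p ∈ antidiagonal n, f p) a := by
  refine (Finset.HasAntidiagonal.sigmaAntidiagonalEquivProd.hasSum_iff.2 h).sigma fun n => ?_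
  have := hasSum_fintype fun p : antidiagonal n => f p
  rwa [Finset.sum_coe_sort (antidiagonal n) f] at this

theorem hasSum_sum_range_prod {f : (ℕ × ℕ) × κ → E} {a : E} (h : HasSum f a) :
    HasSum (fun q : ℕ × κ => ∑ s ∈ Finset.range q.1, f ((s, q.1 - 1 - s), q.2)) a := by
  have hinj : Function.Injective fun q : ℕ × κ => (q.1 + 1, q.2) :=
    Nat.succ_injective.prodMap Function.injective_id
  refine (hinj.hasSum_iff ?_).1 ?_
  · rintro ⟨_ | n, k⟩ hn
    · rfl
    · exact absurd ⟨(n, k), rfl⟩ hn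
  · convert hasSum_sum_antidiagonal_prod h using 2 with q
    exact (Finset.Nat.sum_antidiagonal_eq_sum_range_succ (fun i j => f ((i, j), q.2)) q.1).symm

theorem tsum_prod_eq_zero_add [CompleteSpace E] {f : ℕ × ℕ → E} (hf : Summable f) :
    ∑' p, f p = ∑' m, f (0, m) + ∑' p : ℕ × ℕ, f (p.1 + 1, p.2) := by
  have hinj : Function.Injective fun q : ℕ × ℕ => (q.1 + 1, q.2) :=
    Nat.succ_injective.prodMap Function.injective_id
  have hsucc : Summable fun p : ℕ × ℕ => f (p.1 + 1, p.2) := hf.comp_injective hinj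
  have hrows := hf.hasSum.prod_fiberwise fun n => (hf.prod_factor n).hasSum
  rw [hsucc.tsum_prod, ← hrows.tsum_eq, hrows.summable.tsum_eq_zero_add]

theorem hasSum_prod_apply [CompleteSpace E] [CompleteSpace F] (φ : κ → E →+ F) {C : κ → ℝ}
    (hC : Summable C) (hφ : ∀ k b, ‖φ k b‖ ≤ C k * ‖b‖) {e : ι → E}
    (he : Summable fun i => ‖e i‖) :
    HasSum (fun p : ι × κ => φ p.2 (e p.1)) (∑' k, φ k (∑' i, e i)) := by
  have hsum : Summable fun p : κ × ι => φ p.1 (e p.2) := by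
    refine Summable.of_norm_bounded (g := fun p : κ × ι => |C p.1| * ‖e p.2‖) ?_ fun p => ?_
    · exact hC.abs.mul_of_nonneg he (fun _ => abs_nonneg _) fun _ => norm_nonneg _
    · exact (hφ _ _).trans (mul_le_mul_of_nonneg_right (le_abs_self _) (norm_nonneg _))
  have hrows (k : κ) : HasSum (fun i => φ k (e i)) (φ k (∑' i, e i)) :=
    he.of_norm.hasSum.map (φ k) (AddMonoidHomClass.continuous_of_bound (φ k) (C k) (hφ k))
  rw [(hsum.hasSum.prod_fiberwise hrows).tsum_eq]
  exact (Equiv.prodComm ι κ).hasSum_iff.2 hsum.hasSum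

theorem hasSum_of_eq_add_succ {θ κ : ℕ → E} (h : ∀ q, θ q = κ q + θ (q + 1))
    (hκ : Summable κ) (hθ : Filter.Tendsto θ Filter.atTop (nhds 0)) : HasSum κ (θ 0) := by
  obtain rfl : κ = fun q => θ q - θ (q + 1) := funext fun q => by rw [h q, add_sub_cancel_right]
  rw [hκ.hasSum_iff_tendsto_nat]
  simpa only [Finset.sum_range_sub', sub_zero] using hθ.const_sub (θ 0)

theorem summable_mul_half_pow (C : ℝ) : Summable fun n : ℕ => C * (1 / 2) ^ n :=
  summable_geometric_two.mul_left C

theorem summable_mul_half_pow_mul_half_pow (C : ℝ) :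
    Summable fun q : ℕ × ℕ => C * ((1 / 2) ^ q.1 * (1 / 2) ^ q.2) :=
  (summable_geometric_two.mul_of_nonneg summable_geometric_two (fun _ => by positivity)
    fun _ => by positivity).mul_left C

end Sums

section Norms

variable {B A : Type*} [SeminormedAddCommGroup B] [NormedRing A] {Γ : ℝ}

theorem exists_pos_forall_norm_mul_le {f : B → A} (hf : ∀ b, ‖f b‖ ≤ Γ * ‖b‖) (Z : A) {ε : ℝ}
    (hε : 0 < ε) : ∃ δ > 0, ∀ b, ‖b‖ < δ → ‖f b * Z‖ ≤ ε := by
  have hzero : Filter.Tendsto (fun b => ‖f b * Z‖) (nhds 0) (nhds 0) := by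
    refine squeeze_zero (fun _ => norm_nonneg _) (fun b => (norm_mul_le _ _).trans
      (mul_le_mul_of_nonneg_right (hf b) (norm_nonneg Z))) ?_
    have : Continuous fun b : B => Γ * ‖b‖ * ‖Z‖ := by fun_prop
    simpa using this.tendsto 0
  obtain ⟨δ, hδ, hball⟩ := Metric.eventually_nhds_iff.1 (hzero.eventually_le_const hε)
  exact ⟨δ, hδ, fun b hb => hball (by rwa [dist_zero_right])⟩

theorem mul_norm_le_half_of_norm_le_mul (hΓ : 0 < Γ) {a : B} {Z Z' : A} (ha : ‖a‖ ≤ Γ * 2)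
    (hZ : ‖Z‖ ≤ 1 / (4 * Γ ^ 3)) (hZ' : ‖Z'‖ ≤ Γ * ‖a‖ * ‖Z‖) : Γ * ‖Z'‖ ≤ 1 / 2 :=
  calc Γ * ‖Z'‖ ≤ Γ * (Γ * (Γ * 2) * (1 / (4 * Γ ^ 3))) := by
        gcongr
        exact hZ'.trans (by gcongr)
    _ = 1 / 2 := by field_simp; norm_num

end Norms

/-! ### The order `≺_χ` and the moment function -/

theorem sum_filter_sum_filter_and_eq {α β E : Type*} [Fintype α] [Fintype β] [DecidableEq β]
    [AddCommMonoid E] (p : α → Prop) [DecidablePred p] (q : β → Prop) [DecidablePred q]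
    (r : α → β) (f : α → E) :
    ∑ b with q b, ∑ a with p a ∧ r a = b, f a = ∑ a with p a ∧ q (r a), f a := by
  rw [← Finset.sum_fiberwise_of_maps_to (s := {a | p a ∧ q (r a)}) (t := {b | q b}) (g := r)
    (by simp)]
  refine Finset.sum_congr rfl fun b hb => Finset.sum_congr ?_ fun _ _ => rfl
  ext a
  simp only [Finset.mem_filter, Finset.mem_univ, true_and] at hb ⊢
  exact ⟨fun ⟨hp, hr⟩ => ⟨⟨hp, hr ▸ hb⟩, hr⟩, fun ⟨⟨hp, _⟩, hr⟩ => ⟨hp, hr⟩⟩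

section Order

variable {N : ℕ} {χ : Fin N → Side}

theorem Prec.trans {i j k : Fin N} (hij : Prec χ i j) (hjk : Prec χ j k) : Prec χ i k :=
  lt_trans hij hjk

theorem Prec.irrefl (i : Fin N) : ¬ Prec χ i i := lt_irrefl _

theorem Prec.asymm {i j : Fin N} (h : Prec χ i j) : ¬ Prec χ j i := lt_asymm h

theorem prec_left_left {i j : Fin N} (hi : χ i = Side.left) (hj : χ j = Side.left) :
    Prec χ i j ↔ i < j := by
  simp [Prec, chiKey, hi, hj]

theorem prec_left_right {i j : Fin N} (hi : χ i = Side.left) (hj : χ j = Side.right) :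
    Prec χ i j := by
  simp only [Prec, chiKey, hi, hj]
  omega

theorem prec_right_right {i j : Fin N} (hi : χ i = Side.right) (hj : χ j = Side.right) :
    Prec χ i j ↔ j < i := by
  simp only [Prec, chiKey, hi, hj]
  omega

theorem not_prec_right_left {i j : Fin N} (hi : χ i = Side.right) (hj : χ j = Side.left) :
    ¬ Prec χ i j :=
  (prec_left_right hj hi).asymm

theorem chiKey_injective (χ : Fin N → Side) : Function.Injective (chiKey χ) := by
  intro i j hij
  unfold chiKey at hij
  split at hij <;> split at hij <;> omega

theorem not_prec_iff {i j : Fin N} (hij : i ≠ j) : ¬ Prec χ i j ↔ Prec χ j i :=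
  not_lt.trans ((chiKey_injective χ).ne hij).symm.le_iff_lt

theorem exists_prec_min (χ : Fin N → Side) {T : Finset (Fin N)} (hT : T ≠ ∅) :
    ∃ p ∈ T, ∀ j ∈ T, ¬ Prec χ j p := by
  obtain ⟨p, hp, hmin⟩ := T.exists_min_image (chiKey χ) (Finset.nonempty_iff_ne_empty.mpr hT)
  exact ⟨p, hp, fun j hj => not_lt.mpr (hmin j hj)⟩

theorem eq_left_of_lt_of_not_prec {k v : Fin N} (hkv : ¬ Prec χ k v) (hlt : v < k) :
    χ v = Side.left := by
  cases hv : χ v with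
  | left => rfl
  | right =>
    cases hk : χ k with
    | left => exact absurd (prec_left_right hk hv) hkv
    | right => exact absurd ((prec_right_right hk hv).2 hlt) hkv

theorem not_lt_of_left_of_not_prec {k v : Fin N} (hkv : ¬ Prec χ k v) (hk : χ k = Side.left) :
    ¬ k < v := fun hlt => by
  cases hv : χ v with
  | left => exact hkv ((prec_left_left hk hv).2 hlt)
  | right => exact hkv (prec_left_right hk hv)

theorem mem_firstBlock {π : Setoid (Fin N)} {T : Finset (Fin N)} {p : Fin N} (hp : p ∈ T)
    (hmin : ∀ j ∈ T, ¬ Prec χ j p) (k : Fin N) : k ∈ firstBlock χ π T ↔ k ∈ T ∧ π p k := by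
  simp only [firstBlock, Finset.mem_filter]
  refine and_congr_right fun _ => ⟨?_, fun hpk => ⟨p, hp, hmin, hpk⟩⟩
  rintro ⟨q, hq, hqmin, hqk⟩
  obtain rfl : p = q := by
    by_contra hpq
    exact hmin q hq ((not_prec_iff hpq).1 (hqmin p hp))
  exact hqk

theorem firstBlock_subset (π : Setoid (Fin N)) (T : Finset (Fin N)) : firstBlock χ π T ⊆ T := by
  classical exact Finset.filter_subset _ _

theorem mem_gap {π : Setoid (Fin N)} {T : Finset (Fin N)} {k j : Fin N} :
    j ∈ gap χ π T k ↔ (j ∈ T ∧ j ∉ firstBlock χ π T) ∧ Prec χ k j ∧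
      (∃ v ∈ firstBlock χ π T, Prec χ j v) ∧ ∀ v ∈ firstBlock χ π T, Prec χ k v → Prec χ j v := by
  simp only [gap, Finset.mem_filter, Finset.mem_sdiff]

theorem mem_rest {π : Setoid (Fin N)} {T : Finset (Fin N)} {j : Fin N} :
    j ∈ rest χ π T ↔ (j ∈ T ∧ j ∉ firstBlock χ π T) ∧ ∀ v ∈ firstBlock χ π T, Prec χ v j := by
  simp only [rest, Finset.mem_filter, Finset.mem_sdiff]

theorem gap_eq_empty_of_last {π : Setoid (Fin N)} {T : Finset (Fin N)} {k : Fin N}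
    (hlast : ∀ v ∈ firstBlock χ π T, ¬ Prec χ k v) : gap χ π T k = ∅ := by
  refine Finset.eq_empty_of_forall_notMem fun j hj => ?_
  obtain ⟨-, hkj, ⟨v, hv, hjv⟩, -⟩ := mem_gap.1 hj
  exact hlast v hv (hkj.trans hjv)

end Order

namespace BBSpace

variable {B A : Type*} [Ring B] [Algebra ℂ B] [Ring A] [Algebra ℂ A] (S : BBSpace B A)

section Operators

theorem L_mul (a b : B) : S.L (a * b) = S.L a * S.L b := by simp [L, ← map_mul]

theorem R_mul (a b : B) : S.R (a * b) = S.R b * S.R a := by simp [R, ← map_mul]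

theorem L_one : S.L 1 = 1 := by
  rw [L, ← Algebra.TensorProduct.one_def, map_one]

theorem R_one : S.R 1 = 1 := by
  rw [R, MulOpposite.op_one, ← Algebra.TensorProduct.one_def, map_one]

theorem L_mul_R (a b : B) : S.L a * S.R b = S.R b * S.L a := by simp [L, R, ← map_mul]

theorem E_L_mul (b : B) (Z : A) : S.E (S.L b * Z) = b * S.E Z := by
  simpa [L] using S.E_bimodule b 1 Z

theorem E_R_mul (b : B) (Z : A) : S.E (S.R b * Z) = S.E Z * b := by
  simpa [R] using S.E_bimodule 1 b Z

theorem E_mul_L (b : B) (Z : A) : S.E (Z * S.L b) = S.E (Z * S.R b) := S.E_left_eq_right b Z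

/-- The algebra in which the operators with a given label live. -/
def sideAlgebra : Side → Subalgebra ℂ A
  | Side.left => S.leftAlgebra
  | Side.right => S.rightAlgebra

theorem R_comm {Z : A} (hZ : Z ∈ S.leftAlgebra) (b : B) : S.R b * Z = Z * S.R b :=
  (Subalgebra.mem_centralizer_iff ℂ).1 hZ _ ⟨b, rfl⟩

theorem L_comm {Z : A} (hZ : Z ∈ S.rightAlgebra) (b : B) : S.L b * Z = Z * S.L b :=
  (Subalgebra.mem_centralizer_iff ℂ).1 hZ _ ⟨b, rfl⟩

theorem L_mem (b : B) : S.L b ∈ S.leftAlgebra := by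
  refine (Subalgebra.mem_centralizer_iff ℂ).2 ?_
  rintro _ ⟨c, rfl⟩
  exact (S.L_mul_R b c).symm

theorem R_mem (b : B) : S.R b ∈ S.rightAlgebra := by
  refine (Subalgebra.mem_centralizer_iff ℂ).2 ?_
  rintro _ ⟨c, rfl⟩
  exact S.L_mul_R c b

variable {S}

theorem insertAfter_mem {s : Side} {Z : A} (hZ : Z ∈ S.sideAlgebra s) (b : B) :
    S.insertAfter s Z b ∈ S.sideAlgebra s :=
  match s with
  | Side.left => mul_mem hZ (S.L_mem b)
  | Side.right => mul_mem (S.R_mem b) hZ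

variable (S)

theorem insertAfter_one (s : Side) (Z : A) : S.insertAfter s Z 1 = Z := by
  cases s <;> simp [insertAfter, L_one, R_one]

theorem insertAfter_insertAfter (s : Side) (Z : A) (a b : B) :
    S.insertAfter s (S.insertAfter s Z a) b = S.insertAfter s Z (a * b) := by
  cases s <;> simp [insertAfter, L_mul, R_mul, mul_assoc]

theorem E_mul_insertAfter_mul {s : Side} {P Z Q : A} (b : B) (hP : P ∈ S.leftAlgebra)
    (hZ : Z ∈ S.sideAlgebra s) (hQ : s = Side.left → Q = 1) :
    S.E (P * S.insertAfter s Z b * Q) = S.E (P * Z * Q) * b := by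
  cases s with
  | left =>
    simp only [insertAfter, hQ, mul_one]
    rw [← mul_assoc, E_mul_L, ← S.R_comm (mul_mem hP hZ), E_R_mul]
  | right =>
    simp only [insertAfter]
    rw [← mul_assoc, ← S.R_comm hP, mul_assoc, mul_assoc, E_R_mul, ← mul_assoc]

end Operators

section Moments

variable {N : ℕ} {χ : Fin N → Side} {π : Setoid (Fin N)} {Z W W' : Fin N → A}
  {V T : Finset (Fin N)}

/-- The value of the moment function on a single block `V`. -/
def blockMoment (Z : Fin N → A) (V : Finset (Fin N)) : B :=
  S.E ((V.sort (· ≤ ·)).map Z).prod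

theorem blockMoment_empty (Z : Fin N → A) : S.blockMoment Z ∅ = 1 := by
  simp [blockMoment, S.E_one]

theorem blockMoment_congr (h : ∀ k ∈ V, W k = W' k) : S.blockMoment W V = S.blockMoment W' V := by
  unfold blockMoment
  congr 2
  exact List.map_congr_left fun k hk => h k ((Finset.mem_sort _).1 hk)

theorem blockMoment_map {N' : ℕ} {f : Fin N' → Fin N} (hf : StrictMono f) (W : Fin N → A)
    (V : Finset (Fin N')) :
    S.blockMoment W (V.map ⟨f, hf.injective⟩) = S.blockMoment (fun i => W (f i)) V := by
  unfold blockMoment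
  rw [← Finset.map_sort (r := (· ≤ ·)) _ _ _ fun a _ b _ => hf.le_iff_le.symm, List.map_map]
  rfl

/-- The entry `Z k`, followed by the value of the gap after `k` in the first block of `T`. -/
def gapEntry (χ : Fin N → Side) (π : Setoid (Fin N)) (Z : Fin N → A) (T : Finset (Fin N))
    (k : Fin N) : A :=
  S.insertAfter (χ k) (Z k) (S.momentOn χ π Z (gap χ π T k))

theorem momentOn_empty (χ : Fin N → Side) (π : Setoid (Fin N)) (Z : Fin N → A) :
    S.momentOn χ π Z ∅ = 1 := by
  rw [momentOn, dif_pos rfl]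

theorem momentOn_of_ne_empty (χ : Fin N → Side) (π : Setoid (Fin N)) (Z : Fin N → A)
    (hT : T ≠ ∅) :
    S.momentOn χ π Z T =
      S.blockMoment (S.gapEntry χ π Z T) (firstBlock χ π T) * S.momentOn χ π Z (rest χ π T) := by
  rw [momentOn, dif_neg hT]
  rfl

theorem gapEntry_of_gap_eq_empty {k : Fin N} (h : gap χ π T k = ∅) :
    S.gapEntry χ π Z T k = Z k := by
  rw [gapEntry, h, momentOn_empty, insertAfter_one]

theorem momentOn_eq_blockMoment_mul (Z : Fin N → A) {U : Finset (Fin N)}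
    (hU : ∀ k, k ∈ U ↔ k ∈ V ∨ k ∈ T) (hV : V ≠ ∅) (hVT : ∀ v ∈ V, ∀ t ∈ T, Prec χ v t)
    (hVπ : ∀ v ∈ V, ∀ k ∈ U, π v k ↔ k ∈ V) :
    S.momentOn χ π Z U = S.blockMoment Z V * S.momentOn χ π Z T := by
  obtain ⟨p, hp, hmin⟩ := exists_prec_min χ hV
  have hpU : p ∈ U := (hU p).2 (Or.inl hp)
  have hminU : ∀ j ∈ U, ¬ Prec χ j p := fun j hj =>
    ((hU j).1 hj).elim (hmin j) fun hjT => (hVT p hp j hjT).asymm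
  have hfirst : firstBlock χ π U = V := by
    ext k
    rw [mem_firstBlock hpU hminU]
    refine ⟨fun h => (hVπ p hp k h.1).1 h.2, fun hk => ?_⟩
    have hkU := (hU k).2 (Or.inl hk)
    exact ⟨hkU, (hVπ p hp k hkU).2 hk⟩
  have hgap (k : Fin N) : gap χ π U k = ∅ := by
    refine Finset.eq_empty_of_forall_notMem fun j hj => ?_
    rw [mem_gap, hfirst] at hj
    obtain ⟨⟨hjU, hjV⟩, -, ⟨v, hv, hjv⟩, -⟩ := hj
    exact (hVT v hv j (((hU j).1 hjU).resolve_left hjV)).asymm hjv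
  have hrest : rest χ π U = T := by
    ext j
    rw [mem_rest, hfirst, hU]
    exact ⟨fun h => h.1.1.resolve_left h.1.2,
      fun hj => ⟨⟨Or.inr hj, fun hjV => (hVT j hjV j hj).irrefl⟩, fun v hv => hVT v hv j hj⟩⟩
  rw [S.momentOn_of_ne_empty χ π Z (Finset.ne_empty_of_mem hpU), hrest, hfirst]
  congr 1
  exact S.blockMoment_congr fun k _ => S.gapEntry_of_gap_eq_empty (hgap k)

theorem blockMoment_of_insertAfter_last {k : Fin N} {b : B} (hk : k ∈ V)
    (hlast : ∀ v ∈ V, ¬ Prec χ k v) (hW : ∀ v ∈ V, W v ∈ S.sideAlgebra (χ v))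
    (hne : ∀ v ∈ V, v ≠ k → W' v = W v) (heq : W' k = S.insertAfter (χ k) (W k) b) :
    S.blockMoment W' V = S.blockMoment W V * b := by
  unfold blockMoment
  obtain ⟨l₁, l₂, hl⟩ := List.append_of_mem ((Finset.mem_sort (· ≤ ·)).2 hk)
  have hmem (v : Fin N) : v ∈ l₁ ++ k :: l₂ ↔ v ∈ V := by rw [← hl, Finset.mem_sort]
  have hsorted : (l₁ ++ k :: l₂).Pairwise (· < ·) := hl ▸ (Finset.sortedLT_sort V).pairwise
  obtain ⟨-, hsorted₂, hsorted₁⟩ := List.pairwise_append.1 hsorted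
  have hlt₁ : ∀ v ∈ l₁, v < k := fun v hv => hsorted₁ v hv k (by simp)
  have hlt₂ : ∀ v ∈ l₂, k < v := (List.pairwise_cons.1 hsorted₂).1
  have hV₁ : ∀ v ∈ l₁, v ∈ V := fun v hv => (hmem v).1 (by simp [hv])
  have hV₂ : ∀ v ∈ l₂, v ∈ V := fun v hv => (hmem v).1 (by simp [hv])
  have hmap₁ : l₁.map W' = l₁.map W :=
    List.map_congr_left fun v hv => hne v (hV₁ v hv) (hlt₁ v hv).ne
  have hmap₂ : l₂.map W' = l₂.map W :=
    List.map_congr_left fun v hv => hne v (hV₂ v hv) (hlt₂ v hv).ne'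
  have hleft : (l₁.map W).prod ∈ S.leftAlgebra := by
    refine Subalgebra.list_prod_mem _ fun x hx => ?_
    obtain ⟨v, hv, rfl⟩ := List.mem_map.1 hx
    have hWv := hW v (hV₁ v hv)
    rwa [eq_left_of_lt_of_not_prec (hlast v (hV₁ v hv)) (hlt₁ v hv)] at hWv
  have hright (hχ : χ k = Side.left) : (l₂.map W).prod = 1 := by
    obtain rfl : l₂ = [] := List.eq_nil_iff_forall_not_mem.2 fun v hv =>
      not_lt_of_left_of_not_prec (hlast v (hV₂ v hv)) hχ (hlt₂ v hv)
    rfl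
  rw [hl]
  simpa only [List.map_append, List.map_cons, List.prod_append, List.prod_cons, hmap₁, hmap₂, heq,
    mul_assoc] using S.E_mul_insertAfter_mul b hleft (hW k hk) hright

theorem moment_one (hN : 0 < N) (Z : Fin N → A) :
    S.moment (BNC.one χ) Z = S.blockMoment Z Finset.univ := by
  rw [moment, S.momentOn_eq_blockMoment_mul (V := Finset.univ) (T := ∅), S.momentOn_empty, mul_one]
  · simp
  · exact Finset.ne_empty_of_mem (Finset.mem_univ ⟨0, hN⟩)
  · simp
  · exact fun _ _ _ _ => ⟨fun _ => Finset.mem_univ _, fun _ => trivial⟩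

open Classical in
theorem sum_cumulant_le (π : BNC χ) (Z : Fin N → A) :
    ∑ σ : BNC χ with σ ≤ π, S.cumulant σ Z = S.moment π Z :=
  sum_le_sum_mu_smul (𝕜 := ℂ) (fun σ => S.moment σ Z) π

open Classical in
theorem eq_cumulant_of_forall_sum_le_eq_moment {F : BNC χ → B}
    (hF : ∀ π, ∑ σ with σ ≤ π, F σ = S.moment π Z) (π : BNC χ) : F π = S.cumulant π Z :=
  congrFun (eq_of_forall_sum_le_eq fun π => (hF π).trans (S.sum_cumulant_le π Z).symm) π

end Moments

end BBSpace

/-! ### Contracting an interval of indices -/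

/-- `χ'` is obtained from `χ` by leaving out a `≺_χ`-interval of indices directly after `f j`, where
`f` embeds the indices that are kept. Contracting the interval is how a block nested directly after
`f j` is evaluated. -/
structure IsContraction {N N' : ℕ} (χ : Fin N → Side) (χ' : Fin N' → Side) (f : Fin N' → Fin N)
    (j : Fin N') : Prop where
  strictMono : StrictMono f
  side : ∀ i, χ (f i) = χ' i
  prec_iff : ∀ g, g ∉ Set.range f → ∀ i, Prec χ (f i) g ↔ ¬ Prec χ' j i

section Contraction

variable {N N' : ℕ} {χ : Fin N → Side} {χ' : Fin N' → Side} {f : Fin N' → Fin N} {j : Fin N'}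

open Classical in
/-- The indices left out by `f`. -/
def leftOut (f : Fin N' → Fin N) : Finset (Fin N) :=
  {g | g ∉ Set.range f}

open Classical in
/-- The set of indices that contracts to `T`: the image of `T`, together with the left out indices
if the index `j` they are attached to lies in `T`. -/
def expand (f : Fin N' → Fin N) (j : Fin N') (T : Finset (Fin N')) : Finset (Fin N) :=
  {x | (∃ i ∈ T, f i = x) ∨ (j ∈ T ∧ x ∉ Set.range f)}

/-- The left out indices form a block of `π`. -/
def IsLeftOutBlock (f : Fin N' → Fin N) (π : Setoid (Fin N)) : Prop :=
  ∀ g, g ∉ Set.range f → ∀ x, π g x ↔ x ∉ Set.range f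

/-- The left out indices are a union of blocks of `π`. -/
def Saturated (f : Fin N' → Fin N) (π : Setoid (Fin N)) : Prop :=
  ∀ g, g ∉ Set.range f → ∀ x, π g x → x ∉ Set.range f

theorem mem_leftOut {g : Fin N} : g ∈ leftOut f ↔ g ∉ Set.range f := by simp [leftOut]

theorem mem_expand {T : Finset (Fin N')} {x : Fin N} :
    x ∈ expand f j T ↔ (∃ i ∈ T, f i = x) ∨ (j ∈ T ∧ x ∉ Set.range f) := by simp [expand]

theorem map_mem_expand (hf : Function.Injective f) {T : Finset (Fin N')} {i : Fin N'} :
    f i ∈ expand f j T ↔ i ∈ T := by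
  simp [mem_expand, hf.eq_iff]

theorem mem_expand_of_notMem_range {T : Finset (Fin N')} {g : Fin N} (hg : g ∉ Set.range f) :
    g ∈ expand f j T ↔ j ∈ T := by
  rw [mem_expand, or_iff_right fun ⟨i, _, hi⟩ => hg ⟨i, hi⟩, and_iff_left hg]

theorem expand_empty : expand f j ∅ = ∅ := by
  ext x
  simp [mem_expand]

theorem expand_univ : expand f j Finset.univ = Finset.univ := by
  ext x
  simp only [mem_expand, Finset.mem_univ, true_and, iff_true]
  exact Classical.em _

namespace IsContraction

section Prec

variable (h : IsContraction χ χ' f j)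

include h

theorem prec_map (i k : Fin N') : Prec χ (f i) (f k) ↔ Prec χ' i k := by
  have hi := h.side i
  have hk := h.side k
  cases hi' : χ' i <;> cases hk' : χ' k <;> rw [hi'] at hi <;> rw [hk'] at hk
  · rw [prec_left_left hi hk, prec_left_left hi' hk', h.strictMono.lt_iff_lt]
  · exact iff_of_true (prec_left_right hi hk) (prec_left_right hi' hk')
  · exact iff_of_false (not_prec_right_left hi hk) (not_prec_right_left hi' hk')
  · rw [prec_right_right hi hk, prec_right_right hi' hk', h.strictMono.lt_iff_lt]

theorem prec_map_right {g : Fin N} (hg : g ∉ Set.range f) (i : Fin N') :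
    Prec χ g (f i) ↔ Prec χ' j i := by
  rw [← not_prec_iff fun hi => hg ⟨i, hi⟩, h.prec_iff g hg i, not_not]

theorem notMem_range_of_prec_of_prec {u v w : Fin N} (hu : u ∉ Set.range f) (hw : w ∉ Set.range f)
    (huv : Prec χ u v) (hvw : Prec χ v w) : v ∉ Set.range f := by
  rintro ⟨i, rfl⟩
  exact (h.prec_iff w hw i).1 hvw ((h.prec_map_right hu i).1 huv)

end Prec

section Blocks

variable (h : IsContraction χ χ' f j) {π : Setoid (Fin N)} (hπ : IsLeftOutBlock f π)
  (T : Finset (Fin N'))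

include h

theorem map_mem_firstBlock (i : Fin N') :
    f i ∈ firstBlock χ π (expand f j T) ↔ i ∈ firstBlock χ' (π.comap f) T := by
  by_cases hT : T = ∅
  · subst hT
    rw [expand_empty]
    exact iff_of_false (fun hi => by simpa using firstBlock_subset _ _ hi)
      fun hi => by simpa using firstBlock_subset _ _ hi
  obtain ⟨p, hp, hmin⟩ := exists_prec_min χ' hT
  have hmin' : ∀ x ∈ expand f j T, ¬ Prec χ x (f p) := by
    intro x hx
    rcases mem_expand.1 hx with ⟨k, hk, rfl⟩ | ⟨hj, hx⟩
    · rw [h.prec_map]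
      exact hmin k hk
    · rw [h.prec_map_right hx]
      exact hmin j hj
  rw [mem_firstBlock hp hmin, mem_firstBlock ((map_mem_expand h.strictMono.injective).2 hp) hmin',
    map_mem_expand h.strictMono.injective]
  rfl

include hπ

theorem notMem_firstBlock {g : Fin N} (hg : g ∉ Set.range f) :
    g ∉ firstBlock χ π (expand f j T) := by
  intro hmem
  simp only [firstBlock, Finset.mem_filter] at hmem
  obtain ⟨hgT, p, -, hpmin, hpg⟩ := hmem
  have hj : j ∈ T := (mem_expand_of_notMem_range hg).1 hgT
  refine hpmin (f j) ((map_mem_expand h.strictMono.injective).2 hj) ?_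
  rw [h.prec_iff p ((hπ g hg p).1 (π.symm hpg))]
  exact Prec.irrefl j

theorem firstBlock_expand : firstBlock χ π (expand f j T) =
    (firstBlock χ' (π.comap f) T).map ⟨f, h.strictMono.injective⟩ := by
  ext x
  simp only [Finset.mem_map, Function.Embedding.coeFn_mk]
  constructor
  · intro hx
    obtain ⟨i, rfl⟩ := not_not.1 fun hr => h.notMem_firstBlock hπ T hr hx
    exact ⟨i, (h.map_mem_firstBlock T i).1 hx, rfl⟩
  · rintro ⟨i, hi, rfl⟩
    exact (h.map_mem_firstBlock T i).2 hi

theorem exists_mem_firstBlock_expand (P : Fin N → Prop) :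
    (∃ v ∈ firstBlock χ π (expand f j T), P v) ↔
      ∃ v ∈ firstBlock χ' (π.comap f) T, P (f v) := by
  simp [h.firstBlock_expand hπ T]

theorem forall_mem_firstBlock_expand (P : Fin N → Prop) :
    (∀ v ∈ firstBlock χ π (expand f j T), P v) ↔
      ∀ v ∈ firstBlock χ' (π.comap f) T, P (f v) := by
  simp [h.firstBlock_expand hπ T]

theorem map_mem_gap (i k : Fin N') :
    f k ∈ gap χ π (expand f j T) (f i) ↔ k ∈ gap χ' (π.comap f) T i := by
  rw [mem_gap, mem_gap, map_mem_expand h.strictMono.injective, h.map_mem_firstBlock,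
    h.exists_mem_firstBlock_expand hπ, h.forall_mem_firstBlock_expand hπ]
  simp only [h.prec_map]

theorem leftOut_mem_gap {g : Fin N} (hg : g ∉ Set.range f) (i : Fin N') :
    g ∈ gap χ π (expand f j T) (f i) ↔ j ∈ T ∧ ¬ Prec χ' j i ∧
      (∃ v ∈ firstBlock χ' (π.comap f) T, Prec χ' j v) ∧
      ∀ v ∈ firstBlock χ' (π.comap f) T, Prec χ' i v → Prec χ' j v := by
  rw [mem_gap, mem_expand_of_notMem_range hg, h.exists_mem_firstBlock_expand hπ,
    h.forall_mem_firstBlock_expand hπ, h.prec_iff g hg,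
    and_iff_left (h.notMem_firstBlock hπ T hg)]
  simp only [h.prec_map, h.prec_map_right hg]

theorem gap_expand_of_ne {i : Fin N'} (hi : i ≠ j) :
    gap χ π (expand f j T) (f i) = expand f j (gap χ' (π.comap f) T i) := by
  ext x
  by_cases hx : x ∈ Set.range f
  · obtain ⟨k, rfl⟩ := hx
    rw [h.map_mem_gap hπ, map_mem_expand h.strictMono.injective]
  · rw [h.leftOut_mem_gap hπ T hx, mem_expand_of_notMem_range hx, mem_gap, not_prec_iff hi.symm]
    exact ⟨fun ⟨hj, hij, hlast, hnext⟩ =>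
        ⟨⟨hj, fun hjV => Prec.irrefl j (hnext j hjV hij)⟩, hij, hlast, hnext⟩,
      fun ⟨⟨hj, _⟩, hij, hlast, hnext⟩ => ⟨hj, hij, hlast, hnext⟩⟩

theorem mem_gap_expand_self (hj : j ∈ T)
    (hlast : ∃ v ∈ firstBlock χ' (π.comap f) T, Prec χ' j v) (x : Fin N) :
    x ∈ gap χ π (expand f j T) (f j) ↔
      x ∈ leftOut f ∨ x ∈ expand f j (gap χ' (π.comap f) T j) := by
  rw [mem_leftOut]
  by_cases hx : x ∈ Set.range f
  · obtain ⟨k, rfl⟩ := hx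
    rw [h.map_mem_gap hπ, map_mem_expand h.strictMono.injective]
    simp
  · rw [h.leftOut_mem_gap hπ T hx]
    exact iff_of_true ⟨hj, Prec.irrefl j, hlast, fun _ _ hv => hv⟩ (Or.inl hx)

theorem gap_expand_self_of_last (hlast : ∀ v ∈ firstBlock χ' (π.comap f) T, ¬ Prec χ' j v) :
    gap χ π (expand f j T) (f j) = ∅ := by
  refine gap_eq_empty_of_last ((h.forall_mem_firstBlock_expand hπ T _).2 ?_)
  simpa only [h.prec_map] using hlast

theorem map_mem_rest (k : Fin N') :
    f k ∈ rest χ π (expand f j T) ↔ k ∈ rest χ' (π.comap f) T := by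
  rw [mem_rest, mem_rest, map_mem_expand h.strictMono.injective, h.map_mem_firstBlock,
    h.forall_mem_firstBlock_expand hπ]
  simp only [h.prec_map]

theorem leftOut_mem_rest {g : Fin N} (hg : g ∉ Set.range f) :
    g ∈ rest χ π (expand f j T) ↔ j ∈ T ∧ ∀ v ∈ firstBlock χ' (π.comap f) T, ¬ Prec χ' j v := by
  rw [mem_rest, mem_expand_of_notMem_range hg, h.forall_mem_firstBlock_expand hπ,
    and_iff_left (h.notMem_firstBlock hπ T hg)]
  simp only [h.prec_iff g hg]

theorem rest_expand (hj : j ∈ firstBlock χ' (π.comap f) T →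
      ∃ v ∈ firstBlock χ' (π.comap f) T, Prec χ' j v) :
    rest χ π (expand f j T) = expand f j (rest χ' (π.comap f) T) := by
  ext x
  by_cases hx : x ∈ Set.range f
  · obtain ⟨k, rfl⟩ := hx
    rw [h.map_mem_rest hπ, map_mem_expand h.strictMono.injective]
  · rw [h.leftOut_mem_rest hπ T hx, mem_expand_of_notMem_range hx, mem_rest]
    constructor
    · rintro ⟨hjT, hlast⟩
      have hjV : j ∉ firstBlock χ' (π.comap f) T := fun hjV =>
        let ⟨v, hv, hjv⟩ := hj hjV
        hlast v hv hjv
      exact ⟨⟨hjT, hjV⟩, fun v hv =>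
        (not_prec_iff (ne_of_mem_of_not_mem hv hjV).symm).1 (hlast v hv)⟩
    · exact fun ⟨⟨hjT, _⟩, hlast⟩ => ⟨hjT, fun v hv => (hlast v hv).asymm⟩

theorem mem_rest_expand_of_last (hj : j ∈ T)
    (hlast : ∀ v ∈ firstBlock χ' (π.comap f) T, ¬ Prec χ' j v) (x : Fin N) :
    x ∈ rest χ π (expand f j T) ↔
      x ∈ leftOut f ∨ x ∈ expand f j (rest χ' (π.comap f) T) := by
  rw [mem_leftOut]
  by_cases hx : x ∈ Set.range f
  · obtain ⟨k, rfl⟩ := hx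
    rw [h.map_mem_rest hπ, map_mem_expand h.strictMono.injective]
    simp
  · rw [h.leftOut_mem_rest hπ T hx]
    exact iff_of_true ⟨hj, hlast⟩ (Or.inl hx)

end Blocks

section Moments

variable {B A : Type*} [Ring B] [Algebra ℂ B] [Ring A] [Algebra ℂ A] {S : BBSpace B A}
  {π : Setoid (Fin N)} {Z : Fin N → A} {Z' : Fin N' → A} {T : Finset (Fin N')}

theorem momentOn_leftOut_union (h : IsContraction χ χ' f j) (hπ : IsLeftOutBlock f π)
    {U : Finset (Fin N)} (hU : ∀ x, x ∈ U ↔ x ∈ leftOut f ∨ x ∈ expand f j T)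
    (hT : ∀ t ∈ T, Prec χ' j t) :
    S.momentOn χ π Z U = S.blockMoment Z (leftOut f) * S.momentOn χ π Z (expand f j T) := by
  by_cases hG : leftOut f = ∅
  · obtain rfl : U = expand f j T := by
      ext x
      simp [hU, hG]
    rw [hG, S.blockMoment_empty, one_mul]
  refine S.momentOn_eq_blockMoment_mul Z hU hG (fun g hg t ht => ?_) fun g hg k _ => ?_
  · rcases mem_expand.1 ht with ⟨i, hi, rfl⟩ | ⟨hj, -⟩
    · exact (h.prec_map_right (mem_leftOut.1 hg) i).2 (hT i hi)
    · exact absurd (hT j hj) (Prec.irrefl j)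
  · rw [hπ g (mem_leftOut.1 hg), mem_leftOut]

/-- `Z'` is the family `Z` with the left out entries replaced by the value of their block, which is
attached to the entry before them. -/
structure ContractsTo (S : BBSpace B A) (χ' : Fin N' → Side) (f : Fin N' → Fin N) (j : Fin N')
    (Z : Fin N → A) (Z' : Fin N' → A) : Prop where
  of_ne : ∀ i, i ≠ j → Z' i = Z (f i)
  self : Z' j = S.insertAfter (χ' j) (Z (f j)) (S.blockMoment Z (leftOut f))

section Step

/- The induction step of `momentOn_expand`: `hgap` and `hrest` are the induction hypotheses. -/
variable (h : IsContraction χ χ' f j) (hπ : IsLeftOutBlock f π) (hZ' : ContractsTo S χ' f j Z Z')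
  (hgap : ∀ i, S.momentOn χ π Z (expand f j (gap χ' (π.comap f) T i)) =
    S.momentOn χ' (π.comap f) Z' (gap χ' (π.comap f) T i))

include h hπ hZ' hgap

theorem gapEntry_expand_of_ne {i : Fin N'} (hi : i ≠ j) :
    S.gapEntry χ π Z (expand f j T) (f i) = S.gapEntry χ' (π.comap f) Z' T i := by
  rw [BBSpace.gapEntry, BBSpace.gapEntry, h.gap_expand_of_ne hπ T hi, hgap, hZ'.of_ne i hi, h.side]

theorem gapEntry_expand_of_not_last
    (hj : j ∈ firstBlock χ' (π.comap f) T → ∃ v ∈ firstBlock χ' (π.comap f) T, Prec χ' j v)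
    {i : Fin N'} (hi : i ∈ firstBlock χ' (π.comap f) T) :
    S.gapEntry χ π Z (expand f j T) (f i) = S.gapEntry χ' (π.comap f) Z' T i := by
  rcases eq_or_ne i j with rfl | hij
  · rw [BBSpace.gapEntry, BBSpace.gapEntry, h.momentOn_leftOut_union hπ
      (h.mem_gap_expand_self hπ T (firstBlock_subset _ _ hi) (hj hi))
      fun t ht => (mem_gap.1 ht).2.1, hgap, hZ'.self, S.insertAfter_insertAfter, h.side]
  · exact h.gapEntry_expand_of_ne hπ hZ' hgap hij

theorem blockMoment_gapEntry_of_last (hZ : ∀ k, Z k ∈ S.sideAlgebra (χ k))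
    (hj : j ∈ firstBlock χ' (π.comap f) T)
    (hlast : ∀ v ∈ firstBlock χ' (π.comap f) T, ¬ Prec χ' j v) :
    S.blockMoment (S.gapEntry χ' (π.comap f) Z' T) (firstBlock χ' (π.comap f) T) =
      S.blockMoment (fun i => S.gapEntry χ π Z (expand f j T) (f i))
        (firstBlock χ' (π.comap f) T) * S.blockMoment Z (leftOut f) := by
  refine S.blockMoment_of_insertAfter_last (χ := χ') hj hlast (fun v _ => ?_)
    (fun v _ hv => (h.gapEntry_expand_of_ne hπ hZ' hgap hv).symm) ?_
  · rw [← h.side v]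
    exact BBSpace.insertAfter_mem (hZ _) _
  · rw [S.gapEntry_of_gap_eq_empty (gap_eq_empty_of_last hlast),
      S.gapEntry_of_gap_eq_empty (h.gap_expand_self_of_last hπ T hlast), hZ'.self]

end Step

theorem momentOn_expand (h : IsContraction χ χ' f j) (hπ : IsLeftOutBlock f π)
    (hZ : ∀ k, Z k ∈ S.sideAlgebra (χ k)) (hZ' : ContractsTo S χ' f j Z Z')
    (T : Finset (Fin N')) :
    S.momentOn χ π Z (expand f j T) = S.momentOn χ' (π.comap f) Z' T := by
  induction hc : T.card using Nat.strong_induction_on generalizing T with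
  | _ c ih =>
  subst hc
  by_cases hT : T = ∅
  · rw [hT, expand_empty, S.momentOn_empty, S.momentOn_empty]
  have hT' : expand f j T ≠ ∅ := by
    obtain ⟨i, hi⟩ := Finset.nonempty_iff_ne_empty.mpr hT
    exact Finset.ne_empty_of_mem ((map_mem_expand h.strictMono.injective).2 hi)
  have hgap := fun i => ih _ (card_gap_lt χ' (π.comap f) hT i) _ rfl
  have hrest := ih _ (card_rest_lt χ' (π.comap f) hT) _ rfl
  rw [S.momentOn_of_ne_empty χ π Z hT', S.momentOn_of_ne_empty χ' (π.comap f) Z' hT,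
    h.firstBlock_expand hπ, S.blockMoment_map h.strictMono]
  by_cases hlast : j ∈ firstBlock χ' (π.comap f) T ∧
    ∀ v ∈ firstBlock χ' (π.comap f) T, ¬ Prec χ' j v
  · obtain ⟨hjV, hlast⟩ := hlast
    rw [h.momentOn_leftOut_union hπ
      (h.mem_rest_expand_of_last hπ T (firstBlock_subset _ _ hjV) hlast)
      fun t ht => (mem_rest.1 ht).2 j hjV, hrest, ← mul_assoc,
      h.blockMoment_gapEntry_of_last hπ hZ' hgap hZ hjV hlast]
  · push Not at hlast
    rw [h.rest_expand hπ T hlast, hrest]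
    congr 1
    exact S.blockMoment_congr fun i hi => h.gapEntry_expand_of_not_last hπ hZ' hgap hlast hi

end Moments

/-- The restriction of a partition to the indices that are kept. -/
def restrict (h : IsContraction χ χ' f j) (π : BNC χ) : BNC χ' :=
  ⟨π.1.comap f, fun u₁ v₁ u₂ v₂ h₁ h₂ h₃ =>
    π.2 (f u₁) (f v₁) (f u₂) (f v₂) ((h.prec_map _ _).2 h₁) ((h.prec_map _ _).2 h₂)
      ((h.prec_map _ _).2 h₃)⟩

/-- The partition with the left out indices as an additional block. -/
def extendSetoid (h : IsContraction χ χ' f j) (τ : Setoid (Fin N')) : Setoid (Fin N) where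
  r x y := (x ∉ Set.range f ∧ y ∉ Set.range f) ∨ ∃ a b, f a = x ∧ f b = y ∧ τ a b
  iseqv :=
    { refl := fun x => by
        by_cases hx : x ∈ Set.range f
        · obtain ⟨a, rfl⟩ := hx
          exact Or.inr ⟨a, a, rfl, rfl, τ.refl a⟩
        · exact Or.inl ⟨hx, hx⟩
      symm := by
        rintro x y (⟨hx, hy⟩ | ⟨a, b, hax, hby, hab⟩)
        · exact Or.inl ⟨hy, hx⟩
        · exact Or.inr ⟨b, a, hby, hax, τ.symm hab⟩
      trans := by
        rintro x y z (⟨hx, hy⟩ | ⟨a, b, rfl, rfl, hab⟩) (⟨hy', hz⟩ | ⟨c, d, hcb, rfl, hcd⟩)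
        · exact Or.inl ⟨hx, hz⟩
        · exact absurd ⟨c, hcb⟩ hy
        · exact absurd ⟨b, rfl⟩ hy'
        · obtain rfl := h.strictMono.injective hcb
          exact Or.inr ⟨a, d, rfl, rfl, τ.trans hab hcd⟩ }

section Partitions

variable (h : IsContraction χ χ' f j)

theorem extendSetoid_map (τ : Setoid (Fin N')) (a b : Fin N') :
    h.extendSetoid τ (f a) (f b) ↔ τ a b := by
  constructor
  · rintro (⟨ha, -⟩ | ⟨c, d, hc, hd, hcd⟩)
    · exact absurd ⟨a, rfl⟩ ha
    · rwa [h.strictMono.injective hc, h.strictMono.injective hd] at hcd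
  · exact fun hab => Or.inr ⟨a, b, rfl, rfl, hab⟩

theorem isLeftOutBlock_extendSetoid (τ : Setoid (Fin N')) :
    IsLeftOutBlock f (h.extendSetoid τ) := by
  refine fun g hg x => ⟨?_, fun hx => Or.inl ⟨hg, hx⟩⟩
  rintro (⟨-, hx⟩ | ⟨c, d, hc, -, -⟩)
  · exact hx
  · exact absurd ⟨c, hc⟩ hg

theorem comap_extendSetoid (τ : Setoid (Fin N')) : (h.extendSetoid τ).comap f = τ :=
  Setoid.ext (h.extendSetoid_map τ)

theorem isBiNonCrossing_extendSetoid {τ : Setoid (Fin N')} (hτ : IsBiNonCrossing χ' τ) :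
    IsBiNonCrossing χ (h.extendSetoid τ) := by
  rintro u₁ v₁ u₂ v₂ h₁ h₂ h₃ (⟨hu₁, hu₂⟩ | ⟨a, b, rfl, rfl, hab⟩)
    (⟨hv₁, hv₂⟩ | ⟨c, d, rfl, rfl, hcd⟩)
  · exact Or.inl ⟨hu₁, hv₁⟩
  · exact absurd ⟨c, rfl⟩ (h.notMem_range_of_prec_of_prec hu₁ hu₂ h₁ h₂)
  · exact absurd ⟨b, rfl⟩ (h.notMem_range_of_prec_of_prec hv₁ hv₂ h₂ h₃)
  · exact Or.inr ⟨a, c, rfl, rfl, hτ a c b d ((h.prec_map _ _).1 h₁) ((h.prec_map _ _).1 h₂)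
      ((h.prec_map _ _).1 h₃) hab hcd⟩

theorem le_extendSetoid_iff (π : Setoid (Fin N)) (τ : Setoid (Fin N')) :
    π ≤ h.extendSetoid τ ↔ Saturated f π ∧ π.comap f ≤ τ := by
  constructor
  · exact fun hle => ⟨fun g hg x hgx => (h.isLeftOutBlock_extendSetoid τ g hg x).1 (hle hgx),
      fun a b hab => (h.extendSetoid_map τ a b).1 (hle hab)⟩
  · rintro ⟨hsat, hle⟩ x y hxy
    by_cases hx : x ∈ Set.range f
    · obtain ⟨b, rfl⟩ := not_not.1 fun hy => hsat y hy x (π.symm hxy) hx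
      obtain ⟨a, rfl⟩ := hx
      exact (h.extendSetoid_map τ a b).2 (hle hxy)
    · exact (h.isLeftOutBlock_extendSetoid τ x hx y).2 (hsat x hx y hxy)

end Partitions

section Cumulants

variable {B A : Type*} [Ring B] [Algebra ℂ B] [Ring A] [Algebra ℂ A] {S : BBSpace B A}
  {Z : Fin N → A} {Z' : Fin N' → A}

theorem moment_extendSetoid (h : IsContraction χ χ' f j) (hZ : ∀ k, Z k ∈ S.sideAlgebra (χ k))
    (hZ' : ContractsTo S χ' f j Z Z') (τ : BNC χ') :
    S.moment (⟨_, h.isBiNonCrossing_extendSetoid τ.2⟩ : BNC χ) Z = S.moment τ Z' := by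
  have hmoment := h.momentOn_expand (h.isLeftOutBlock_extendSetoid τ.1) hZ hZ' Finset.univ
  rwa [h.comap_extendSetoid, expand_univ] at hmoment

/- By Möbius inversion it is enough to compare moments: a saturated partition lies below the
extension of `τ` exactly if its restriction lies below `τ`. -/
open Classical in
theorem sum_cumulant_saturated (h : IsContraction χ χ' f j) (hZ : ∀ k, Z k ∈ S.sideAlgebra (χ k))
    (hZ' : ContractsTo S χ' f j Z Z') (P : BNC χ' → Prop) :
    ∑ π : BNC χ with Saturated f π.1 ∧ P (h.restrict π), S.cumulant π Z
      = ∑ τ : BNC χ' with P τ, S.cumulant τ Z' := by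
  have fiber (τ : BNC χ') :
      ∑ π : BNC χ with Saturated f π.1 ∧ h.restrict π = τ, S.cumulant π Z = S.cumulant τ Z' := by
    refine S.eq_cumulant_of_forall_sum_le_eq_moment (F := fun τ =>
      ∑ π : BNC χ with Saturated f π.1 ∧ h.restrict π = τ, S.cumulant π Z) (fun ρ => ?_) τ
    rw [sum_filter_sum_filter_and_eq, ← h.moment_extendSetoid hZ hZ' ρ, ← S.sum_cumulant_le]
    refine Finset.sum_congr (Finset.filter_congr fun π _ => ?_) fun _ _ => rfl
    exact (h.le_extendSetoid_iff π.1 ρ.1).symm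
  rw [← sum_filter_sum_filter_and_eq]
  exact Finset.sum_congr rfl fun τ _ => fiber τ

end Cumulants

end IsContraction

end Contraction

/-! ### Intervals following a position -/

theorem Side.ne_left_iff {s : Side} : s ≠ Side.left ↔ s = Side.right := by
  cases s <;> simp

theorem Side.eq_of_eq_left_iff {s t : Side} (h : s = Side.left ↔ t = Side.left) : s = t := by
  cases s <;> cases t <;> simp at h ⊢

section Position

variable {N N' n n' a t : ℕ}

/-- The position of an index with respect to `≺_χ` if the first `n` indices are left and the other
ones are right. The same formula recovers the index from its position. -/
def position (n : ℕ) (k : Fin N) : Fin N :=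
  ⟨if (k : ℕ) < n then k else N + n - 1 - k, by split_ifs <;> omega⟩

theorem position_val (n : ℕ) (k : Fin N) :
    (position n k : ℕ) = if (k : ℕ) < n then (k : ℕ) else N + n - 1 - k := rfl

theorem position_position (n : ℕ) (k : Fin N) : position n (position n k) = k := by
  ext
  simp only [position_val]
  split_ifs <;> omega

theorem eq_of_position_eq (n : ℕ) {k l : Fin N} (h : (position n k : ℕ) = position n l) :
    k = l := by
  have := congrArg (position n) (Fin.ext h)
  rwa [position_position, position_position] at this

theorem exists_position (n : ℕ) {i : ℕ} (hi : i < N) : ∃ k : Fin N, (position n k : ℕ) = i :=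
  ⟨position n ⟨i, hi⟩, by rw [position_position]⟩

theorem position_lt_iff (n : ℕ) (k : Fin N) : (position n k : ℕ) < n ↔ (k : ℕ) < n := by
  rw [position_val]
  split_ifs <;> omega

theorem prec_iff_position {χ : Fin N → Side} (hχ : ∀ k, χ k = Side.left ↔ (k : ℕ) < n)
    (i k : Fin N) : Prec χ i k ↔ (position n i : ℕ) < position n k := by
  have hi := hχ i
  have hk := hχ k
  rw [position_val, position_val]
  cases hi' : χ i <;> cases hk' : χ k <;>
    simp only [hi', hk', true_iff, reduceCtorEq, false_iff] at hi hk
  · rw [prec_left_left hi' hk', if_pos hi, if_pos hk, Fin.lt_def]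
  · refine iff_of_true (prec_left_right hi' hk') ?_
    rw [if_pos hi, if_neg hk]
    omega
  · refine iff_of_false (not_prec_right_left hi' hk') ?_
    rw [if_neg hi, if_pos hk]
    omega
  · rw [prec_right_right hi' hk', if_neg hi, if_neg hk, Fin.lt_def]
    omega

/-- The map of positions that leaves out the `t` positions after `a`. -/
def skip (a t i : ℕ) : ℕ := if i ≤ a then i else i + t

theorem skip_of_le {i : ℕ} (hi : i ≤ a) : skip a t i = i := if_pos hi

theorem skip_of_lt {i : ℕ} (hi : a < i) : skip a t i = i + t := if_neg hi.not_ge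

theorem skip_lt (hN : N = N' + t) (i : Fin N') : skip a t i < N := by
  unfold skip
  split_ifs <;> omega

/-- The map of indices that leaves out the `t` positions after `a`; `n'` and `n` are the numbers of
left indices in its domain and codomain. -/
def skipIndex (n n' a t : ℕ) (hN : N = N' + t) (k : Fin N') : Fin N :=
  position n ⟨skip a t (position n' k), skip_lt hN _⟩

section SkipIndex

variable (hN : N = N' + t)

theorem position_skipIndex (k : Fin N') :
    (position n (skipIndex n n' a t hN k) : ℕ) = skip a t (position n' k) := by
  rw [skipIndex, position_position]

theorem notMem_range_skipIndex (ha : a < N') (g : Fin N) :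
    g ∉ Set.range (skipIndex n n' a t hN) ↔
      a < (position n g : ℕ) ∧ (position n g : ℕ) ≤ a + t := by
  constructor
  · refine fun hg => by_contra fun hcon => hg ?_
    have hpos := (position n g).2
    rcases le_or_gt (position n g : ℕ) a with hle | hlt
    · refine ⟨position n' ⟨position n g, by omega⟩, eq_of_position_eq n ?_⟩
      rw [position_skipIndex, position_position, skip_of_le hle]
    · refine ⟨position n' ⟨position n g - t, by omega⟩, eq_of_position_eq n ?_⟩
      rw [position_skipIndex, position_position, skip_of_lt (by dsimp only; omega)]
      dsimp only
      omega
  · rintro ⟨hlt, hle⟩ ⟨k, rfl⟩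
    rw [position_skipIndex, skip] at hlt hle
    split_ifs at hlt hle <;> omega

theorem strictMono_skipIndex (hskip : ∀ i < N', (skip a t i < n ↔ i < n')) :
    StrictMono (skipIndex n n' a t hN) := by
  intro k l hkl
  have hk := hskip _ (position n' k).2
  have hl := hskip _ (position n' l).2
  have hpk := position_val n' k
  have hpl := position_val n' l
  simp only [Fin.lt_def, skipIndex, position_val (n := n)] at hkl ⊢
  generalize (position n' k : ℕ) = pk at *
  generalize (position n' l : ℕ) = pl at *
  unfold skip at *
  split_ifs at * <;> omega

theorem isContraction_skipIndex {χ : Fin N → Side} {χ' : Fin N' → Side} (ha : a < N')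
    (hχ : ∀ k, χ k = Side.left ↔ (k : ℕ) < n) (hχ' : ∀ k, χ' k = Side.left ↔ (k : ℕ) < n')
    (hskip : ∀ i < N', (skip a t i < n ↔ i < n')) :
    IsContraction χ χ' (skipIndex n n' a t hN) (position n' ⟨a, ha⟩) where
  strictMono := strictMono_skipIndex hN hskip
  side i := Side.eq_of_eq_left_iff <| by
    rw [hχ, hχ', ← position_lt_iff, position_skipIndex, hskip _ (Fin.is_lt _), position_lt_iff]
  prec_iff g hg i := by
    rw [notMem_range_skipIndex hN ha] at hg
    rw [prec_iff_position hχ, prec_iff_position hχ', position_skipIndex, position_position, skip]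
    dsimp only
    split_ifs <;> omega

end SkipIndex

/-- The positions up to `j` lie in one block. -/
def InitialBlock (n j : ℕ) (π : Setoid (Fin N)) : Prop :=
  ∀ k l : Fin N, (position n k : ℕ) ≤ j → (position n l : ℕ) ≤ j → π k l

/-- The positions up to `a` lie in one block, which contains none of the next `t` positions, all of
which exist. -/
def InitialBlockWithGap (n a t : ℕ) (π : Setoid (Fin N)) : Prop :=
  a + t < N ∧ InitialBlock n a π ∧ ∀ k l : Fin N, (position n k : ℕ) ≤ a →
    a < (position n l : ℕ) → (position n l : ℕ) ≤ a + t → ¬ π k l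

theorem initialBlockWithGap_zero (ha : a < N) (π : Setoid (Fin N)) :
    InitialBlockWithGap n a 0 π ↔ InitialBlock n a π :=
  ⟨fun h => h.2.1, fun h => ⟨ha, h, fun _ _ _ hl hl' => by omega⟩⟩

theorem InitialBlockWithGap.of_succ {π : Setoid (Fin N)} (h : InitialBlockWithGap n a (t + 1) π) :
    InitialBlockWithGap n a t π :=
  ⟨by have := h.1; omega, h.2.1, fun k l hk hl hl' => h.2.2 k l hk hl (by omega)⟩

section Classification

variable {hN : N = N' + t} {π : Setoid (Fin N)}

theorem rel_of_initialBlock_comap (ha : a < N')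
    (hinit : InitialBlock n' (a + 1) (π.comap (skipIndex n n' a t hN))) {k l : Fin N}
    (hk : (position n k : ℕ) ≤ a ∨ (position n k : ℕ) = a + t + 1)
    (hl : (position n l : ℕ) ≤ a ∨ (position n l : ℕ) = a + t + 1) : π k l := by
  have lift (k : Fin N) (hk : (position n k : ℕ) ≤ a ∨ (position n k : ℕ) = a + t + 1) :
      ∃ i : Fin N', skipIndex n n' a t hN i = k ∧ (position n' i : ℕ) ≤ a + 1 := by
    obtain ⟨i, rfl⟩ : k ∈ Set.range (skipIndex n n' a t hN) := by
      by_contra hcon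
      rw [notMem_range_skipIndex hN ha] at hcon
      omega
    refine ⟨i, rfl, ?_⟩
    rw [position_skipIndex, skip] at hk
    split_ifs at hk <;> omega
  obtain ⟨i, rfl, hi⟩ := lift k hk
  obtain ⟨i', rfl, hi'⟩ := lift l hl
  exact hinit i i' hi hi'

theorem initialBlockWithGap_of_saturated (ha : a < N')
    (hsat : Saturated (skipIndex n n' a t hN) π)
    (hinit : InitialBlock n' (a + 1) (π.comap (skipIndex n n' a t hN))) :
    InitialBlockWithGap n a t π ∧ ¬ InitialBlockWithGap n a (t + 1) π := by
  refine ⟨⟨by omega, fun k l hk hl => rel_of_initialBlock_comap ha hinit (.inl hk) (.inl hl),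
    fun k l hk hl hl' hkl => ?_⟩, fun hgap => ?_⟩
  · have hk' := hsat l ((notMem_range_skipIndex hN ha l).2 ⟨hl, hl'⟩) k (π.symm hkl)
    rw [notMem_range_skipIndex hN ha] at hk'
    omega
  · obtain ⟨o, ho⟩ := exists_position n (i := 0) (N := N) (by omega)
    obtain ⟨y, hy⟩ := exists_position n (i := a + t + 1) (by have := hgap.1; omega)
    exact hgap.2.2 o y (by omega) (by omega) (by omega)
      (rel_of_initialBlock_comap ha hinit (by omega) (.inr hy))

theorem InitialBlockWithGap.rel_of_not_succ (hgap : InitialBlockWithGap n a t π)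
    (hnot : ¬ InitialBlockWithGap n a (t + 1) π) {k y : Fin N} (hk : (position n k : ℕ) ≤ a)
    (hy : (position n y : ℕ) = a + t + 1) : π k y := by
  by_contra hky
  refine hnot ⟨by omega, hgap.2.1, fun k' l hk' hl hl' hkl => ?_⟩
  rcases Nat.lt_or_eq_of_le hl' with hlt | heq
  · exact hgap.2.2 k' l hk' hl (by omega) hkl
  · obtain rfl : l = y := eq_of_position_eq n (by omega)
    exact hky (π.trans (hgap.2.1 k k' hk hk') hkl)

/-- If the initial block ends at position `a`, nothing lies behind the gap, and otherwise a block
that meets the gap and a position behind it would cross the initial block. -/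
theorem InitialBlockWithGap.saturated (ha : a < N') {χ : Fin N → Side}
    (hχ : ∀ k, χ k = Side.left ↔ (k : ℕ) < n) (hπ : IsBiNonCrossing χ π)
    (hgap : InitialBlockWithGap n a t π) (hnot : ¬ InitialBlockWithGap n a (t + 1) π) :
    Saturated (skipIndex n n' a t hN) π := by
  intro g hg x hgx
  rw [notMem_range_skipIndex hN ha] at hg ⊢
  by_contra hx
  rcases le_or_gt (position n x : ℕ) a with hxa | hxa
  · exact hgap.2.2 x g hxa hg.1 hg.2 (π.symm hgx)
  · obtain ⟨o, ho⟩ := exists_position n (i := 0) (N := N) (by omega)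
    obtain ⟨y, hy⟩ := exists_position n (i := a + t + 1) (N := N) (by omega)
    have hoy : π o y := hgap.rel_of_not_succ hnot (by omega) hy
    refine hgap.2.2 o g (by omega) hg.1 hg.2 ?_
    rcases eq_or_ne x y with rfl | hxy
    · exact π.trans hoy (π.symm hgx)
    · have hne : (position n x : ℕ) ≠ position n y := fun e => hxy (eq_of_position_eq n e)
      refine hπ o g y x ?_ ?_ ?_ hoy hgx <;> rw [prec_iff_position hχ] <;> omega

theorem InitialBlockWithGap.initialBlock_comap (hgap : InitialBlockWithGap n a t π)
    (hnot : ¬ InitialBlockWithGap n a (t + 1) π) :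
    InitialBlock n' (a + 1) (π.comap (skipIndex n n' a t hN)) := by
  obtain ⟨o, ho⟩ := exists_position n (i := 0) (N := N) (by have := hgap.1; omega)
  have key (i : Fin N') (hi : (position n' i : ℕ) ≤ a + 1) : π o (skipIndex n n' a t hN i) := by
    have hp := position_skipIndex (n := n) (n' := n') (a := a) hN i
    rw [skip] at hp
    split_ifs at hp with hle
    · exact hgap.2.1 _ _ (by omega) (by omega)
    · exact hgap.rel_of_not_succ hnot (by omega) (by omega)
  exact fun i i' hi hi' => π.trans (π.symm (key i hi)) (key i' hi')

theorem saturated_and_initialBlock_iff (ha : a < N') {χ : Fin N → Side}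
    (hχ : ∀ k, χ k = Side.left ↔ (k : ℕ) < n) (hπ : IsBiNonCrossing χ π) :
    Saturated (skipIndex n n' a t hN) π ∧
        InitialBlock n' (a + 1) (π.comap (skipIndex n n' a t hN)) ↔
      InitialBlockWithGap n a t π ∧ ¬ InitialBlockWithGap n a (t + 1) π :=
  ⟨fun h => initialBlockWithGap_of_saturated ha h.1 h.2,
    fun h => ⟨h.1.saturated ha hχ hπ h.2, h.1.initialBlock_comap h.2⟩⟩

end Classification

end Position

/-! ### Words and partial cumulants -/

section SideMul

variable {M : Type*} [Monoid M]

/-- The product of `Z` with an operator `P` all of whose factors come `≺_χ`-after `Z`. -/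
def sideMul (s : Side) (Z P : M) : M :=
  match s with
  | Side.left => Z * P
  | Side.right => P * Z

theorem sort_insert_max {α : Type*} [LinearOrder α] {s : Finset α} {a : α} (h : ∀ b ∈ s, b < a) :
    (insert a s).sort (· ≤ ·) = s.sort (· ≤ ·) ++ [a] := by
  have hmem {b : α} (hb : b ∈ s.sort (· ≤ ·)) : b < a := h b ((Finset.mem_sort _).1 hb)
  refine List.Perm.eq_of_pairwise' (Finset.pairwise_sort _ _) ?_ ?_
  · exact List.pairwise_append.2 ⟨Finset.pairwise_sort _ _, by simp, fun b hb c hc =>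
      (List.mem_singleton.1 hc) ▸ (hmem hb).le⟩
  · refine (List.perm_ext_iff_of_nodup (Finset.sort_nodup _ _) ?_).2 fun b => by simp [or_comm]
    exact List.nodup_append.2 ⟨Finset.sort_nodup _ _, by simp, fun b hb c hc =>
      (List.mem_singleton.1 hc) ▸ (hmem hb).ne⟩

theorem prod_sort_insert {N n : ℕ} {χ : Fin N → Side} (hχ : ∀ k, χ k = Side.left ↔ (k : ℕ) < n)
    (Z : Fin N → M) {k : Fin N} {V : Finset (Fin N)} (hk : ∀ l ∈ V, Prec χ k l) :
    (((insert k V).sort (· ≤ ·)).map Z).prod =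
      sideMul (χ k) (Z k) ((V.sort (· ≤ ·)).map Z).prod := by
  have hkV : k ∉ V := fun h => Prec.irrefl k (hk k h)
  have hpos (l : Fin N) (hl : l ∈ V) := (prec_iff_position hχ k l).1 (hk l hl)
  simp only [position_val] at hpos
  have hside := hχ k
  cases hs : χ k with
  | left =>
    have hlt : (k : ℕ) < n := hside.1 hs
    rw [Finset.sort_insert, List.map_cons, List.prod_cons, sideMul]
    · intro l hl
      have := hpos l hl
      rw [Fin.le_def]
      split_ifs at this <;> omega
    · exact hkV
  | right =>
    have hle : ¬ (k : ℕ) < n := fun h => by simp [hside.2 h] at hs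
    rw [sort_insert_max, List.map_append, List.prod_append, List.map_singleton,
      List.prod_singleton, sideMul]
    intro l hl
    have := hpos l hl
    rw [Fin.lt_def]
    split_ifs at this <;> omega

end SideMul

section Letters

variable {B A : Type*} [Ring B] [Algebra ℂ B] [Ring A] [Algebra ℂ A]

namespace BBSpace

/-- A labelled operator from the algebra that belongs to its label. -/
abbrev Letter (S : BBSpace B A) : Type _ := Σ s : Side, S.sideAlgebra s

/-- A word of labelled operators. When all left letters come first, the letters are thought of as
listed in the order `≺_χ`: the right operators appear in the reverse of their usual order. -/
abbrev Word (S : BBSpace B A) : Type _ := List S.Letter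

end BBSpace

variable {S : BBSpace B A}

section Words

variable {w : S.Word}

/-- All left letters of the word precede all right letters. -/
def LeftFirst (w : S.Word) : Prop := w.Pairwise fun y z => z.1 = Side.left → y.1 = Side.left

open Classical in
/-- The number of left letters of a word. -/
def leftCount (w : S.Word) : ℕ := w.countP fun z => z.1 = Side.left

theorem LeftFirst.side_eq_left_iff (hw : LeftFirst w) (i : ℕ) (hi : i < w.length) :
    w[i].1 = Side.left ↔ i < leftCount w := by
  classical
  induction w generalizing i with
  | nil => simp at hi
  | cons z w ih =>
    obtain ⟨hz, hw⟩ := List.pairwise_cons.1 hw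
    by_cases hzl : z.1 = Side.left
    · have hcount : leftCount (z :: w) = leftCount w + 1 :=
        List.countP_cons_of_pos (by simpa using hzl)
      rw [hcount]
      cases i with
      | zero => simp [hzl]
      | succ i => simpa using ih hw i (by simpa using hi)
    · have hall : ∀ y ∈ z :: w, y.1 ≠ Side.left :=
        List.forall_mem_cons.2 ⟨hzl, fun y hy hyl => hzl (hz y hy hyl)⟩
      have hcount : leftCount (z :: w) = 0 := List.countP_eq_zero.2 (by simpa using hall)
      rw [hcount]
      simpa using hall _ (List.getElem_mem hi)

/-- The labels of a word as a function of the index. -/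
def wordSide (w : S.Word) (k : Fin w.length) : Side := w[position (leftCount w) k].1

/-- The operators of a word as a function of the index. -/
def wordOp (w : S.Word) (k : Fin w.length) : A := w[position (leftCount w) k].2

theorem wordSide_eq_getElem {k : Fin w.length} {i : ℕ} (hk : (position (leftCount w) k : ℕ) = i)
    (hi : i < w.length) : wordSide w k = w[i].1 := by
  subst hk
  rfl

theorem wordOp_eq_getElem {k : Fin w.length} {i : ℕ} (hk : (position (leftCount w) k : ℕ) = i)
    (hi : i < w.length) : wordOp w k = w[i].2 := by
  subst hk
  rfl

theorem wordOp_mem (w : S.Word) (k : Fin w.length) : wordOp w k ∈ S.sideAlgebra (wordSide w k) :=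
  w[position (leftCount w) k].2.2

theorem LeftFirst.wordSide_eq_left_iff (hw : LeftFirst w) (k : Fin w.length) :
    wordSide w k = Side.left ↔ (k : ℕ) < leftCount w := by
  rw [← position_lt_iff (leftCount w) k]
  exact hw.side_eq_left_iff _ _

/-- The product of a word in the usual order of its indices. -/
def wordProd (w : S.Word) : A := w.foldr (fun z P => sideMul z.1 z.2 P) 1

theorem LeftFirst.prod_interval (hw : LeftFirst w) {t a : ℕ} (h : a + t ≤ w.length)
    {V : Finset (Fin w.length)}
    (hV : ∀ k, k ∈ V ↔ a ≤ (position (leftCount w) k : ℕ) ∧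
      (position (leftCount w) k : ℕ) < a + t) :
    ((V.sort (· ≤ ·)).map (wordOp w)).prod = wordProd ((w.drop a).take t) := by
  induction t generalizing a V with
  | zero =>
    obtain rfl : V = ∅ := Finset.eq_empty_of_forall_notMem fun k hk => by
      have := (hV k).1 hk
      omega
    simp [wordProd]
  | succ t ih =>
    have ha : a < w.length := by omega
    obtain ⟨k, hk⟩ := exists_position (leftCount w) ha
    have hV' (l : Fin w.length) : l ∈ V.erase k ↔ a + 1 ≤ (position (leftCount w) l : ℕ) ∧
        (position (leftCount w) l : ℕ) < a + 1 + t := by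
      have hlk : l ≠ k ↔ (position (leftCount w) l : ℕ) ≠ a :=
        not_congr ⟨fun h => h ▸ hk, fun h => eq_of_position_eq _ (h.trans hk.symm)⟩
      rw [Finset.mem_erase, hV, hlk]
      omega
    rw [← Finset.insert_erase ((hV k).2 (by omega)),
      prod_sort_insert hw.wordSide_eq_left_iff, ih (by omega) hV',
      List.drop_eq_getElem_cons ha, List.take_succ_cons]
    · rw [wordSide_eq_getElem hk ha, wordOp_eq_getElem hk ha, wordProd, wordProd, List.foldr_cons]
    · intro l hl
      rw [prec_iff_position hw.wordSide_eq_left_iff, hk]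
      exact ((hV' l).1 hl).1

end Words

namespace BBSpace

section PartialCumulants

variable {w : S.Word}

/-- `E` of the product of a word. -/
def wordMoment (w : S.Word) : B := S.E (wordProd w)

open Classical in
/-- The sum of the cumulants of a word over all partitions for which the letters at the positions
up to `j` lie in one block. It interpolates between the moment (`j = 0`) and the cumulant. -/
def partialCumulant (w : S.Word) (j : ℕ) : B :=
  ∑ π : BNC (wordSide w) with InitialBlock (leftCount w) j π.1, S.cumulant π (wordOp w)

theorem blockMoment_interval (hw : LeftFirst w) {t a : ℕ} (h : a + t ≤ w.length)
    {V : Finset (Fin w.length)}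
    (hV : ∀ k, k ∈ V ↔ a ≤ (position (leftCount w) k : ℕ) ∧
      (position (leftCount w) k : ℕ) < a + t) :
    S.blockMoment (wordOp w) V = wordMoment ((w.drop a).take t) := by
  rw [blockMoment, hw.prod_interval h hV, wordMoment]

theorem moment_one_wordOp (hw : LeftFirst w) :
    S.moment (BNC.one (wordSide w)) (wordOp w) = wordMoment w := by
  rcases eq_or_ne w [] with rfl | hne
  · simp [moment, momentOn_empty, wordMoment, wordProd, S.E_one]
  · rw [S.moment_one (List.length_pos_of_ne_nil hne),
      blockMoment_interval hw (t := w.length) (a := 0) (by simp) (by simp)]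
    simp

theorem partialCumulant_zero (hw : LeftFirst w) : partialCumulant w 0 = wordMoment w := by
  classical
  rw [← moment_one_wordOp hw, ← S.sum_cumulant_le, partialCumulant]
  congr! 2 with π
  refine iff_of_true (fun k l hk hl => ?_) fun x y _ => trivial
  obtain rfl : k = l := eq_of_position_eq (leftCount w) (by omega)
  exact π.1.refl _

theorem partialCumulant_of_length_le {j : ℕ} (hj : w.length ≤ j + 1) :
    partialCumulant w j = S.kappa (wordSide w) (wordOp w) := by
  classical
  have hone : ({π | InitialBlock (leftCount w) j π.1} : Finset (BNC (wordSide w)))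
      = {BNC.one (wordSide w)} := by
    ext π
    simp only [Finset.mem_filter, Finset.mem_univ, true_and, Finset.mem_singleton]
    constructor
    · exact fun h => Subtype.ext <| Setoid.ext fun k l =>
        iff_of_true (h k l (by omega) (by omega)) trivial
    · rintro rfl k l _ _
      trivial
  rw [partialCumulant, hone, Finset.sum_singleton, kappa]

end PartialCumulants

section Contract

variable {p v : S.Word} {z : S.Letter} {s : ℕ}

/-- The letter `z` with the coefficient `b` inserted after it. -/
def Letter.insAfter (z : S.Letter) (b : B) : S.Letter :=
  ⟨z.1, S.insertAfter z.1 z.2 b, S.insertAfter_mem z.2.2 b⟩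

/-- The word `p ++ z :: v` with the `s` letters after `z` replaced by their moment. -/
def contract (p : S.Word) (z : S.Letter) (v : S.Word) (s : ℕ) : S.Word :=
  p ++ z.insAfter (wordMoment (v.take s)) :: v.drop s

theorem length_contract (p : S.Word) (z : S.Letter) (v : S.Word) (hs : s ≤ v.length) :
    (p ++ z :: v).length = (contract p z v s).length + s := by
  simp only [contract, List.length_append, List.length_cons, List.length_drop]
  omega

theorem lt_length_contract : p.length < (contract p z v s).length := by
  simp [contract]

theorem _root_.BiFree.LeftFirst.contract (hw : LeftFirst (p ++ z :: v)) (s : ℕ) :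
    LeftFirst (contract p z v s) := by
  have hw' : LeftFirst (p ++ z :: v.drop s) :=
    List.Pairwise.sublist (((List.drop_sublist s v).cons_cons z).append_left p) hw
  rw [LeftFirst, ← List.pairwise_map (f := Sigma.fst)
    (R := fun s t => t = Side.left → s = Side.left)] at hw' ⊢
  simpa [BBSpace.contract, Letter.insAfter] using hw'

theorem getElem_contract_self : (contract p z v s)[p.length]'lt_length_contract =
    z.insAfter (wordMoment (v.take s)) := by
  simp [contract]

theorem getElem_contract_of_ne {i : ℕ} (hi : i < (contract p z v s).length)
    (hi' : skip p.length s i < (p ++ z :: v).length) (hne : i ≠ p.length) :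
    (contract p z v s)[i] = (p ++ z :: v)[skip p.length s i] := by
  rcases lt_or_gt_of_ne hne with h | h
  · simp only [skip_of_le h.le, contract]
    rw [List.getElem_append_left h, List.getElem_append_left h]
  · obtain ⟨m, rfl⟩ : ∃ m, i = p.length + (m + 1) := ⟨i - p.length - 1, by omega⟩
    have hskip : skip p.length s (p.length + (m + 1)) = p.length + (s + m + 1) := by
      rw [skip_of_lt h]
      omega
    simp only [hskip, contract]
    rw [List.getElem_append_right (by omega), List.getElem_append_right (by omega)]
    simp

theorem side_getElem_contract {i : ℕ} (hi : i < (contract p z v s).length)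
    (hi' : skip p.length s i < (p ++ z :: v).length) :
    (contract p z v s)[i].1 = (p ++ z :: v)[skip p.length s i].1 := by
  rcases eq_or_ne i p.length with rfl | hne
  · simp [getElem_contract_self, skip, Letter.insAfter]
  · rw [getElem_contract_of_ne hi hi' hne]

/-- The indices of `p ++ z :: v` that survive in `contract p z v s`. -/
def contractIndex (p : S.Word) (z : S.Letter) (v : S.Word) (hs : s ≤ v.length) :
    Fin (contract p z v s).length → Fin (p ++ z :: v).length :=
  skipIndex (leftCount (p ++ z :: v)) (leftCount (contract p z v s)) p.length s
    (length_contract p z v hs)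

/-- The index of the letter of `contract p z v s` that comes from `z`. -/
def contractedIndex (p : S.Word) (z : S.Letter) (v : S.Word) (s : ℕ) :
    Fin (contract p z v s).length :=
  position (leftCount (contract p z v s)) ⟨p.length, lt_length_contract⟩

theorem position_contractedIndex :
    (position (leftCount (contract p z v s)) (contractedIndex p z v s) : ℕ) = p.length := by
  rw [contractedIndex, position_position]

theorem isContraction_contractIndex (hw : LeftFirst (p ++ z :: v)) (hs : s ≤ v.length) :
    IsContraction (wordSide (p ++ z :: v)) (wordSide (contract p z v s)) (contractIndex p z v hs)
      (contractedIndex p z v s) := by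
  refine isContraction_skipIndex _ lt_length_contract hw.wordSide_eq_left_iff
    (hw.contract s).wordSide_eq_left_iff fun i hi => ?_
  have hi' : skip p.length s i < (p ++ z :: v).length :=
    skip_lt (length_contract p z v hs) ⟨i, hi⟩
  rw [← hw.side_eq_left_iff _ hi', ← (hw.contract s).side_eq_left_iff _ hi,
    side_getElem_contract hi hi']

theorem blockMoment_leftOut_contractIndex (hw : LeftFirst (p ++ z :: v)) (hs : s ≤ v.length) :
    S.blockMoment (wordOp (p ++ z :: v)) (leftOut (contractIndex p z v hs)) =
      wordMoment (v.take s) := by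
  rw [blockMoment_interval hw (t := s) (a := p.length + 1)]
  · congr 2
    simp
  · simp only [List.length_append, List.length_cons]
    omega
  · intro k
    rw [mem_leftOut, contractIndex, notMem_range_skipIndex _ lt_length_contract]
    omega

theorem contractsTo_contract (hw : LeftFirst (p ++ z :: v)) (hs : s ≤ v.length) :
    IsContraction.ContractsTo S (wordSide (contract p z v s)) (contractIndex p z v hs)
      (contractedIndex p z v s)
      (wordOp (p ++ z :: v)) (wordOp (contract p z v s)) where
  of_ne i hi := by
    have hne : (position (leftCount (contract p z v s)) i : ℕ) ≠ p.length := fun e =>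
      hi (eq_of_position_eq (leftCount (contract p z v s)) (e.trans position_contractedIndex.symm))
    have hi' := skip_lt (a := p.length) (length_contract p z v hs)
      (position (leftCount (contract p z v s)) i)
    rw [wordOp_eq_getElem rfl (Fin.is_lt _), getElem_contract_of_ne _ hi' hne]
    exact (wordOp_eq_getElem (position_skipIndex _ i) hi').symm
  self := by
    rw [blockMoment_leftOut_contractIndex hw hs]
    have hpos : (position (leftCount (p ++ z :: v))
        (contractIndex p z v hs (contractedIndex p z v s)) : ℕ) = p.length := by
      rw [contractIndex, position_skipIndex, position_contractedIndex, skip_of_le le_rfl]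
    rw [wordOp_eq_getElem position_contractedIndex lt_length_contract,
      wordSide_eq_getElem position_contractedIndex lt_length_contract,
      wordOp_eq_getElem hpos (by simp), getElem_contract_self,
      show (p ++ z :: v)[p.length] = z by simp]
    rfl

open Classical in
theorem partialCumulant_contract_add (hw : LeftFirst (p ++ z :: v)) (hs : s ≤ v.length) :
    partialCumulant (contract p z v s) (p.length + 1)
      + ∑ π : BNC (wordSide (p ++ z :: v)) with
          InitialBlockWithGap (leftCount (p ++ z :: v)) p.length (s + 1) π.1,
          S.cumulant π (wordOp (p ++ z :: v))
      = ∑ π : BNC (wordSide (p ++ z :: v)) with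
          InitialBlockWithGap (leftCount (p ++ z :: v)) p.length s π.1,
          S.cumulant π (wordOp (p ++ z :: v)) := by
  rw [partialCumulant, ← (isContraction_contractIndex hw hs).sum_cumulant_saturated (wordOp_mem _)
    (contractsTo_contract hw hs) fun τ =>
      InitialBlock (leftCount (contract p z v s)) (p.length + 1) τ.1]
  simp only [IsContraction.restrict, contractIndex, saturated_and_initialBlock_iff
    lt_length_contract hw.wordSide_eq_left_iff (Subtype.prop _)]
  rw [← Finset.sum_filter_not_add_sum_filter
    (s := {π : BNC (wordSide (p ++ z :: v)) | InitialBlockWithGap _ p.length s π.1})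
    (p := fun π => InitialBlockWithGap (leftCount (p ++ z :: v)) p.length (s + 1) π.1),
    Finset.filter_filter, Finset.filter_filter]
  congr! 3 with π
  exact ⟨fun h => ⟨h.of_succ, h⟩, fun h => h.2⟩

/-- Sort the partitions by the number `s` of letters between `z` and the next letter of the block
of `z`; if there is no next letter then all letters of `v` are between. -/
theorem partialCumulant_append_cons (hw : LeftFirst (p ++ z :: v)) :
    partialCumulant (p ++ z :: v) p.length =
      ∑ s ∈ Finset.range (v.length + 1), partialCumulant (contract p z v s) (p.length + 1) := by
  classical
  let R (s : ℕ) : B := ∑ π : BNC (wordSide (p ++ z :: v)) with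
    InitialBlockWithGap (leftCount (p ++ z :: v)) p.length s π.1,
    S.cumulant π (wordOp (p ++ z :: v))
  have hzero : partialCumulant (p ++ z :: v) p.length = R 0 := by
    simp only [R, partialCumulant,
      initialBlockWithGap_zero (show p.length < (p ++ z :: v).length by simp)]
  have hlast : R (v.length + 1) = 0 := by
    refine Finset.sum_eq_zero fun π hπ => absurd (Finset.mem_filter.1 hπ).2.1 ?_
    simp only [List.length_append, List.length_cons]
    omega
  have hstep : ∀ s ∈ Finset.range (v.length + 1),
      partialCumulant (contract p z v s) (p.length + 1) = R s - R (s + 1) := fun s hs =>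
    eq_sub_of_add_eq (partialCumulant_contract_add hw (Finset.mem_range_succ_iff.1 hs))
  rw [Finset.sum_congr rfl hstep, Finset.sum_range_sub', hzero, hlast, sub_zero]

end Contract

end BBSpace

end Letters

/-! ### Moving coefficients between letters -/

namespace BBSpace

variable {B A : Type*} [Ring B] [Algebra ℂ B] [Ring A] [Algebra ℂ A] {S : BBSpace B A}

theorem leftFirst_iff_pairwise_map {w : S.Word} : LeftFirst w ↔
    (w.map Sigma.fst).Pairwise fun s t => t = Side.left → s = Side.left :=
  (List.pairwise_map (R := fun s t => t = Side.left → s = Side.left)).symm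

theorem wordMoment_nil : wordMoment ([] : S.Word) = 1 := S.E_one

theorem Letter.insAfter_one (z : S.Letter) : z.insAfter 1 = z := by
  simp [insAfter, insertAfter_one]

theorem Letter.insAfter_insAfter (z : S.Letter) (a b : B) :
    (z.insAfter a).insAfter b = z.insAfter (a * b) := by
  simp [insAfter, insertAfter_insertAfter]

theorem leftFirst_insAfter_iff {p q : S.Word} {z : S.Letter} {b : B} :
    LeftFirst (p ++ z.insAfter b :: q) ↔ LeftFirst (p ++ z :: q) := by
  rw [leftFirst_iff_pairwise_map, leftFirst_iff_pairwise_map]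
  simp [Letter.insAfter]

section ContractAt

/-- The word in which the `t` letters after position `a` are replaced by their moment. -/
def contractAt (w : S.Word) (a t : ℕ) : S.Word :=
  match w.drop a with
  | [] => w
  | z :: v => contract (w.take a) z v t

theorem contractAt_append_cons (p : S.Word) (z : S.Letter) (v : S.Word) (t : ℕ) :
    contractAt (p ++ z :: v) p.length t = contract p z v t := by
  simp [contractAt]

theorem exists_eq_append_cons {α : Type*} {w : List α} {a : ℕ} (ha : a < w.length) :
    ∃ p z v, w = p ++ z :: v ∧ p.length = a :=
  ⟨w.take a, w[a], w.drop (a + 1), by simp, by simp [ha.le]⟩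

theorem exists_eq_append_cons_append {α : Type*} {w : List α} {a t : ℕ} (h : a + t < w.length) :
    ∃ p z g q, w = p ++ z :: (g ++ q) ∧ p.length = a ∧ g.length = t := by
  obtain ⟨p, z, v, rfl, rfl⟩ := exists_eq_append_cons (show a < w.length by omega)
  refine ⟨p, z, v.take t, v.drop t, by simp, rfl, List.length_take_of_le ?_⟩
  simp only [List.length_append, List.length_cons] at h
  omega

theorem length_contractAt {w : S.Word} {a t : ℕ} (h : a + t < w.length) :
    (contractAt w a t).length + t = w.length := by
  obtain ⟨p, z, v, rfl, rfl⟩ := exists_eq_append_cons (show a < w.length by omega)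
  rw [contractAt_append_cons]
  refine (length_contract p z v ?_).symm
  simp only [List.length_append, List.length_cons] at h
  omega

theorem _root_.BiFree.LeftFirst.contractAt {w : S.Word} (hw : LeftFirst w) (a t : ℕ) :
    LeftFirst (contractAt w a t) := by
  by_cases ha : a < w.length
  · obtain ⟨p, z, v, rfl, rfl⟩ := exists_eq_append_cons ha
    rw [contractAt_append_cons]
    exact hw.contract t
  · rwa [BBSpace.contractAt, List.drop_eq_nil_of_le (by omega)]

theorem partialCumulant_succ {w : S.Word} (hw : LeftFirst w) (a : ℕ) :
    partialCumulant w (a + 1) = partialCumulant w a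
      - ∑ t ∈ Finset.range (w.length - (a + 1)),
          partialCumulant (contractAt w a (t + 1)) (a + 1) := by
  rcases lt_or_ge a w.length with ha | ha
  · obtain ⟨p, z, v, rfl, rfl⟩ := exists_eq_append_cons ha
    have hzero : contract p z v 0 = p ++ z :: v := by
      simp [BBSpace.contract, wordMoment_nil, Letter.insAfter_one]
    have hlen : (p ++ z :: v).length - (p.length + 1) = v.length := by
      simp only [List.length_append, List.length_cons]
      omega
    simp only [contractAt_append_cons, hlen]
    rw [partialCumulant_append_cons hw, Finset.sum_range_succ', hzero, add_sub_cancel_left]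
  · rw [Nat.sub_eq_zero_of_le (by omega), Finset.sum_range_zero, sub_zero,
      partialCumulant_of_length_le (by omega), partialCumulant_of_length_le (by omega)]

/-- By the recursion `partialCumulant_succ`, partial cumulants are determined by moments of
contracted words. -/
theorem sum_partialCumulant_eq_zero {ι : Type*} [Fintype ι] (φ : ι → B →+ B)
    (P : (ι → S.Word) → Prop) (hleft : ∀ w, P w → ∀ i, LeftFirst (w i))
    (hmoment : ∀ w, P w → ∑ i, φ i (wordMoment (w i)) = 0)
    (hcontract : ∀ w, P w → ∀ a t, (∀ i, a + t < (w i).length) → P fun i => contractAt (w i) a t)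
    {w : ι → S.Word} (hw : P w) {N : ℕ} (hN : ∀ i, (w i).length = N) (j : ℕ) :
    ∑ i, φ i (partialCumulant (w i) j) = 0 := by
  induction N using Nat.strong_induction_on generalizing w j with
  | _ N ihN =>
  induction j with
  | zero => simpa only [partialCumulant_zero (hleft w hw _)] using hmoment w hw
  | succ a iha =>
    have hstep : ∀ t ∈ Finset.range (N - (a + 1)),
        ∑ i, φ i (partialCumulant (contractAt (w i) a (t + 1)) (a + 1)) = 0 := by
      intro t ht
      have ht' : a + (t + 1) < N := by
        have := Finset.mem_range.1 ht
        omega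
      refine ihN (N - (t + 1)) (by omega)
        (hcontract w hw a (t + 1) fun i => (hN i).symm ▸ ht') (fun i => ?_) (a + 1)
      have := length_contractAt (w := w i) ((hN i).symm ▸ ht')
      rw [hN i] at this
      omega
    simp only [partialCumulant_succ (hleft w hw _), hN, map_sub, map_sum,
      Finset.sum_sub_distrib, iha]
    rw [Finset.sum_comm, Finset.sum_eq_zero hstep, sub_zero]

end ContractAt

section Additivity

variable {ι : Type*} [Fintype ι] {c : ι → ℂ} {s : Side} {x : ι → S.sideAlgebra s}

theorem sum_smul_sideMul_left {x : ι → A} (hx : ∑ i, c i • x i = 0) (s : Side) (P : A) :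
    ∑ i, c i • sideMul s (x i) P = 0 := by
  cases s
  · simp only [sideMul, ← smul_mul_assoc]
    rw [← Finset.sum_mul, hx, zero_mul]
  · simp only [sideMul, ← mul_smul_comm]
    rw [← Finset.mul_sum, hx, mul_zero]

theorem sum_smul_sideMul_right {x : ι → A} (hx : ∑ i, c i • x i = 0) (s : Side) (Z : A) :
    ∑ i, c i • sideMul s Z (x i) = 0 := by
  cases s
  · simp only [sideMul, ← mul_smul_comm]
    rw [← Finset.mul_sum, hx, mul_zero]
  · simp only [sideMul, ← smul_mul_assoc]
    rw [← Finset.sum_mul, hx, zero_mul]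

theorem sum_smul_insertAfter_left {x : ι → A} (hx : ∑ i, c i • x i = 0) (s : Side) (b : B) :
    ∑ i, c i • S.insertAfter s (x i) b = 0 := by
  cases s
  · exact sum_smul_sideMul_left hx Side.left (S.L b)
  · exact sum_smul_sideMul_left hx Side.right (S.R b)

theorem sum_smul_insertAfter_right {b : ι → B} (hb : ∑ i, c i • b i = 0) (s : Side) (Z : A) :
    ∑ i, c i • S.insertAfter s Z (b i) = 0 := by
  cases s
  · refine sum_smul_sideMul_right (x := fun i => S.L (b i)) ?_ Side.left Z
    simp only [L, ← map_smul, ← map_sum, TensorProduct.smul_tmul', ← TensorProduct.sum_tmul, hb,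
      TensorProduct.zero_tmul, map_zero]
  · refine sum_smul_sideMul_right (x := fun i => S.R (b i)) ?_ Side.right Z
    have hb' : ∑ i, c i • MulOpposite.op (b i) = 0 := by
      simpa using congrArg (MulOpposite.opAddEquiv (α := B)) hb
    simp only [R, ← map_smul, ← map_sum, ← TensorProduct.tmul_smul, ← TensorProduct.tmul_sum,
      hb', TensorProduct.tmul_zero, map_zero]

theorem sum_smul_wordProd (hx : ∑ i, c i • (x i : A) = 0) (p q : S.Word) :
    ∑ i, c i • wordProd (p ++ ⟨s, x i⟩ :: q) = 0 := by
  induction p with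
  | nil => exact sum_smul_sideMul_left hx s (wordProd q)
  | cons z p ih => exact sum_smul_sideMul_right ih z.1 (z.2 : A)

theorem sum_smul_wordMoment (hx : ∑ i, c i • (x i : A) = 0) (p q : S.Word) :
    ∑ i, c i • wordMoment (p ++ ⟨s, x i⟩ :: q) = 0 := by
  simp only [wordMoment, ← map_smul, ← map_sum, sum_smul_wordProd hx, map_zero]

theorem contractAt_append_cons_of_lt (p : S.Word) (y : S.Letter) (g : S.Word) (z : S.Letter)
    (v : S.Word) (t : ℕ) : contractAt (p ++ y :: (g ++ z :: v)) (p.length + (g.length + 1)) t =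
      p ++ y :: (g ++ z.insAfter (wordMoment (v.take t)) :: v.drop t) := by
  have h := contractAt_append_cons (p ++ y :: g) z v t
  simpa [contract] using h

/-- A contraction after the position of `x i` does not touch `x i`, a contraction after an earlier
position either does not touch it or absorbs it into the coefficient of another letter. -/
theorem exists_contractAt_append_cons (hx : ∑ i, c i • (x i : A) = 0) (p q : S.Word) {a t : ℕ}
    (hat : a + t < p.length + (q.length + 1)) :
    ∃ (p' q' : S.Word) (s' : Side) (x' : ι → S.sideAlgebra s'), ∑ i, c i • (x' i : A) = 0 ∧
      ∀ i, contractAt (p ++ ⟨s, x i⟩ :: q) a t = p' ++ ⟨s', x' i⟩ :: q' := by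
  rcases lt_trichotomy a p.length with ha | rfl | ha
  · obtain ⟨p, z, g, rfl, rfl⟩ := exists_eq_append_cons ha
    simp only [List.append_assoc, List.cons_append, contractAt_append_cons, contract]
    rcases le_or_gt t g.length with ht | ht
    · refine ⟨p ++ z.insAfter (wordMoment (g.take t)) :: g.drop t, q, s, x, hx, fun i => ?_⟩
      simp [List.take_append_of_le_length ht, List.drop_append_of_le_length ht]
    · obtain ⟨m, rfl⟩ : ∃ m, t = g.length + (m + 1) := ⟨t - g.length - 1, by omega⟩
      refine ⟨p, q.drop m, z.1, fun i =>
        (z.insAfter (wordMoment (g ++ ⟨s, x i⟩ :: q.take m))).2, ?_, fun i => ?_⟩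
      · exact sum_smul_insertAfter_right (sum_smul_wordMoment hx g (q.take m)) z.1 (z.2 : A)
      · simp [List.take_length_add_append, List.drop_length_add_append, Letter.insAfter]
  · refine ⟨p, q.drop t, s, fun i => (Letter.insAfter ⟨s, x i⟩ (wordMoment (q.take t))).2,
      ?_, fun i => ?_⟩
    · exact sum_smul_insertAfter_left hx s (wordMoment (q.take t))
    · simp [contractAt_append_cons, contract, Letter.insAfter]
  · obtain ⟨g, z, v, rfl, hg⟩ := exists_eq_append_cons (show a - (p.length + 1) < q.length by omega)
    obtain rfl : a = p.length + (g.length + 1) := by omega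
    exact ⟨p, g ++ z.insAfter (wordMoment (v.take t)) :: v.drop t, s, x, hx, fun i =>
      contractAt_append_cons_of_lt p _ g z v t⟩

theorem sum_smul_partialCumulant (hx : ∑ i, c i • (x i : A) = 0) {p q : S.Word}
    (hpq : ∀ i, LeftFirst (p ++ ⟨s, x i⟩ :: q)) (j : ℕ) :
    ∑ i, c i • partialCumulant (p ++ ⟨s, x i⟩ :: q) j = 0 := by
  refine sum_partialCumulant_eq_zero (fun i => DistribSMul.toAddMonoidHom B (c i))
    (fun w => (∀ i, LeftFirst (w i)) ∧ ∃ (p q : S.Word) (s : Side) (x : ι → S.sideAlgebra s),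
      ∑ i, c i • (x i : A) = 0 ∧ w = fun i => p ++ ⟨s, x i⟩ :: q) (fun w hw => hw.1) ?_ ?_
    ⟨hpq, p, q, s, x, hx, rfl⟩ (N := p.length + (q.length + 1)) (by simp) j
  · rintro _ ⟨-, p, q, s, x, hx, rfl⟩
    exact sum_smul_wordMoment hx p q
  · rintro _ ⟨hleft, p, q, s, x, hx, rfl⟩ a t hat
    refine ⟨fun i => (hleft i).contractAt a t, ?_⟩
    rcases isEmpty_or_nonempty ι with hι | ⟨⟨i₀⟩⟩
    · exact ⟨p, q, s, x, hx, funext fun i => isEmptyElim i⟩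
    · obtain ⟨p', q', s', x', hx', h⟩ :=
        exists_contractAt_append_cons (c := c) hx p q (a := a) (t := t) (by simpa using hat i₀)
      exact ⟨p', q', s', x', hx', funext h⟩

/-- The partial cumulant of `p ++ z :: q` as a function of a coefficient inserted after `z`. -/
def coefHom (p : S.Word) (z : S.Letter) (q : S.Word) (hpq : LeftFirst (p ++ z :: q)) (j : ℕ) :
    B →+ B :=
  AddMonoidHom.mk' (fun b => partialCumulant (p ++ z.insAfter b :: q) j) fun b b' => by
    let c : Fin 3 → ℂ := ![1, -1, -1]
    let β : Fin 3 → B := ![b + b', b, b']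
    have hβ : ∑ i, c i • β i = 0 := by simp [c, β, Fin.sum_univ_three]
    have hsum : ∑ i, c i • partialCumulant (p ++ z.insAfter (β i) :: q) j = 0 :=
      sum_smul_partialCumulant (sum_smul_insertAfter_right hβ z.1 (z.2 : A))
        (fun _ => leftFirst_insAfter_iff.2 hpq) j
    rw [Fin.sum_univ_three] at hsum
    simpa [c, β, ← sub_eq_add_neg, sub_sub, sub_eq_zero] using hsum

end Additivity

section Coefficients

/-- The letter `z` with the coefficient `b` inserted before it. -/
def Letter.insBefore (z : S.Letter) (b : B) : S.Letter :=
  match z with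
  | ⟨Side.left, Z⟩ => ⟨Side.left, S.L b * Z, mul_mem (S.L_mem b) Z.2⟩
  | ⟨Side.right, Z⟩ => ⟨Side.right, Z * S.R b, mul_mem Z.2 (S.R_mem b)⟩

theorem Letter.fst_insBefore (z : S.Letter) (b : B) : (z.insBefore b).1 = z.1 := by
  obtain ⟨_ | _, Z⟩ := z <;> rfl

theorem Letter.insBefore_insAfter (z : S.Letter) (a b : B) :
    (z.insAfter a).insBefore b = (z.insBefore b).insAfter a := by
  obtain ⟨_ | _, Z⟩ := z <;> simp [insBefore, insAfter, insertAfter, mul_assoc]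

/-- A word with a coefficient before each letter. -/
abbrev CoefWord (S : BBSpace B A) := List (S.Letter × B)

/-- The first coefficient, or `h` for the empty word. -/
def headCoef (T : S.CoefWord) (h : B) : B :=
  match T with
  | [] => h
  | y :: _ => y.2

/-- The word in which each coefficient is multiplied into its own letter. -/
def coefBefore (T : S.CoefWord) : S.Word := T.map fun y => y.1.insBefore y.2

/-- The word in which each coefficient is multiplied into the preceding letter. The first
coefficient is omitted, and `h` is multiplied into the last letter. -/
def coefAfter : S.CoefWord → B → S.Word
  | [], _ => []
  | y :: T, h => y.1.insAfter (headCoef T h) :: coefAfter T h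

section

variable {T T' : S.CoefWord} {h : B}

theorem headCoef_cons (y : S.Letter × B) (T : S.CoefWord) (h : B) : headCoef (y :: T) h = y.2 :=
  rfl

theorem headCoef_append (T T' : S.CoefWord) (h : B) :
    headCoef (T ++ T') h = headCoef T (headCoef T' h) := by
  cases T <;> rfl

theorem coefBefore_append (T T' : S.CoefWord) :
    coefBefore (T ++ T') = coefBefore T ++ coefBefore T' := by
  simp [coefBefore]

theorem coefAfter_append (T T' : S.CoefWord) (h : B) :
    coefAfter (T ++ T') h = coefAfter T (headCoef T' h) ++ coefAfter T' h := by
  induction T with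
  | nil => rfl
  | cons y T ih => simp [coefAfter, ih, headCoef_append]

theorem length_coefBefore (T : S.CoefWord) : (coefBefore T).length = T.length := by
  simp [coefBefore]

theorem length_coefAfter (T : S.CoefWord) (h : B) : (coefAfter T h).length = T.length := by
  induction T with
  | nil => rfl
  | cons y T ih => simp [coefAfter, ih]

theorem map_fst_coefBefore (T : S.CoefWord) :
    (coefBefore T).map Sigma.fst = (T.map Prod.fst).map Sigma.fst := by
  simp [coefBefore, Function.comp_def, Letter.fst_insBefore]

theorem map_fst_coefAfter (T : S.CoefWord) (h : B) :
    (coefAfter T h).map Sigma.fst = (T.map Prod.fst).map Sigma.fst := by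
  induction T with
  | nil => rfl
  | cons y T ih => simp [coefAfter, ih, Letter.insAfter]

theorem leftFirst_coefBefore (hT : LeftFirst (T.map Prod.fst)) : LeftFirst (coefBefore T) := by
  rwa [leftFirst_iff_pairwise_map, map_fst_coefBefore, ← leftFirst_iff_pairwise_map]

theorem leftFirst_coefAfter (hT : LeftFirst (T.map Prod.fst)) (h : B) :
    LeftFirst (coefAfter T h) := by
  rwa [leftFirst_iff_pairwise_map, map_fst_coefAfter, ← leftFirst_iff_pairwise_map]

theorem _root_.BiFree.LeftFirst.forall_right {Z : S.sideAlgebra Side.right} {w : S.Word}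
    (hw : LeftFirst (⟨Side.right, Z⟩ :: w)) : ∀ y ∈ w, y.1 = Side.right := fun y hy =>
  Side.ne_left_iff.1 fun hl => Side.noConfusion ((List.pairwise_cons.1 hw).1 y hy hl)

theorem wordProd_mem_rightAlgebra {w : S.Word} (hw : ∀ y ∈ w, y.1 = Side.right) :
    wordProd w ∈ S.rightAlgebra := by
  induction w with
  | nil => exact one_mem _
  | cons z w ih =>
    obtain ⟨s, Z, hZ⟩ := z
    obtain rfl : s = Side.right := hw _ (List.mem_cons_self ..)
    exact mul_mem (ih fun y hy => hw y (List.mem_cons_of_mem _ hy)) hZ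

theorem wordProd_coefAfter_mul_R (hT : ∀ y ∈ T, y.1.1 = Side.right) (h : B) :
    wordProd (coefAfter T h) * S.R (headCoef T h) = S.R h * wordProd (coefBefore T) := by
  induction T with
  | nil => simp [coefAfter, coefBefore, wordProd, headCoef]
  | cons y T ih =>
    obtain ⟨⟨s, Z⟩, b⟩ := y
    obtain rfl : s = Side.right := hT _ (List.mem_cons_self ..)
    have ih' := ih fun y hy => hT y (List.mem_cons_of_mem _ hy)
    calc wordProd (coefAfter T h) * (S.R (headCoef T h) * Z) * S.R b
        = wordProd (coefAfter T h) * S.R (headCoef T h) * (Z * S.R b) := by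
          simp only [mul_assoc]
      _ = S.R h * (wordProd (coefBefore T) * (Z * S.R b)) := by rw [ih', mul_assoc]

/-- Left coefficients pass to the preceding left letter by associativity. At the last left letter
`E (Z * L b) = E (Z * R b)` turns them into right coefficients, which pass through the right
letters in the reverse order. -/
theorem E_mul_wordProd_coefAfter (hT : LeftFirst (T.map Prod.fst)) (h : B) {Y : A}
    (hY : Y ∈ S.leftAlgebra) :
    S.E (Y * S.L (headCoef T h) * wordProd (coefAfter T h)) =
      S.E (Y * wordProd (coefBefore T)) * h := by
  induction T generalizing Y with
  | nil =>
    simp only [headCoef, coefAfter, coefBefore, wordProd, List.map_nil, List.foldr_nil, mul_one]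
    rw [E_mul_L, ← S.R_comm hY, E_R_mul]
  | cons y T ih =>
    obtain ⟨⟨_ | _, Z⟩, b⟩ := y
    · have := ih hT.of_cons (mul_mem (mul_mem hY (S.L_mem b)) Z.2)
      change S.E (Y * S.L b * (Z * S.L (headCoef T h) * wordProd (coefAfter T h))) =
        S.E (Y * (S.L b * Z * wordProd (coefBefore T))) * h
      simpa only [mul_assoc] using this
    · have hright : ∀ y ∈ T, y.1.1 = Side.right := fun y hy =>
        LeftFirst.forall_right hT y.1 (List.mem_map_of_mem hy)
      set P := wordProd (coefBefore T)
      have hP : P * (Z : A) ∈ S.rightAlgebra := by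
        refine mul_mem (wordProd_mem_rightAlgebra fun y hy => ?_) Z.2
        obtain ⟨x, hx, rfl⟩ := List.mem_map.1 hy
        rw [Letter.fst_insBefore, hright x hx]
      calc S.E (Y * S.L b * (wordProd (coefAfter T h) * (S.R (headCoef T h) * Z)))
          = S.E (Y * (S.L b * S.R h) * (P * Z)) := by
            rw [← mul_assoc (wordProd _), wordProd_coefAfter_mul_R hright]
            simp only [mul_assoc, P]
        _ = S.E (S.R h * (Y * (P * Z)) * S.L b) := by
            rw [L_mul_R, ← mul_assoc Y, ← S.R_comm hY]
            simp only [mul_assoc]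
            rw [← mul_assoc P, S.L_comm hP, mul_assoc]
        _ = S.E (Y * (P * (Z * S.R b))) * h := by
            rw [E_mul_L, mul_assoc, E_R_mul]
            simp only [mul_assoc]

theorem headCoef_mul_wordMoment (hT : LeftFirst (T.map Prod.fst)) (h : B) :
    headCoef T h * wordMoment (coefAfter T h) = wordMoment (coefBefore T) * h := by
  have := E_mul_wordProd_coefAfter hT h (one_mem S.leftAlgebra)
  rwa [one_mul, one_mul, E_L_mul] at this

end

section

variable (p g q : S.CoefWord) (z : S.Letter) (b h : B)

theorem contractAt_coefBefore :
    contractAt (coefBefore (p ++ (z, b) :: (g ++ q))) p.length g.length =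
      coefBefore (p ++ (z.insAfter (wordMoment (coefBefore g)), b) :: q) := by
  have hsplit : coefBefore (p ++ (z, b) :: (g ++ q)) =
      coefBefore p ++ z.insBefore b :: (coefBefore g ++ coefBefore q) := by simp [coefBefore]
  rw [hsplit, ← length_coefBefore p, ← length_coefBefore g, contractAt_append_cons, contract,
    List.take_left, List.drop_left, ← Letter.insBefore_insAfter]
  simp [coefBefore]

theorem contractAt_coefAfter (hg : LeftFirst (g.map Prod.fst)) :
    contractAt (coefAfter (p ++ (z, b) :: (g ++ q)) h) p.length g.length =
      coefAfter (p ++ (z.insAfter (wordMoment (coefBefore g)), b) :: q) h := by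
  have hsplit : coefAfter (p ++ (z, b) :: (g ++ q)) h =
      coefAfter p b ++ z.insAfter (headCoef g (headCoef q h)) ::
        (coefAfter g (headCoef q h) ++ coefAfter q h) := by
    simp [coefAfter_append, coefAfter, headCoef_append, headCoef_cons]
  rw [hsplit, ← length_coefAfter p b, ← length_coefAfter g (headCoef q h),
    contractAt_append_cons, contract, List.take_left, List.drop_left,
    Letter.insAfter_insAfter, headCoef_mul_wordMoment hg]
  simp [coefAfter_append, coefAfter, headCoef_cons, Letter.insAfter_insAfter]

end

theorem headCoef_mul_partialCumulant {T : S.CoefWord} (hT : LeftFirst (T.map Prod.fst)) (h : B)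
    (j : ℕ) :
    headCoef T h * partialCumulant (coefAfter T h) j = partialCumulant (coefBefore T) j * h := by
  have key := sum_partialCumulant_eq_zero
    ![AddMonoidHom.mulLeft (headCoef T h), -AddMonoidHom.mulRight h]
    (fun w => ∃ T' : S.CoefWord, LeftFirst (T'.map Prod.fst) ∧ headCoef T' h = headCoef T h ∧
      w = ![coefAfter T' h, coefBefore T']) ?_ ?_ ?_ ⟨T, hT, rfl, rfl⟩ (N := T.length)
    (by simp [Fin.forall_fin_two, length_coefAfter, length_coefBefore]) j
  · simpa [← sub_eq_add_neg, sub_eq_zero] using key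
  · rintro _ ⟨T', hT', -, rfl⟩
    simp [Fin.forall_fin_two, leftFirst_coefAfter hT', leftFirst_coefBefore hT']
  · rintro _ ⟨T', hT', hhead, rfl⟩
    simp [← hhead, headCoef_mul_wordMoment hT']
  · rintro _ ⟨T', hT', hhead, rfl⟩ a t hat
    have hat' : a + t < T'.length := by simpa [length_coefAfter] using hat 0
    obtain ⟨p, ⟨z, b⟩, g, q, rfl, rfl, rfl⟩ := exists_eq_append_cons_append hat'
    have hg : LeftFirst (g.map Prod.fst) := by
      refine List.Pairwise.sublist (List.Sublist.map _ ?_) hT'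
      exact ((List.sublist_append_left g q).cons _).trans (List.sublist_append_right p _)
    refine ⟨p ++ (z.insAfter (wordMoment (coefBefore g)), b) :: q, ?_, ?_, ?_⟩
    · have hpq : LeftFirst ((p ++ (z, b) :: q).map Prod.fst) :=
        hT'.sublist ((((List.sublist_append_right g q).cons_cons _).append_left p).map _)
      simpa [leftFirst_insAfter_iff] using hpq
    · rw [← hhead, headCoef_append, headCoef_append]
      rfl
    · rw [← contractAt_coefAfter p g q z b h hg, ← contractAt_coefBefore p g q z b]
      exact funext <| Fin.forall_fin_two.2 ⟨rfl, rfl⟩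

end Coefficients

end BBSpace

/-! ### Norm bounds -/

theorem mul_two_pow_mul_pow_add_sum_le {D W : ℝ} (hD : 0 ≤ D) (hW : 0 ≤ W) (a n : ℕ) :
    D * 2 ^ a * (2 * D + 1) ^ (a + 1 + n) * W + ∑ t ∈ Finset.range n,
        D * 2 ^ (a + 1) * (2 * D + 1) ^ (a + 1 + (n - 1 - t)) * (D * W) ≤
      D * 2 ^ (a + 1) * (2 * D + 1) ^ (a + 1 + n) * W := by
  set G := 2 * D + 1 with hG
  have hgeom : 2 * D * ∑ t ∈ Finset.range n, G ^ (n - 1 - t) ≤ G ^ n := by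
    rw [Finset.sum_range_reflect (fun t => G ^ t), show 2 * D = G - 1 by rw [hG]; ring,
      mul_geom_sum]
    linarith
  calc _ = D * 2 ^ a * G ^ (a + 1) * W *
        (G ^ n + 2 * D * ∑ t ∈ Finset.range n, G ^ (n - 1 - t)) := by
        simp only [Finset.mul_sum, mul_add]
        congr 1
        · ring
        · exact Finset.sum_congr rfl fun t _ => by ring
    _ ≤ D * 2 ^ a * G ^ (a + 1) * W * (G ^ n + G ^ n) := by gcongr
    _ = D * 2 ^ (a + 1) * G ^ (a + 1 + n) * W := by ring

namespace BBSpace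

section Bound

variable {B A : Type*} [NormedRing B] [NormedAlgebra ℂ B] [NormedRing A] [NormedAlgebra ℂ A]
  {S : BBSpace B A}

/-- The product of the norms of the letters of a word, each multiplied by `Γ`. -/
def weight (Γ : ℝ) (w : S.Word) : ℝ := (w.map fun z => Γ * ‖(z.2 : A)‖).prod

theorem weight_nil (Γ : ℝ) : weight Γ ([] : S.Word) = 1 := rfl

theorem weight_cons (Γ : ℝ) (z : S.Letter) (w : S.Word) :
    weight Γ (z :: w) = Γ * ‖(z.2 : A)‖ * weight Γ w := by
  simp [weight]

theorem weight_append (Γ : ℝ) (w w' : S.Word) :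
    weight Γ (w ++ w') = weight Γ w * weight Γ w' := by
  simp [weight]

theorem weight_replicate (Γ : ℝ) (n : ℕ) (z : S.Letter) :
    weight Γ (List.replicate n z) = (Γ * ‖(z.2 : A)‖) ^ n := by
  simp [weight]

theorem weight_nonneg {Γ : ℝ} (hΓ : 0 ≤ Γ) (w : S.Word) : 0 ≤ weight Γ w :=
  List.prod_nonneg fun _ hx => by
    obtain ⟨z, -, rfl⟩ := List.mem_map.1 hx
    positivity

theorem pow_length_mul_weight (c Γ : ℝ) (w : S.Word) :
    c ^ w.length * weight Γ w = weight (c * Γ) w := by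
  induction w with
  | nil => simp [weight_nil]
  | cons z w ih => rw [weight_cons, weight_cons, ← ih, List.length_cons]; ring

theorem norm_wordProd_le (w : S.Word) : ‖wordProd w‖ ≤ weight 1 w * ‖(1 : A)‖ := by
  induction w with
  | nil => simp [wordProd, weight_nil]
  | cons z w ih =>
    obtain ⟨s, Z⟩ := z
    have hsideMul : ‖wordProd (⟨s, Z⟩ :: w)‖ ≤ ‖(Z : A)‖ * ‖wordProd w‖ := by
      cases s
      · exact norm_mul_le _ _
      · exact (norm_mul_le _ _).trans_eq (mul_comm _ _)
    rw [weight_cons, one_mul, mul_assoc]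
    exact hsideMul.trans (mul_le_mul_of_nonneg_left ih (norm_nonneg _))

theorem weight_contractAt_le {D : ℝ}
    (hins : ∀ (z : S.Letter) (g : S.Word),
      ‖((z.insAfter (wordMoment g)).2 : A)‖ ≤ D * weight 1 g * ‖(z.2 : A)‖)
    {w : S.Word} {a t : ℕ} (h : a + t < w.length) :
    weight 1 (contractAt w a t) ≤ D * weight 1 w := by
  obtain ⟨p, z, g, q, rfl, rfl, rfl⟩ := exists_eq_append_cons_append h
  rw [contractAt_append_cons, contract, List.take_left, List.drop_left]
  simp only [weight_append, weight_cons, one_mul]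
  have hp := weight_nonneg zero_le_one p
  have hq := weight_nonneg zero_le_one q
  calc weight 1 p * (‖((z.insAfter (wordMoment g)).2 : A)‖ * weight 1 q)
      ≤ weight 1 p * (D * weight 1 g * ‖(z.2 : A)‖ * weight 1 q) := by
        gcongr
        exact hins z g
    _ = D * (weight 1 p * (‖(z.2 : A)‖ * (weight 1 g * weight 1 q))) := by ring

theorem norm_partialCumulant_le {D : ℝ} (hmom : ∀ w : S.Word, ‖wordMoment w‖ ≤ D * weight 1 w)
    (hins : ∀ (z : S.Letter) (g : S.Word),
      ‖((z.insAfter (wordMoment g)).2 : A)‖ ≤ D * weight 1 g * ‖(z.2 : A)‖)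
    {w : S.Word} (hw : LeftFirst w) {j : ℕ} (hj : j ≤ w.length) :
    ‖partialCumulant w j‖ ≤ D * 2 ^ j * (2 * D + 1) ^ w.length * weight 1 w := by
  have hD : 0 ≤ D := (norm_nonneg _).trans (by simpa [weight_nil] using hmom [])
  set G := 2 * D + 1
  induction hN : w.length using Nat.strong_induction_on generalizing w j with
  | _ N ihN =>
  have hW := weight_nonneg zero_le_one w
  induction j with
  | zero =>
    rw [partialCumulant_zero hw, pow_zero, mul_one]
    have hGN : 1 ≤ G ^ N := one_le_pow₀ (by linarith)
    exact (hmom w).trans (mul_le_mul_of_nonneg_right (le_mul_of_one_le_right hD hGN) hW)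
  | succ a iha =>
    obtain ⟨n, rfl⟩ := Nat.exists_eq_add_of_le (hN ▸ hj)
    have hterm : ∀ t ∈ Finset.range n, ‖partialCumulant (contractAt w a (t + 1)) (a + 1)‖ ≤
        D * 2 ^ (a + 1) * G ^ (a + 1 + (n - 1 - t)) * (D * weight 1 w) := by
      intro t ht
      have ht' : a + (t + 1) < w.length := by
        have := Finset.mem_range.1 ht
        omega
      have hlen := length_contractAt ht'
      refine (ihN (a + 1 + (n - 1 - t)) (by omega) (hw.contractAt a (t + 1)) (by omega)
        (by omega)).trans ?_
      gcongr
      exact weight_contractAt_le hins ht'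
    rw [partialCumulant_succ hw, hN, Nat.add_sub_cancel_left]
    calc _ ≤ ‖partialCumulant w a‖
          + ∑ t ∈ Finset.range n, ‖partialCumulant (contractAt w a (t + 1)) (a + 1)‖ :=
          (norm_sub_le _ _).trans (add_le_add_right (norm_sum_le _ _) _)
      _ ≤ D * 2 ^ a * G ^ (a + 1 + n) * weight 1 w + ∑ t ∈ Finset.range n,
            D * 2 ^ (a + 1) * G ^ (a + 1 + (n - 1 - t)) * (D * weight 1 w) :=
          add_le_add (iha (by omega)) (Finset.sum_le_sum hterm)
      _ ≤ D * 2 ^ (a + 1) * G ^ (a + 1 + n) * weight 1 w := mul_two_pow_mul_pow_add_sum_le hD hW a n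

/-- The constant `Γ` bounds the embeddings of `B` into `A` and, up to the weight of the word, the
partial cumulants of all words. -/
structure IsBound (S : BBSpace B A) (Γ : ℝ) : Prop where
  one_le : 1 ≤ Γ
  norm_L_le : ∀ b, ‖S.L b‖ ≤ Γ * ‖b‖
  norm_R_le : ∀ b, ‖S.R b‖ ≤ Γ * ‖b‖
  norm_partialCumulant_le : ∀ w : S.Word, LeftFirst w → ∀ j ≤ w.length,
    ‖partialCumulant w j‖ ≤ Γ * weight Γ w

theorem norm_insAfter_le {K : ℝ} (hL : ∀ b, ‖S.L b‖ ≤ K * ‖b‖) (hR : ∀ b, ‖S.R b‖ ≤ K * ‖b‖)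
    (z : S.Letter) (b : B) : ‖((z.insAfter b).2 : A)‖ ≤ K * ‖b‖ * ‖(z.2 : A)‖ := by
  obtain ⟨_ | _, Z⟩ := z
  · exact (norm_mul_le _ _).trans
      ((mul_comm _ _).trans_le (mul_le_mul_of_nonneg_right (hL b) (norm_nonneg _)))
  · exact (norm_mul_le _ _).trans (mul_le_mul_of_nonneg_right (hR b) (norm_nonneg _))

theorem IsBanach.exists_isBound (hS : S.IsBanach) : ∃ Γ, S.IsBound Γ := by
  obtain ⟨K₁, hE⟩ := hS.E_bounded
  obtain ⟨K₂, hL⟩ := hS.L_bounded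
  obtain ⟨K₃, hR⟩ := hS.R_bounded
  set K := max 1 (max |K₁| (max K₂ K₃))
  have hK : 1 ≤ K := le_max_left _ _
  replace hE (Z : A) : ‖S.E Z‖ ≤ K * ‖Z‖ := (hE Z).trans (by gcongr; simp [K, le_abs_self])
  replace hL (b : B) : ‖S.L b‖ ≤ K * ‖b‖ := (hL b).trans (by gcongr; simp [K])
  replace hR (b : B) : ‖S.R b‖ ≤ K * ‖b‖ := (hR b).trans (by gcongr; simp [K])
  set D := K * (K * (1 + ‖(1 : A)‖))
  have hmom' (w : S.Word) : ‖wordMoment w‖ ≤ K * (1 + ‖(1 : A)‖) * weight 1 w := by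
    have := norm_wordProd_le w
    have := weight_nonneg zero_le_one w
    exact (hE _).trans (by nlinarith)
  have hmom (w : S.Word) : ‖wordMoment w‖ ≤ D * weight 1 w :=
    (hmom' w).trans (mul_le_mul_of_nonneg_right (le_mul_of_one_le_left (by positivity) hK)
      (weight_nonneg zero_le_one w))
  have hins (z : S.Letter) (g : S.Word) :
      ‖((z.insAfter (wordMoment g)).2 : A)‖ ≤ D * weight 1 g * ‖(z.2 : A)‖ := by
    refine (norm_insAfter_le hL hR z _).trans (mul_le_mul_of_nonneg_right ?_ (norm_nonneg _))
    rw [mul_assoc]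
    exact mul_le_mul_of_nonneg_left (hmom' g) (by linarith)
  have hKD : K ≤ D := le_mul_of_one_le_right (by linarith)
    (one_le_mul_of_one_le_of_one_le hK (by linarith [norm_nonneg (1 : A)]))
  refine ⟨2 * (2 * D + 1), by linarith, fun b => (hL b).trans ?_, fun b => (hR b).trans ?_,
    fun w hw j hj => (norm_partialCumulant_le hmom hins hw hj).trans ?_⟩
  · gcongr; linarith
  · gcongr; linarith
  · have hW := weight_nonneg zero_le_one w
    calc D * 2 ^ j * (2 * D + 1) ^ w.length * weight 1 w
        ≤ 2 * (2 * D + 1) * 2 ^ w.length * (2 * D + 1) ^ w.length * weight 1 w := by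
          gcongr
          · linarith
          · exact one_le_two
      _ = 2 * (2 * D + 1) * weight (2 * (2 * D + 1)) w := by
          rw [← mul_one (2 * (2 * D + 1)), ← pow_length_mul_weight, mul_pow]; ring

end Bound

/-! ### Cumulant series -/

section Algebraic

variable {B A : Type*} [Ring B] [Algebra ℂ B] [Ring A] [Algebra ℂ A] {S : BBSpace B A}

theorem _root_.BiFree.LeftFirst.congr_map_fst {w w' : S.Word} (hw : LeftFirst w)
    (h : w'.map Sigma.fst = w.map Sigma.fst) : LeftFirst w' := by
  rwa [leftFirst_iff_pairwise_map, h, ← leftFirst_iff_pairwise_map]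

theorem leftFirst_append {l r : S.Word} (hl : ∀ z ∈ l, z.1 = Side.left)
    (hr : ∀ z ∈ r, z.1 = Side.right) : LeftFirst (l ++ r) := by
  refine List.pairwise_append.2 ⟨?_, ?_, fun y hy _ _ _ => hl y hy⟩
  · exact List.pairwise_iff_getElem.2 fun i j hi _ _ _ => hl _ (List.getElem_mem hi)
  · exact List.pairwise_iff_getElem.2 fun i j _ hj _ h =>
      Side.noConfusion (h.symm.trans (hr _ (List.getElem_mem hj)))

/-- The cumulant of all letters of a word. -/
def wordCumulant (w : S.Word) : B := S.kappa (wordSide w) (wordOp w)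

theorem partialCumulant_length (w : S.Word) : partialCumulant w w.length = wordCumulant w :=
  partialCumulant_of_length_le (by omega)

/-- The word `x ⋯ x · x[c] · y ⋯ y` with `n` letters `x` and `k` letters `y`. -/
def mixedWord (x y : S.Letter) (c : B) (n k : ℕ) : S.Word :=
  List.replicate n x ++ x.insAfter c :: List.replicate k y

/-- The element `c` of `B` as a left letter. -/
def coefLetter (S : BBSpace B A) (c : B) : S.Letter := ⟨Side.left, S.L c, S.L_mem c⟩

/-- The moment of `n` letters `x`, the element `c` of `B`, and `k` letters `y`. -/
def mixedMoment (x y : S.Letter) (c : B) (n k : ℕ) : B :=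
  wordMoment (List.replicate n x ++ S.coefLetter c :: List.replicate k y)

variable {x y : S.Letter} {c : B} {p : S.Word}

theorem leftFirst_append_mixedWord (hp : ∀ z ∈ p, z.1 = Side.left) (hx : x.1 = Side.left)
    (hy : y.1 = Side.right) (n k : ℕ) : LeftFirst (p ++ mixedWord x y c n k) := by
  have := leftFirst_append (l := p ++ List.replicate (n + 1) x) (r := List.replicate k y)
    (by simpa [or_imp, forall_and, hx] using hp) (by simp [hy])
  refine this.congr_map_fst ?_
  simp [mixedWord, Letter.insAfter, List.replicate_succ']

theorem mixedMoment_zero (k : ℕ) :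
    mixedMoment x y c 0 k = c * wordMoment (List.replicate k y) :=
  S.E_L_mul c _

theorem wordMoment_mixedWord (hx : x.1 = Side.left) (n k : ℕ) :
    wordMoment (mixedWord x y c n k) = mixedMoment x y c (n + 1) k := by
  obtain ⟨s, X⟩ := x
  obtain rfl : s = Side.left := hx
  rw [mixedMoment, List.replicate_succ', List.append_assoc, wordMoment, wordMoment, mixedWord]
  congr 1
  simp [wordProd, sideMul, Letter.insAfter, insertAfter, coefLetter, mul_assoc]

theorem partialCumulant_append_replicate_succ {z : S.Letter}
    (hpz : ∀ k, LeftFirst (p ++ z :: List.replicate k z)) (n : ℕ) :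
    partialCumulant (p ++ List.replicate (n + 1) z) p.length =
      ∑ q ∈ Finset.HasAntidiagonal.antidiagonal n,
        coefHom p z (List.replicate q.2 z) (hpz q.2) (p.length + 1)
          (wordMoment (List.replicate q.1 z)) := by
  rw [List.replicate_succ, partialCumulant_append_cons (hpz n), List.length_replicate,
    Finset.Nat.sum_antidiagonal_eq_sum_range_succ_mk]
  refine Finset.sum_congr rfl fun s hs => ?_
  rw [contract, List.take_replicate, List.drop_replicate,
    min_eq_left (Finset.mem_range_succ_iff.1 hs)]
  rfl

/-- The gap after the first of the last letters either lies within the letters `x` or contains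
the letter `x[c]`. -/
theorem partialCumulant_append_mixedWord (hp : ∀ z ∈ p, z.1 = Side.left) (hx : x.1 = Side.left)
    (hy : y.1 = Side.right) (n k : ℕ) :
    partialCumulant (p ++ mixedWord x y c n k) p.length =
      ∑ s ∈ Finset.range n, partialCumulant
        (p ++ x.insAfter (wordMoment (List.replicate s x)) :: mixedWord x y c (n - 1 - s) k)
        (p.length + 1) +
      ∑ q ∈ Finset.HasAntidiagonal.antidiagonal k, partialCumulant
        (p ++ x.insAfter (mixedMoment x y c n q.1) :: List.replicate q.2 y) (p.length + 1) := by
  have hleft := leftFirst_append_mixedWord (c := c) hp hx hy n k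
  rw [Finset.Nat.sum_antidiagonal_eq_sum_range_succ_mk]
  cases n with
  | zero =>
    rw [mixedWord, List.replicate_zero, List.nil_append] at hleft ⊢
    rw [partialCumulant_append_cons hleft, List.length_replicate, Finset.sum_range_zero, zero_add]
    refine Finset.sum_congr rfl fun s hs => ?_
    rw [contract, Letter.insAfter_insAfter, List.take_replicate, List.drop_replicate,
      min_eq_left (Finset.mem_range_succ_iff.1 hs), mixedMoment_zero]
  | succ n =>
    have hcons : mixedWord x y c (n + 1) k = x :: mixedWord x y c n k := rfl
    have hlen : (mixedWord x y c n k).length + 1 = n + 1 + (k + 1) := by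
      simp only [mixedWord, List.length_append, List.length_cons, List.length_replicate]
      omega
    rw [hcons] at hleft ⊢
    rw [partialCumulant_append_cons hleft, hlen, Finset.sum_range_add]
    congr 1
    · refine Finset.sum_congr rfl fun s hs => ?_
      have hsn : s ≤ n := Finset.mem_range_succ_iff.1 hs
      simp [contract, mixedWord, List.take_append_of_le_length, List.drop_append_of_le_length,
        List.take_replicate, List.drop_replicate, hsn]
    · refine Finset.sum_congr rfl fun s hs => ?_
      have hsk : s ≤ k := Finset.mem_range_succ_iff.1 hs
      rw [← wordMoment_mixedWord hx, contract, show n + 1 + s = n + (s + 1) by omega]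
      simp [mixedWord, List.take_append, List.drop_append, List.take_replicate,
        List.drop_replicate, hsk]

end Algebraic

section Series

variable {B A : Type*} [NormedRing B] [NormedAlgebra ℂ B] [NormedRing A] [NormedAlgebra ℂ A]
  {S : BBSpace B A}

open Finset.HasAntidiagonal (antidiagonal)

/-- The sum of the moments of the words `z ⋯ z`. -/
def momentSum (z : S.Letter) : B := ∑' n, wordMoment (List.replicate n z)

/-- The sum of the mixed moments of `x`, `c` and `y`. -/
def mixedMomentSum (x y : S.Letter) (c : B) : B := ∑' q : ℕ × ℕ, mixedMoment x y c q.1 q.2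

/-- The sum over `k` of the cumulants of `p` followed by `k` letters `z`, over all partitions with
the letters of `p` in one block. -/
def tailSum (p : S.Word) (z : S.Letter) : B :=
  ∑' k, partialCumulant (p ++ List.replicate k z) p.length

/-- The analogue of `tailSum` for the words `mixedWord x y c n k` in place of `z ⋯ z`. -/
def mixedTailSum (p : S.Word) (x y : S.Letter) (c : B) : B :=
  ∑' q : ℕ × ℕ, partialCumulant (p ++ mixedWord x y c q.1 q.2) p.length

variable {Γ : ℝ} {p : S.Word} {x y z : S.Letter} {c : B}

theorem weight_replicate_le (hΓ : 0 ≤ Γ) (hz : Γ * ‖(z.2 : A)‖ ≤ 1 / 2) (n : ℕ) :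
    weight Γ (List.replicate n z) ≤ (1 / 2) ^ n := by
  rw [weight_replicate]
  exact pow_le_pow_left₀ (by positivity) hz n

namespace IsBound

variable (hS : S.IsBound Γ)

include hS

theorem nonneg : 0 ≤ Γ := zero_le_one.trans hS.one_le

theorem norm_wordMoment_le {w : S.Word} (hw : LeftFirst w) : ‖wordMoment w‖ ≤ Γ * weight Γ w :=
  partialCumulant_zero hw ▸ hS.norm_partialCumulant_le w hw 0 (Nat.zero_le _)

theorem norm_wordCumulant_le {w : S.Word} (hw : LeftFirst w) :
    ‖wordCumulant w‖ ≤ Γ * weight Γ w :=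
  partialCumulant_length w ▸ hS.norm_partialCumulant_le w hw w.length le_rfl

theorem norm_wordMoment_replicate_le (hz : Γ * ‖(z.2 : A)‖ ≤ 1 / 2) (n : ℕ) :
    ‖wordMoment (List.replicate n z)‖ ≤ Γ * (1 / 2) ^ n := by
  refine (hS.norm_wordMoment_le (List.pairwise_replicate.2 (.inr id))).trans ?_
  exact mul_le_mul_of_nonneg_left (weight_replicate_le hS.nonneg hz n) hS.nonneg

theorem norm_momentSum_le (hz : Γ * ‖(z.2 : A)‖ ≤ 1 / 2) : ‖momentSum z‖ ≤ Γ * 2 :=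
  tsum_of_norm_bounded (hasSum_geometric_two.mul_left Γ) (hS.norm_wordMoment_replicate_le hz)

theorem norm_partialCumulant_append_replicate_le (hz : Γ * ‖(z.2 : A)‖ ≤ 1 / 2) {k : ℕ}
    (hpz : LeftFirst (p ++ List.replicate k z)) {j : ℕ} (hj : j ≤ p.length) :
    ‖partialCumulant (p ++ List.replicate k z) j‖ ≤ Γ * weight Γ p * (1 / 2) ^ k := by
  refine (hS.norm_partialCumulant_le _ hpz j (hj.trans (by simp))).trans ?_
  rw [weight_append, mul_assoc]
  have := hS.nonneg
  have := weight_nonneg this p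
  gcongr
  exact weight_replicate_le hS.nonneg hz k

theorem norm_coefHom_le {q : S.Word} (hpq : LeftFirst (p ++ z :: q)) (b : B) :
    ‖coefHom p z q hpq (p.length + 1) b‖ ≤
      Γ * weight Γ p * (Γ * (Γ * ‖(z.2 : A)‖)) * weight Γ q * ‖b‖ := by
  have hΓ := hS.nonneg
  have hp := weight_nonneg hΓ p
  have hq := weight_nonneg hΓ q
  refine (hS.norm_partialCumulant_le _ (leftFirst_insAfter_iff.2 hpq) _ (by simp)).trans ?_
  rw [weight_append, weight_cons]
  calc Γ * (weight Γ p * (Γ * ‖((z.insAfter b).2 : A)‖ * weight Γ q))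
      ≤ Γ * (weight Γ p * (Γ * (Γ * ‖b‖ * ‖(z.2 : A)‖) * weight Γ q)) := by
        gcongr
        exact norm_insAfter_le hS.norm_L_le hS.norm_R_le z b
    _ = _ := by ring

theorem norm_tailSum_le (hpz : ∀ k, LeftFirst (p ++ List.replicate k z))
    (hz : Γ * ‖(z.2 : A)‖ ≤ 1 / 2) : ‖tailSum p z‖ ≤ Γ * weight Γ p * 2 :=
  tsum_of_norm_bounded (hasSum_geometric_two.mul_left _) fun k =>
    hS.norm_partialCumulant_append_replicate_le hz (hpz k) le_rfl

variable [CompleteSpace B]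

theorem tailSum_eq_add (hpz : ∀ k, LeftFirst (p ++ List.replicate k z))
    (hz : Γ * ‖(z.2 : A)‖ ≤ 1 / 2) :
    tailSum p z = wordCumulant p + tailSum (p ++ [z.insAfter (momentSum z)]) z := by
  have hφ (k : ℕ) (b : B) : ‖coefHom p z (List.replicate k z) (hpz (k + 1)) (p.length + 1) b‖ ≤
      Γ * weight Γ p * (Γ * (Γ * ‖(z.2 : A)‖)) * (1 / 2) ^ k * ‖b‖ := by
    have hΓ := hS.nonneg
    have hp := weight_nonneg hΓ p
    refine (hS.norm_coefHom_le (hpz (k + 1)) b).trans ?_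
    gcongr
    exact weight_replicate_le hΓ hz k
  have hsum := hasSum_sum_antidiagonal <| hasSum_prod_apply
    (fun k => coefHom p z (List.replicate k z) (hpz (k + 1)) (p.length + 1))
    (summable_mul_half_pow _) hφ (e := fun s => wordMoment (List.replicate s z)) <|
    (summable_mul_half_pow Γ).of_nonneg_of_le (fun _ => norm_nonneg _)
      (hS.norm_wordMoment_replicate_le hz)
  have hsummable : Summable fun k => partialCumulant (p ++ List.replicate k z) p.length :=
    (summable_mul_half_pow _).of_norm_bounded fun k =>
      hS.norm_partialCumulant_append_replicate_le hz (hpz k) le_rfl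
  rw [tailSum, hsummable.tsum_eq_zero_add, List.replicate_zero, List.append_nil,
    partialCumulant_length]
  simp only [partialCumulant_append_replicate_succ fun k => hpz (k + 1)]
  rw [hsum.tsum_eq, tailSum]
  congr 1
  refine tsum_congr fun k => ?_
  rw [List.append_assoc, List.length_append]
  rfl

theorem hasSum_wordCumulant_append_replicate (hpz : ∀ k, LeftFirst (p ++ List.replicate k z))
    (hz : Γ * ‖(z.2 : A)‖ ≤ 1 / 2) (hμ : Γ * ‖((z.insAfter (momentSum z)).2 : A)‖ ≤ 1 / 2) :
    HasSum (fun q => wordCumulant (p ++ List.replicate q (z.insAfter (momentSum z))))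
      (tailSum p z) := by
  set z' := z.insAfter (momentSum z)
  have hleft (q k : ℕ) : LeftFirst (p ++ List.replicate q z' ++ List.replicate k z) :=
    (hpz (q + k)).congr_map_fst (by simp [z', Letter.insAfter])
  have hΓ := hS.nonneg
  have hp := weight_nonneg hΓ p
  have hweight (q : ℕ) : weight Γ (p ++ List.replicate q z') ≤ weight Γ p * (1 / 2) ^ q := by
    rw [weight_append]
    exact mul_le_mul_of_nonneg_left (weight_replicate_le hΓ hμ q) hp
  have hstep (q : ℕ) : tailSum (p ++ List.replicate q z') z =
      wordCumulant (p ++ List.replicate q z') + tailSum (p ++ List.replicate (q + 1) z') z := by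
    rw [hS.tailSum_eq_add (hleft q) hz, List.append_assoc, ← List.replicate_succ']
  have hsummable : Summable fun q => wordCumulant (p ++ List.replicate q z') := by
    refine (summable_mul_half_pow (Γ * weight Γ p)).of_norm_bounded fun q => ?_
    refine (hS.norm_wordCumulant_le (by simpa using hleft q 0)).trans ?_
    rw [mul_assoc]
    exact mul_le_mul_of_nonneg_left (hweight q) hΓ
  have htendsto : Filter.Tendsto (fun q => tailSum (p ++ List.replicate q z') z)
      Filter.atTop (nhds 0) := by
    refine squeeze_zero_norm (fun q => ?_)
      (summable_mul_half_pow (Γ * weight Γ p * 2)).tendsto_atTop_zero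
    refine (hS.norm_tailSum_le (hleft q) hz).trans ?_
    have := mul_le_mul_of_nonneg_left (hweight q) hΓ
    linarith
  have h := hasSum_of_eq_add_succ hstep hsummable htendsto
  rwa [List.replicate_zero, List.append_nil] at h

end IsBound

end Series

section MixedSeries

variable {B A : Type*} [NormedRing B] [NormedAlgebra ℂ B] [NormedRing A] [NormedAlgebra ℂ A]
  {S : BBSpace B A} {Γ : ℝ} {p : S.Word} {x y : S.Letter} {c : B}

open Finset.HasAntidiagonal (antidiagonal)

theorem weight_replicate_append_cons_replicate_le (hΓ : 0 ≤ Γ) (hΓx : Γ * ‖(x.2 : A)‖ ≤ 1 / 2)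
    (hΓy : Γ * ‖(y.2 : A)‖ ≤ 1 / 2) (z : S.Letter) (n k : ℕ) :
    weight Γ (List.replicate n x ++ z :: List.replicate k y) ≤
      Γ * ‖(z.2 : A)‖ * ((1 / 2) ^ n * (1 / 2) ^ k) := by
  rw [weight_append, weight_cons, mul_left_comm]
  have := weight_nonneg hΓ (List.replicate k y)
  gcongr
  · exact weight_replicate_le hΓ hΓx n
  · exact weight_replicate_le hΓ hΓy k

namespace IsBound

variable (hS : S.IsBound Γ) (hx : x.1 = Side.left) (hy : y.1 = Side.right)
  (hΓx : Γ * ‖(x.2 : A)‖ ≤ 1 / 2) (hΓy : Γ * ‖(y.2 : A)‖ ≤ 1 / 2)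

include hS hx hy hΓx hΓy

theorem norm_mixedMoment_le (n k : ℕ) :
    ‖mixedMoment x y c n k‖ ≤ Γ * (Γ * ‖S.L c‖) * ((1 / 2) ^ n * (1 / 2) ^ k) := by
  have hleft : LeftFirst (List.replicate n x ++ S.coefLetter c :: List.replicate k y) := by
    have := leftFirst_append (l := List.replicate n x ++ [S.coefLetter c])
      (r := List.replicate k y) (by simp [or_imp, forall_and, hx, coefLetter]) (by simp [hy])
    rwa [List.append_assoc] at this
  refine (hS.norm_wordMoment_le hleft).trans ?_
  rw [mul_assoc]
  exact mul_le_mul_of_nonneg_left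
    (weight_replicate_append_cons_replicate_le hS.nonneg hΓx hΓy _ n k) hS.nonneg

theorem summable_norm_mixedMoment :
    Summable fun q : ℕ × ℕ => ‖mixedMoment x y c q.1 q.2‖ :=
  (summable_mul_half_pow_mul_half_pow _).of_nonneg_of_le (fun _ => norm_nonneg _) fun q =>
    hS.norm_mixedMoment_le hx hy hΓx hΓy q.1 q.2

section

variable (hp : ∀ z ∈ p, z.1 = Side.left)

include hp

theorem norm_partialCumulant_append_mixedWord_le (n k : ℕ) :
    ‖partialCumulant (p ++ mixedWord x y c n k) p.length‖ ≤
      Γ * (weight Γ p * (Γ * ‖((x.insAfter c).2 : A)‖)) * ((1 / 2) ^ n * (1 / 2) ^ k) := by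
  refine (hS.norm_partialCumulant_le _ (leftFirst_append_mixedWord hp hx hy n k) _
    (by simp)).trans ?_
  rw [weight_append, mul_assoc, mul_assoc (weight Γ p)]
  have := hS.nonneg
  have := weight_nonneg this p
  gcongr
  exact weight_replicate_append_cons_replicate_le hS.nonneg hΓx hΓy _ n k

theorem norm_mixedTailSum_le : ‖mixedTailSum p x y c‖ ≤
    Γ * (weight Γ p * (Γ * ‖((x.insAfter c).2 : A)‖)) * (2 * 2) := by
  have hgeom : HasSum (fun q : ℕ × ℕ => (1 / 2 : ℝ) ^ q.1 * (1 / 2) ^ q.2) (2 * 2) :=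
    hasSum_geometric_two.mul hasSum_geometric_two <|
      summable_geometric_two.mul_of_nonneg summable_geometric_two (fun _ => by positivity)
        fun _ => by positivity
  exact tsum_of_norm_bounded (hgeom.mul_left _) fun q =>
    hS.norm_partialCumulant_append_mixedWord_le hx hy hΓx hΓy hp q.1 q.2

variable [CompleteSpace B]

theorem hasSum_partialCumulant_insAfter_wordMoment :
    HasSum (fun q : ℕ × ℕ => ∑ s ∈ Finset.range q.1, partialCumulant
        (p ++ x.insAfter (wordMoment (List.replicate s x)) :: mixedWord x y c (q.1 - 1 - s) q.2)
        (p.length + 1))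
      (mixedTailSum (p ++ [x.insAfter (momentSum x)]) x y c) := by
  have hleft (r : ℕ × ℕ) : LeftFirst (p ++ x :: mixedWord x y c r.1 r.2) :=
    leftFirst_append_mixedWord hp hx hy (r.1 + 1) r.2
  have hφ (r : ℕ × ℕ) (b : B) : ‖coefHom p x _ (hleft r) (p.length + 1) b‖ ≤
      Γ * weight Γ p * (Γ * (Γ * ‖(x.2 : A)‖)) * (Γ * ‖((x.insAfter c).2 : A)‖) *
        ((1 / 2) ^ r.1 * (1 / 2) ^ r.2) * ‖b‖ := by
    have hΓ := hS.nonneg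
    have := weight_nonneg hΓ p
    refine (hS.norm_coefHom_le (hleft r) b).trans ?_
    rw [mul_assoc (Γ * weight Γ p * (Γ * (Γ * ‖(x.2 : A)‖))) (Γ * _)]
    gcongr
    exact weight_replicate_append_cons_replicate_le hΓ hΓx hΓy _ r.1 r.2
  have hsum := hasSum_prod_apply (fun r => coefHom p x _ (hleft r) (p.length + 1))
    (summable_mul_half_pow_mul_half_pow _) hφ (e := fun s => wordMoment (List.replicate s x)) <|
    (summable_mul_half_pow Γ).of_nonneg_of_le (fun _ => norm_nonneg _)
      (hS.norm_wordMoment_replicate_le hΓx)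
  have hvalue : mixedTailSum (p ++ [x.insAfter (momentSum x)]) x y c =
      ∑' r, coefHom p x _ (hleft r) (p.length + 1) (momentSum x) := by
    refine tsum_congr fun r => ?_
    rw [List.append_assoc, List.length_append]
    rfl
  have hantidiagonal := hasSum_sum_range_prod ((Equiv.prodAssoc ℕ ℕ ℕ).hasSum_iff.2 hsum)
  rw [hvalue]
  exact hantidiagonal

theorem hasSum_partialCumulant_insAfter_mixedMoment :
    HasSum (fun q : ℕ × ℕ => ∑ r ∈ antidiagonal q.2, partialCumulant
        (p ++ x.insAfter (mixedMoment x y c q.1 r.1) :: List.replicate r.2 y) (p.length + 1))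
      (tailSum (p ++ [x.insAfter (mixedMomentSum x y c)]) y) := by
  have hleft (t : ℕ) : LeftFirst (p ++ x :: List.replicate t y) := by
    have := leftFirst_append (l := p ++ [x]) (r := List.replicate t y)
      (by simpa [or_imp, forall_and, hx] using hp) (by simp [hy])
    rwa [List.append_assoc] at this
  have hφ (t : ℕ) (b : B) : ‖coefHom p x _ (hleft t) (p.length + 1) b‖ ≤
      Γ * weight Γ p * (Γ * (Γ * ‖(x.2 : A)‖)) * (1 / 2) ^ t * ‖b‖ := by
    have hΓ := hS.nonneg
    have := weight_nonneg hΓ p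
    refine (hS.norm_coefHom_le (hleft t) b).trans ?_
    gcongr
    exact weight_replicate_le hΓ hΓy t
  have hsum := hasSum_prod_apply (fun t => coefHom p x _ (hleft t) (p.length + 1))
    (summable_mul_half_pow _) hφ (hS.summable_norm_mixedMoment (c := c) hx hy hΓx hΓy)
  let e : (ℕ × ℕ) × ℕ ≃ (ℕ × ℕ) × ℕ := (Equiv.prodComm _ _).trans (Equiv.prodAssoc ℕ ℕ ℕ).symm
  have hvalue : tailSum (p ++ [x.insAfter (mixedMomentSum x y c)]) y =
      ∑' t, coefHom p x _ (hleft t) (p.length + 1) (mixedMomentSum x y c) := by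
    refine tsum_congr fun t => ?_
    rw [List.append_assoc, List.length_append]
    rfl
  have hantidiagonal :=
    (Equiv.prodComm ℕ ℕ).hasSum_iff.2 (hasSum_sum_antidiagonal_prod (e.hasSum_iff.2 hsum))
  rw [hvalue]
  exact hantidiagonal

theorem mixedTailSum_eq_add :
    mixedTailSum p x y c = tailSum (p ++ [x.insAfter (mixedMomentSum x y c)]) y +
      mixedTailSum (p ++ [x.insAfter (momentSum x)]) x y c := by
  rw [mixedTailSum, add_comm]
  simp only [partialCumulant_append_mixedWord hp hx hy]
  exact ((hS.hasSum_partialCumulant_insAfter_wordMoment hx hy hΓx hΓy hp).add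
    (hS.hasSum_partialCumulant_insAfter_mixedMoment hx hy hΓx hΓy hp)).tsum_eq

end

variable [CompleteSpace B]

theorem hasSum_tailSum (hμ : Γ * ‖((x.insAfter (momentSum x)).2 : A)‖ ≤ 1 / 2) :
    HasSum (fun n => tailSum (List.replicate n (x.insAfter (momentSum x)) ++
      [x.insAfter (mixedMomentSum x y c)]) y) (mixedTailSum [] x y c) := by
  set x' := x.insAfter (momentSum x)
  set x'' := x.insAfter (mixedMomentSum x y c)
  have hx' (n : ℕ) : ∀ z ∈ List.replicate n x', z.1 = Side.left := by simp [x', Letter.insAfter, hx]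
  have hleft (n k : ℕ) : LeftFirst (List.replicate n x' ++ [x''] ++ List.replicate k y) :=
    leftFirst_append (by simp [x', x'', Letter.insAfter, hx, or_imp, forall_and]) (by simp [hy])
  have hΓ := hS.nonneg
  have hstep (n : ℕ) : mixedTailSum (List.replicate n x') x y c =
      tailSum (List.replicate n x' ++ [x'']) y +
        mixedTailSum (List.replicate (n + 1) x') x y c := by
    rw [hS.mixedTailSum_eq_add hx hy hΓx hΓy (hx' n), ← List.replicate_succ']
  have hsummable : Summable fun n => tailSum (List.replicate n x' ++ [x'']) y := by
    refine (summable_mul_half_pow (Γ * (Γ * ‖(x''.2 : A)‖) * 2)).of_norm_bounded fun n => ?_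
    refine (hS.norm_tailSum_le (hleft n) hΓy).trans ?_
    rw [weight_append, weight_cons, weight_nil]
    have := mul_le_mul_of_nonneg_left (weight_replicate_le hΓ hμ n)
      (by positivity : 0 ≤ Γ * (Γ * ‖(x''.2 : A)‖))
    linarith
  have htendsto : Filter.Tendsto (fun n => mixedTailSum (List.replicate n x') x y c)
      Filter.atTop (nhds 0) := by
    refine squeeze_zero_norm (fun n => ?_) (summable_mul_half_pow
      (Γ * (Γ * ‖((x.insAfter c).2 : A)‖) * (2 * 2))).tendsto_atTop_zero
    refine (hS.norm_mixedTailSum_le hx hy hΓx hΓy (hx' n)).trans ?_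
    have := mul_le_mul_of_nonneg_left (weight_replicate_le hΓ hμ n)
      (by positivity : 0 ≤ Γ * (Γ * ‖((x.insAfter c).2 : A)‖))
    linarith
  exact hasSum_of_eq_add_succ hstep hsummable htendsto

theorem mixedMomentSum_eq_add :
    mixedMomentSum x y c = c * momentSum y + mixedTailSum [] x y c := by
  have hsummable : Summable fun q : ℕ × ℕ => mixedMoment x y c q.1 q.2 :=
    (hS.summable_norm_mixedMoment hx hy hΓx hΓy).of_norm
  have hy' : Summable fun k => wordMoment (List.replicate k y) :=
    (summable_mul_half_pow Γ).of_norm_bounded (hS.norm_wordMoment_replicate_le hΓy)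
  rw [mixedMomentSum, tsum_prod_eq_zero_add hsummable, momentSum, ← hy'.tsum_mul_left]
  simp only [mixedMoment_zero]
  congr 1
  refine tsum_congr fun q => ?_
  rw [← wordMoment_mixedWord hx]
  exact (partialCumulant_zero
    (leftFirst_append_mixedWord (p := []) (by simp) hx hy q.1 q.2)).symm

end IsBound

end MixedSeries

/-! ### The functional equation -/

section Terms

variable {B A : Type*} [Ring B] [Algebra ℂ B] [Ring A] [Algebra ℂ A] {S : BBSpace B A}

theorem headCoef_mul_wordCumulant {T : S.CoefWord} (hT : LeftFirst (T.map Prod.fst)) :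
    headCoef T 1 * wordCumulant (coefAfter T 1) = wordCumulant (coefBefore T) := by
  rw [← partialCumulant_length, ← partialCumulant_length, length_coefAfter, length_coefBefore,
    headCoef_mul_partialCumulant hT, mul_one]

theorem headCoef_replicate (n : ℕ) (z : S.Letter) (b : B) :
    headCoef (List.replicate n (z, b)) b = b := by
  cases n <;> rfl

theorem coefBefore_replicate (n : ℕ) (z : S.Letter) (b : B) :
    coefBefore (List.replicate n (z, b)) = List.replicate n (z.insBefore b) := by
  simp [coefBefore]

theorem coefAfter_replicate (n : ℕ) (z : S.Letter) (b : B) :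
    coefAfter (List.replicate n (z, b)) b = List.replicate n (z.insAfter b) := by
  induction n with
  | zero => rfl
  | succ n ih => rw [List.replicate_succ, coefAfter, ih, headCoef_replicate, List.replicate_succ]

theorem Letter.insBefore_one (z : S.Letter) : z.insBefore 1 = z := by
  obtain ⟨_ | _, Z⟩ := z <;> simp [insBefore, L_one, R_one]

theorem kappa_congr {N N' : ℕ} (h : N = N') {χ : Fin N → Side} {χ' : Fin N' → Side}
    {Z : Fin N → A} {Z' : Fin N' → A} (hχ : ∀ k, χ k = χ' (Fin.cast h k))
    (hZ : ∀ k, Z k = Z' (Fin.cast h k)) : S.kappa χ Z = S.kappa χ' Z' := by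
  subst h
  obtain rfl : χ = χ' := funext hχ
  obtain rfl : Z = Z' := funext hZ
  rfl

theorem kappa_chi {l r : S.Word} (hl : ∀ z ∈ l, z.1 = Side.left) (hr : ∀ z ∈ r, z.1 = Side.right)
    {n m : ℕ} {Z : Fin (n + m) → A}
    (hZl : List.ofFn (fun k => Z (Fin.castAdd m k)) = l.map fun z => (z.2 : A))
    (hZr : (List.ofFn fun k => Z (Fin.natAdd n k)).reverse = r.map fun z => (z.2 : A)) :
    S.kappa (chi n m) Z = wordCumulant (l ++ r) := by
  obtain rfl : n = l.length := by simpa using congrArg List.length hZl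
  obtain rfl : m = r.length := by simpa using congrArg List.length hZr
  have hcount : leftCount (l ++ r) = l.length := by
    rw [leftCount, List.countP_append, List.countP_eq_length.2 (by simpa using hl),
      List.countP_eq_zero.2 (by simpa using fun z hz => by simp [hr z hz]), add_zero]
  have hposl (k : Fin l.length) : (position (leftCount (l ++ r))
      (Fin.cast List.length_append.symm (Fin.castAdd r.length k)) : ℕ) = k := by
    rw [position_val, hcount, if_pos (by simp)]
    rfl
  have hposr (k : Fin r.length) : (position (leftCount (l ++ r))
      (Fin.cast List.length_append.symm (Fin.natAdd l.length k)) : ℕ) = k.rev + l.length := by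
    rw [position_val, hcount, if_neg (by simp)]
    simp only [List.length_append, Fin.val_cast, Fin.val_natAdd, Fin.val_rev]
    omega
  have hlt (k : Fin r.length) : (k.rev : ℕ) + l.length < (l ++ r).length := by
    have := k.rev.2
    rw [List.length_append]
    omega
  refine kappa_congr List.length_append.symm (Fin.addCases (fun k => ?_) fun k => ?_)
    (Fin.addCases (fun k => ?_) fun k => ?_)
  · rw [wordSide_eq_getElem (hposl k) (by simp; omega), List.getElem_append_left k.2,
      hl _ (List.getElem_mem _)]
    simp [chi]
  · rw [wordSide_eq_getElem (hposr k) (hlt k), ← List.getElem_append_right' l k.rev.2,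
      hr _ (List.getElem_mem _)]
    simp [chi]
  · rw [wordOp_eq_getElem (hposl k) (by simp; omega), List.getElem_append_left k.2]
    simpa using List.getElem_of_eq hZl (by simp : (k : ℕ) < _)
  · rw [wordOp_eq_getElem (hposr k) (hlt k), ← List.getElem_append_right' l k.rev.2]
    have hrev := List.getElem_of_eq hZr (i := k.rev) (by simpa using Fin.pos k)
    have hlast : r.length - 1 - (k.rev : ℕ) = k := by rw [Fin.val_rev]; omega
    simp only [List.getElem_reverse, List.getElem_ofFn, List.length_ofFn, hlast,
      List.getElem_map] at hrev
    exact hrev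

/-- The letter `L_b X`. -/
def leftLetter {X : A} (hX : X ∈ S.leftAlgebra) (b : B) : S.Letter :=
  ⟨Side.left, S.L b * X, mul_mem (S.L_mem b) hX⟩

/-- The letter `R_d Y`. -/
def rightLetter {Y : A} (hY : Y ∈ S.rightAlgebra) (d : B) : S.Letter :=
  ⟨Side.right, S.R d * Y, mul_mem (S.R_mem d) hY⟩

variable {X Y : A} (hX : X ∈ S.leftAlgebra) (hY : Y ∈ S.rightAlgebra)

theorem leftLetter_mul (a b : B) : leftLetter hX (a * b) = (leftLetter hX b).insBefore a := by
  simp [leftLetter, Letter.insBefore, L_mul, mul_assoc]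

theorem rightLetter_mul (d a : B) : rightLetter hY (d * a) = (rightLetter hY d).insAfter a := by
  simp [rightLetter, Letter.insAfter, insertAfter, R_mul, mul_assoc]

theorem leftTerm_eq_wordCumulant (b c : B) (n : ℕ) :
    S.leftTerm X b c (n + 1) =
      wordCumulant (List.replicate n (leftLetter hX b) ++ [(leftLetter hX b).insAfter c]) := by
  rw [leftTerm, kappa_chi (n := n + 1) (m := 0) (r := [])
    (l := List.replicate n (leftLetter hX b) ++ [(leftLetter hX b).insAfter c])
    (by simp [or_imp, forall_and, leftLetter, Letter.insAfter]) (by simp) ?_ rfl, List.append_nil]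
  rw [List.ofFn_succ']
  have (k : Fin n) : (k : ℕ) ≠ n := k.2.ne
  simp [this, leftLetter, Letter.insAfter, insertAfter]

theorem mixedTerm_eq_wordCumulant (b c d : B) (n m : ℕ) :
    S.mixedTerm X Y b c d n (m + 1) =
      wordCumulant (List.replicate n (leftLetter hX b) ++
        (rightLetter hY d).insBefore c :: List.replicate m (rightLetter hY d)) := by
  refine kappa_chi (by simp [leftLetter]) (by simp [rightLetter, Letter.fst_insBefore]) ?_ ?_
  · simp [leftLetter]
  · rw [List.ofFn_succ']
    have (k : Fin m) : (k : ℕ) ≠ m := k.2.ne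
    simp [this, ← add_assoc, rightLetter, Letter.insBefore]

theorem leftTerm_mul (a b c : B) (n : ℕ) :
    S.leftTerm X (a * b) c (n + 1) = a * wordCumulant
      (List.replicate n ((leftLetter hX b).insAfter a) ++ [(leftLetter hX b).insAfter c]) := by
  set x := leftLetter hX b
  let T : S.CoefWord := List.replicate n (x, a) ++ [(x.insAfter c, a)]
  have hT : LeftFirst (T.map Prod.fst) := by
    have := leftFirst_append (l := T.map Prod.fst) (r := [])
      (by simp [T, x, leftLetter, Letter.insAfter, or_imp, forall_and]) (by simp)
    rwa [List.append_nil] at this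
  have hhead : headCoef T 1 = a := by
    rw [headCoef_append, headCoef_cons, headCoef_replicate]
  have hafter : coefAfter T 1 = List.replicate n (x.insAfter a) ++ [x.insAfter c] := by
    rw [coefAfter_append, headCoef_cons, coefAfter_replicate, coefAfter, headCoef, coefAfter,
      Letter.insAfter_one]
  have hbefore :
      coefBefore T = List.replicate n (x.insBefore a) ++ [(x.insBefore a).insAfter c] := by
    rw [coefBefore_append, coefBefore_replicate, ← Letter.insBefore_insAfter]
    rfl
  rw [leftTerm_eq_wordCumulant hX, leftLetter_mul, ← hbefore, ← hafter,
    ← headCoef_mul_wordCumulant hT, hhead]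

theorem mixedTerm_mul (a b c d e : B) (n m : ℕ) {T : S.CoefWord}
    (hT : T = List.replicate n (leftLetter hX b, a) ++ ((rightLetter hY d).insAfter e, c) ::
      List.replicate m ((rightLetter hY d).insAfter e, 1)) :
    S.mixedTerm X Y (a * b) c (d * e) n (m + 1) =
      headCoef T 1 * wordCumulant (coefAfter T 1) := by
  have hbefore : coefBefore T = List.replicate n ((leftLetter hX b).insBefore a) ++
      ((rightLetter hY d).insAfter e).insBefore c ::
        List.replicate m ((rightLetter hY d).insAfter e) := by
    simp [hT, coefBefore, Letter.insBefore_one]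
  rw [headCoef_mul_wordCumulant, mixedTerm_eq_wordCumulant hX hY, leftLetter_mul, rightLetter_mul,
    hbefore]
  rw [hT, List.map_append]
  exact leftFirst_append (by simp [leftLetter]) (by simp [rightLetter, Letter.insAfter])

include hX in
theorem mixedTerm_zero_mul (a b c d e : B) (m : ℕ) :
    S.mixedTerm X Y (a * b) c (d * e) 0 (m + 1) =
      c * wordCumulant (List.replicate (m + 1) ((rightLetter hY d).insAfter e)) := by
  rw [mixedTerm_mul hX hY a b c d e 0 m rfl, List.replicate_zero, List.nil_append, headCoef_cons,
    coefAfter, headCoef_replicate, coefAfter_replicate, Letter.insAfter_one, List.replicate_succ]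

theorem mixedTerm_succ_mul (a b c d e : B) (n m : ℕ) :
    S.mixedTerm X Y (a * b) c (d * e) (n + 1) (m + 1) = a * wordCumulant
      (List.replicate n ((leftLetter hX b).insAfter a) ++ (leftLetter hX b).insAfter c ::
        List.replicate (m + 1) ((rightLetter hY d).insAfter e)) := by
  rw [mixedTerm_mul hX hY a b c d e (n + 1) m rfl, List.replicate_succ', List.append_assoc,
    headCoef_append, coefAfter_append]
  simp only [List.cons_append, List.nil_append, headCoef_cons, coefAfter, headCoef_replicate,
    coefAfter_replicate, Letter.insAfter_one, List.replicate_succ]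

theorem wordProd_replicate_leftLetter_append (b : B) (n : ℕ) (w : S.Word) :
    wordProd (List.replicate n (leftLetter hX b) ++ w) = (S.L b * X) ^ n * wordProd w := by
  induction n with
  | zero => simp
  | succ n ih => rw [pow_succ', mul_assoc, ← ih]; rfl

theorem wordProd_replicate_rightLetter (d : B) (n : ℕ) :
    wordProd (List.replicate n (rightLetter hY d)) = (S.R d * Y) ^ n := by
  induction n with
  | zero => simp [wordProd]
  | succ n ih => rw [pow_succ, ← ih]; rfl

theorem wordMoment_replicate_leftLetter (b : B) (n : ℕ) :
    wordMoment (List.replicate n (leftLetter hX b)) = S.E ((S.L b * X) ^ n) := by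
  have := wordProd_replicate_leftLetter_append hX b n []
  rw [List.append_nil] at this
  rw [wordMoment, this]
  simp [wordProd]

theorem wordMoment_replicate_rightLetter (d : B) (n : ℕ) :
    wordMoment (List.replicate n (rightLetter hY d)) = S.E ((S.R d * Y) ^ n) := by
  rw [wordMoment, wordProd_replicate_rightLetter]

theorem mixedMoment_leftLetter_rightLetter (b c d : B) (n k : ℕ) :
    mixedMoment (leftLetter hX b) (rightLetter hY d) c n k =
      S.E ((S.L b * X) ^ n * (S.R d * Y) ^ k * S.R c) := by
  have hcoef : wordProd (S.coefLetter c :: List.replicate k (rightLetter hY d)) =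
      S.L c * (S.R d * Y) ^ k := by
    rw [← wordProd_replicate_rightLetter hY]
    rfl
  rw [← E_mul_L, mixedMoment, wordMoment, wordProd_replicate_leftLetter_append, hcoef, mul_assoc,
    S.L_comm (pow_mem (mul_mem (S.R_mem d) hY) k)]

end Terms

section FunctionalEquation

variable {B A : Type*} [NormedRing B] [NormedAlgebra ℂ B] [NormedRing A] [NormedAlgebra ℂ A]
  {S : BBSpace B A} {Γ : ℝ} {X Y : A} {b c d : B}

theorem M_eq_mixedMomentSum (hX : X ∈ S.leftAlgebra) (hY : Y ∈ S.rightAlgebra) :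
    S.M X Y b c d = mixedMomentSum (leftLetter hX b) (rightLetter hY d) c := by
  simp only [M, mixedMomentSum, mixedMoment_leftLetter_rightLetter]

theorem wordCumulant_nil : wordCumulant ([] : S.Word) = 1 :=
  (partialCumulant_length []).symm.trans ((partialCumulant_zero List.Pairwise.nil).trans S.E_one)

theorem tailSum_nil (z : S.Letter) : tailSum [] z = momentSum z :=
  tsum_congr fun _ => partialCumulant_zero (List.pairwise_replicate.2 (.inr id))

namespace IsBound

variable (hS : S.IsBound Γ)

include hS

theorem summable_norm_wordMoment_replicate {z : S.Letter} (hz : Γ * ‖(z.2 : A)‖ ≤ 1 / 2) :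
    Summable fun n => ‖wordMoment (List.replicate n z)‖ :=
  (summable_mul_half_pow Γ).of_nonneg_of_le (fun _ => norm_nonneg _)
    (hS.norm_wordMoment_replicate_le hz)

variable (hX : X ∈ S.leftAlgebra) (hY : Y ∈ S.rightAlgebra)
  (hb : Γ * ‖S.L b * X‖ ≤ 1 / 2) (hd : Γ * ‖S.R d * Y‖ ≤ 1 / 2)

include hX hb in
theorem mlConverges : S.MlConverges X b := by
  have := hS.summable_norm_wordMoment_replicate (z := leftLetter hX b) hb
  simp only [wordMoment_replicate_leftLetter] at this
  exact (summable_nat_add_iff (f := fun n => ‖S.E ((S.L b * X) ^ n)‖) 1).2 this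

include hY hd in
theorem mrConverges : S.MrConverges Y d := by
  have := hS.summable_norm_wordMoment_replicate (z := rightLetter hY d) hd
  simp only [wordMoment_replicate_rightLetter] at this
  exact (summable_nat_add_iff (f := fun n => ‖S.E ((S.R d * Y) ^ n)‖) 1).2 this

include hX hY hb hd

theorem mConverges : S.MConverges X Y b c d := by
  have := hS.summable_norm_mixedMoment (c := c) (x := leftLetter hX b) (y := rightLetter hY d)
    rfl rfl hb hd
  simp only [mixedMoment_leftLetter_rightLetter] at this
  exact this

theorem cConverges : S.CConverges X Y b c d := by
  have hΓ := hS.nonneg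
  constructor
  · refine (summable_mul_half_pow (Γ * (Γ * ‖(((leftLetter hX b).insAfter c).2 : A)‖)))
      |>.of_nonneg_of_le (fun _ => norm_nonneg _) fun n => ?_
    rw [leftTerm_eq_wordCumulant hX]
    have hleft := leftFirst_append (r := []) (l := List.replicate n (leftLetter hX b) ++
      [(leftLetter hX b).insAfter c]) (by simp [leftLetter, Letter.insAfter, or_imp, forall_and])
      (by simp)
    rw [List.append_nil] at hleft
    refine (hS.norm_wordCumulant_le hleft).trans ?_
    have := weight_replicate_append_cons_replicate_le hΓ hb hd
      ((leftLetter hX b).insAfter c) n 0 (x := leftLetter hX b) (y := rightLetter hY d)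
    rw [pow_zero, mul_one, List.replicate_zero] at this
    rw [mul_assoc]
    exact mul_le_mul_of_nonneg_left this hΓ
  · refine (summable_mul_half_pow_mul_half_pow
      (Γ * (Γ * ‖(((rightLetter hY d).insBefore c).2 : A)‖))).of_nonneg_of_le
      (fun _ => norm_nonneg _) fun p => ?_
    rw [mixedTerm_eq_wordCumulant hX hY]
    refine (hS.norm_wordCumulant_le (leftFirst_append (by simp [leftLetter])
      (by simp [rightLetter, Letter.fst_insBefore]))).trans ?_
    rw [mul_assoc]
    exact mul_le_mul_of_nonneg_left
      (weight_replicate_append_cons_replicate_le hΓ hb hd _ p.1 p.2) hΓ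

end IsBound

namespace IsBound

variable [CompleteSpace B] (hS : S.IsBound Γ)

include hS

theorem momentSum_eq_one_add {z : S.Letter} (hz : Γ * ‖(z.2 : A)‖ ≤ 1 / 2) :
    momentSum z = 1 + ∑' n, wordMoment (List.replicate (n + 1) z) := by
  rw [momentSum, (hS.summable_norm_wordMoment_replicate hz).of_norm.tsum_eq_zero_add]
  congr 1
  exact S.E_one

variable (hX : X ∈ S.leftAlgebra) (hY : Y ∈ S.rightAlgebra)
  (hb : Γ * ‖S.L b * X‖ ≤ 1 / 2) (hd : Γ * ‖S.R d * Y‖ ≤ 1 / 2)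

include hb in
theorem Ml_eq_momentSum : S.Ml X b = momentSum (leftLetter hX b) := by
  rw [hS.momentSum_eq_one_add hb]
  simp only [Ml, wordMoment_replicate_leftLetter]

include hd

theorem Mr_eq_momentSum : S.Mr Y d = momentSum (rightLetter hY d) := by
  rw [hS.momentSum_eq_one_add hd]
  simp only [Mr, wordMoment_replicate_rightLetter]

variable (hr : Γ * ‖(((rightLetter hY d).insAfter (S.Mr Y d)).2 : A)‖ ≤ 1 / 2)

include hX hr

theorem hasSum_mixedTerm_zero (a : B) :
    HasSum (fun k => S.mixedTerm X Y (a * b) c (d * S.Mr Y d) 0 (k + 1)) (c * S.Mr Y d - c) := by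
  have hMr := hS.Mr_eq_momentSum hY hd
  rw [hMr] at hr
  have hleft (k : ℕ) : LeftFirst ([] ++ List.replicate k (rightLetter hY d)) :=
    leftFirst_append (by simp) (by simp [rightLetter])
  have h := (hasSum_nat_add_iff' 1).2
    ((hS.hasSum_wordCumulant_append_replicate (p := []) hleft hd hr).mul_left c)
  simp only [Finset.sum_range_one, List.replicate_zero, List.nil_append, wordCumulant_nil,
    tailSum_nil, mul_one, ← hMr] at h
  simp only [mixedTerm_zero_mul hX hY]
  exact h

theorem hasSum_mixedTerm_succ (a : B) (n : ℕ) :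
    HasSum (fun k => S.mixedTerm X Y (a * b) c (d * S.Mr Y d) (n + 1) (k + 1))
      (a * tailSum (List.replicate n ((leftLetter hX b).insAfter a) ++
        [(leftLetter hX b).insAfter c]) (rightLetter hY d) - S.leftTerm X (a * b) c (n + 1)) := by
  have hMr := hS.Mr_eq_momentSum hY hd
  rw [hMr] at hr ⊢
  have hleft (k : ℕ) : LeftFirst (List.replicate n ((leftLetter hX b).insAfter a) ++
      [(leftLetter hX b).insAfter c] ++ List.replicate k (rightLetter hY d)) :=
    leftFirst_append (by simp [leftLetter, Letter.insAfter, or_imp, forall_and])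
      (by simp [rightLetter])
  have h := (hasSum_nat_add_iff' 1).2
    ((hS.hasSum_wordCumulant_append_replicate hleft hd hr).mul_left a)
  simp only [Finset.sum_range_one, List.replicate_zero, List.append_nil] at h
  rw [leftTerm_mul hX]
  simp only [mixedTerm_succ_mul hX hY]
  simp only [List.append_assoc, List.singleton_append] at h
  exact h

variable (hl : Γ * ‖(((leftLetter hX b).insAfter (S.Ml X b)).2 : A)‖ ≤ 1 / 2)
  (hC : S.CConverges X Y (S.Ml X b * b) (S.M X Y b c d) (d * S.Mr Y d))

include hb hl hC

theorem C_eq :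
    S.C X Y (S.Ml X b * b) (S.M X Y b c d) (d * S.Mr Y d) =
      S.M X Y b c d * S.Mr Y d + S.Ml X b * (S.M X Y b c d - c * S.Mr Y d) := by
  have hMl := hS.Ml_eq_momentSum hX hb
  have hMr := hS.Mr_eq_momentSum hY hd
  have hM := M_eq_mixedMomentSum (b := b) (c := c) (d := d) hX hY
  have hrows := hS.hasSum_tailSum (c := c) (x := leftLetter hX b) (y := rightLetter hY d) rfl rfl
    hb hd (hMl ▸ hl)
  have htail : mixedTailSum [] (leftLetter hX b) (rightLetter hY d) c =
      S.M X Y b c d - c * S.Mr Y d := by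
    rw [hM, hS.mixedMomentSum_eq_add rfl rfl hb hd, hMr, add_sub_cancel_left]
  rw [htail, ← hMl, ← hM] at hrows
  have hsucc := (hrows.mul_left (S.Ml X b)).sub hC.1.of_norm.hasSum
  simp only [← (hS.hasSum_mixedTerm_succ hX hY hd hr _ _).tsum_eq] at hsucc
  have hfibers := hC.2.of_norm.hasSum.prod_fiberwise fun n => (hC.2.of_norm.prod_factor n).hasSum
  have hmixed := hfibers.unique hsucc.zero_add
  rw [C, hmixed, (hS.hasSum_mixedTerm_zero hX hY hd hr _).tsum_eq]
  abel

theorem functional_equation :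
    S.Ml X b * S.M X Y b c d + S.M X Y b c d * S.Mr Y d =
      S.Ml X b * c * S.Mr Y d
        + S.C X Y (S.Ml X b * b) (S.M X Y b c d) (d * S.Mr Y d) := by
  rw [hS.C_eq hX hY hb hd hr hl hC]
  noncomm_ring

end IsBound

end FunctionalEquation

section Smallness

variable {B A : Type*} [NormedRing B] [NormedAlgebra ℂ B] [NormedRing A] [NormedAlgebra ℂ A]
  {S : BBSpace B A} {Γ : ℝ}

namespace IsBound

variable (hS : S.IsBound Γ)

include hS

theorem mul_norm_le_half {Z : A} (hZ : ‖Z‖ ≤ 1 / (4 * Γ ^ 3)) : Γ * ‖Z‖ ≤ 1 / 2 := by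
  have hΓ := hS.one_le
  calc Γ * ‖Z‖ ≤ Γ * (1 / (4 * Γ ^ 3)) := by gcongr
    _ = 1 / (4 * Γ ^ 2) := by field_simp
    _ ≤ 1 / 2 := by gcongr; nlinarith

theorem mul_norm_insAfter_momentSum_le_half {z : S.Letter}
    (hz : ‖(z.2 : A)‖ ≤ 1 / (4 * Γ ^ 3)) :
    Γ * ‖((z.insAfter (momentSum z)).2 : A)‖ ≤ 1 / 2 :=
  mul_norm_le_half_of_norm_le_mul (zero_lt_one.trans_le hS.one_le)
    (hS.norm_momentSum_le (hS.mul_norm_le_half hz)) hz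
    (norm_insAfter_le hS.norm_L_le hS.norm_R_le z _)

variable [CompleteSpace B] {X Y : A} (hX : X ∈ S.leftAlgebra) (hY : Y ∈ S.rightAlgebra)
  {b c d : B} (hb : ‖S.L b * X‖ ≤ 1 / (4 * Γ ^ 3)) (hd : ‖S.R d * Y‖ ≤ 1 / (4 * Γ ^ 3))

include hX hY hb hd

theorem cConverges_mul_Ml_Mr (a : B) :
    S.CConverges X Y (S.Ml X b * b) a (d * S.Mr Y d) := by
  have hb' := hS.mul_norm_le_half hb
  have hd' := hS.mul_norm_le_half hd
  refine hS.cConverges hX hY ?_ ?_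
  · rw [hS.Ml_eq_momentSum hX hb', S.L_mul, mul_assoc]
    exact mul_norm_le_half_of_norm_le_mul (zero_lt_one.trans_le hS.one_le)
      (hS.norm_momentSum_le (z := leftLetter hX b) hb') hb ((norm_mul_le _ _).trans
        (mul_le_mul_of_nonneg_right (hS.norm_L_le _) (norm_nonneg _)))
  · have := hS.mul_norm_insAfter_momentSum_le_half (z := rightLetter hY d) hd
    rw [← hS.Mr_eq_momentSum hY hd', ← rightLetter_mul] at this
    exact this

theorem functional_equation_of_norm_le :
    S.Ml X b * S.M X Y b c d + S.M X Y b c d * S.Mr Y d =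
      S.Ml X b * c * S.Mr Y d
        + S.C X Y (S.Ml X b * b) (S.M X Y b c d) (d * S.Mr Y d) := by
  have hb' := hS.mul_norm_le_half hb
  have hd' := hS.mul_norm_le_half hd
  refine hS.functional_equation hX hY hb' hd' ?_ ?_ (hS.cConverges_mul_Ml_Mr hX hY hb hd _)
  · rw [hS.Mr_eq_momentSum hY hd']
    exact hS.mul_norm_insAfter_momentSum_le_half hd
  · rw [hS.Ml_eq_momentSum hX hb']
    exact hS.mul_norm_insAfter_momentSum_le_half hb

end IsBound

end Smallness

end BBSpace

end BiFree

end

theorem mainTheorem3_general {B A : Type*}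
    [NormedRing B] [NormedAlgebra ℂ B] [CompleteSpace B] [NormedRing A] [NormedAlgebra ℂ A]
    (S : BiFree.BBSpace B A) (hS : S.IsBanach)
    (X Y : A) (hX : X ∈ S.leftAlgebra) (hY : Y ∈ S.rightAlgebra) :
    ∃ δ : ℝ, 0 < δ ∧ ∀ b c d : B, ‖b‖ < δ → ‖d‖ < δ →
      S.MlConverges X b ∧ S.MrConverges Y d ∧ S.MConverges X Y b c d ∧ S.CConverges X Y b c d ∧
      S.CConverges X Y (S.Ml X b * b) (S.M X Y b c d) (d * S.Mr Y d) ∧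
      S.Ml X b * S.M X Y b c d + S.M X Y b c d * S.Mr Y d =
        S.Ml X b * c * S.Mr Y d
          + S.C X Y (S.Ml X b * b) (S.M X Y b c d) (d * S.Mr Y d) := by
  obtain ⟨Γ, hΓ⟩ := hS.exists_isBound
  have hε : 0 < 1 / (4 * Γ ^ 3) := by have := hΓ.one_le; positivity
  obtain ⟨δ₁, hδ₁, hleft⟩ := BiFree.exists_pos_forall_norm_mul_le hΓ.norm_L_le X hε
  obtain ⟨δ₂, hδ₂, hright⟩ := BiFree.exists_pos_forall_norm_mul_le hΓ.norm_R_le Y hε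
  refine ⟨min δ₁ δ₂, lt_min hδ₁ hδ₂, fun b c d hb hd => ?_⟩
  have hbX := hleft b (hb.trans_le (min_le_left _ _))
  have hdY := hright d (hd.trans_le (min_le_right _ _))
  have hbX' := hΓ.mul_norm_le_half hbX
  have hdY' := hΓ.mul_norm_le_half hdY
  exact ⟨hΓ.mlConverges hX hbX', hΓ.mrConverges hY hdY', hΓ.mConverges hX hY hbX' hdY',
    hΓ.cConverges hX hY hbX' hdY', hΓ.cConverges_mul_Ml_Mr hX hY hbX hdY _,
    hΓ.functional_equation_of_norm_le hX hY hbX hdY⟩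

theorem mainTheorem3 {B A : Type*}
    [NormedRing B] [NormedAlgebra ℂ B] [CompleteSpace B]
    [NormedRing A] [NormedAlgebra ℂ A] [CompleteSpace A]
    (S : BiFree.BBSpace B A) (hS : S.IsBanach)
    (X Y : A) (hX : X ∈ S.leftAlgebra) (hY : Y ∈ S.rightAlgebra) :
    ∃ δ : ℝ, 0 < δ ∧ ∀ b c d : B, ‖b‖ < δ → ‖d‖ < δ →
      S.MlConverges X b ∧ S.MrConverges Y d ∧ S.MConverges X Y b c d ∧ S.CConverges X Y b c d ∧
      S.CConverges X Y (S.Ml X b * b) (S.M X Y b c d) (d * S.Mr Y d) ∧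
      S.Ml X b * S.M X Y b c d + S.M X Y b c d * S.Mr Y d =
        S.Ml X b * c * S.Mr Y d
          + S.C X Y (S.Ml X b * b) (S.M X Y b c d) (d * S.Mr Y d) :=
  mainTheorem3_general S hS X Y hX hY
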